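/- \textbf{Setting.} Fix $T>0$, $\alpha\in(1/3,1/2]$. Write $\delta Z_{s,t}=Z_t-Z_s$. All H\"older-type bounds below are over $0\le s<t\le T$. A weakly geometric $\alpha$-H\"older rough path $\mathbf Z=(Z,\mathbb Z)$ over $\mathbb R^{d_Z}$ on $[0,T]$ consists of $Z:[0,T]\to\mathbb R^{d_Z}$ and $\mathbb Z_{s,t}\in\mathbb R^{d_Z}\otimes\mathbb R^{d_Z}$ with $|\delta Z_{s,t}|\lesssim|t-s|^{\alpha}$, $|\mathbb Z_{s,t}|\lesssim|t-s|^{2\alpha}$, $\mathbb Z_{s,t}=\mathbb Z_{s,u}+\mathbb Z_{u,t}+\delta Z_{s,u}\otimes\delta Z_{u,t}$ for $s\le u\le t$, and $\delta Z_{s,t}\otimes\delta Z_{s,t}=2\,\mathrm{Sym}(\mathbb Z_{s,t})$. A pair $(H,H')$, with $H'_t$ linear from $\mathbb R^{d_Z}$ to the value space of $H$, is $Z$-controlled on an interval if there $|\delta H_{s,t}-H'_s\delta Z_{s,t}|\lesssim|t-s|^{2\alpha}$ and $|\delta H'_{s,t}|\lesssim|t-s|^{\alpha}$. A tuple $(Y,Y',Y'',\dot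 Y)$ with values in $U\times\mathcal L(\mathbb R^{d_Z};U)\times\mathcal L(\mathbb R^{d_Z}\otimes\mathbb R^{d_Z};U)\times U$ is strongly $\mathbf Z$-controlled if $(Y',Y'')$ is $Z$-controlled, $\dot Y$ is $\alpha$-H\"older, and $|\delta Y_{s,t}-Y'_s\delta Z_{s,t}-Y''_s\mathbb Z_{s,t}-\dot Y_s(t-s)|\lesssim|t-s|^{3\alpha}$. The rough integral $\int_s^t(H,H')_r\circ d\mathbf Z_r$ is the limit, as the mesh of partitions of $[s,t]$ tends to $0$, of $\sum_{[u,v]}\big(H_u\,\delta Z_{u,v}+H'_u\,\mathbb Z_{u,v}\big)$, where $H'_u\in\mathcal L(\mathbb R^{d_Z};\mathcal L(\mathbb R^{d_Z};U))\cong\mathcal L(\mathbb R^{d_Z}\otimes\mathbb R^{d_Z};U)$. For an integer $k\ge0$, $g\in\mathrm{Lip}^{k+1}$ means that $g$ is $C^k$, that $g$ and its derivatives up to order $k$ are bounded, and that $D^kg$ is Lipschitz. For a map $u$ on $\mathbb R^{d_X}$ put $\Gamma u(x)=Du(x)\,\sigma(x)$. \textbf{Lemma (rough Alekseev--Gr\"obner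 formula).} Let $\mathbf Z=(Z,\mathbb Z)$ be a weakly geometric $\alpha$-H\"older rough path over $\mathbb R^{d_Z}$ on $[0,T]$, and let $(Y,Y',Y'',\dot Y)$ be strongly $\mathbf Z$-controlled with values in $\mathbb R^{d_X}$. Let $\mu\in\mathrm{Lip}^3(\mathbb R^{d_X};\mathbb R^{d_X})$ and $\sigma\in\mathrm{Lip}^5(\mathbb R^{d_X};\mathbb R^{d_X\times d_Z})$. Let $f:\mathbb R^{d_X}\to\mathbb R^{d_X}$ be $C^2$ with locally Lipschitz second derivative (for instance $f\in C^3$). (i) For all $t\in[0,T]$ and $x\in\mathbb R^{d_X}$, the rough differential equation $$dX_s=\mu(X_s)\,ds+\sigma(X_s)\,d\mathbf Z_s,\qquad X_t=x,$$ has exactly one solution $X^{t,x;\mathbf Z}$ on $[t,T]$. Here a solution is a path $X$ with $X_t=x$ such that $(X,\sigma(X))$ is $Z$-controlled on $[t,T]$ and $X_s=x+\int_t^s\mu(X_r)\,dr+\int_t^s\big(\sigma(X),(\Gamma\sigma)(X)\big)_r\,d\mathbf Z_r$ for all $s\in[t,T]$. (ii) Put $F_t(x)=f(X_T^{t,x;\mathbf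 Z})$. Then $F_t\in C^2$ for every $t\in[0,T]$. With $$H_r=DF_r(Y_r)\,(Y'_r-\sigma(Y_r)),$$ $$H'_r=DF_r(Y_r)Y''_r+(\Gamma^2F_r)^{\top}(Y_r)-D(\Gamma F_r)(Y_r)Y'_r-\big(D(\Gamma F_r)(Y_r)Y'_r\big)^{\top}+D^2F_r(Y_r)(Y'_r,Y'_r),$$ where $\top$ exchanges the two arguments of a bilinear map, the pair $(H,H')$ is $Z$-controlled on $[0,T]$. Moreover, for all $0\le s\le t\le T$, the function $r\mapsto DF_r(Y_r)(\dot Y_r-\mu(Y_r))$ is integrable on $[s,t]$, the rough integral below exists, and $$F_t(Y_t)-F_s(Y_s)=\int_s^tDF_r(Y_r)\,(\dot Y_r-\mu(Y_r))\,dr+\int_s^tDF_r(Y_r)\,(Y'_r-\sigma(Y_r))\circ d\mathbf Z_r,$$ where the last integral is $\int_s^t(H,H')_r\circ d\mathbf Z_r$. -/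

import Mathlib

noncomputable section

/-- The functions of class `Lip^(k+1)` in the sense of Stein on a whole normed space: `f` is `k` times
continuously differentiable, `f` and its derivatives up to order `k` are bounded, and the `k`-th
derivative is Lipschitz continuous. -/
def IsSteinLip {W U : Type*} [NormedAddCommGroup W] [NormedSpace ℝ W]
    [NormedAddCommGroup U] [NormedSpace ℝ U] (k : ℕ) (f : W → U) : Prop :=
  ContDiff ℝ k f ∧ ∃ M : ℝ,
    (∀ j ≤ k, ∀ x, ‖iteratedFDeriv ℝ j f x‖ ≤ M) ∧
    ∀ x y, ‖iteratedFDeriv ℝ k f x - iteratedFDeriv ℝ k f y‖ ≤ M * ‖x - y‖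

/-- A bilinear map `A`, seen as a linear map on `ℝᵐ ⊗ ℝᵐ`, evaluated at the tensor
`∑ i j, M i j • (e i ⊗ e j)`. -/
def contract {m : ℕ} {U : Type*} [NormedAddCommGroup U] [NormedSpace ℝ U]
    (A : EuclideanSpace ℝ (Fin m) →L[ℝ] EuclideanSpace ℝ (Fin m) →L[ℝ] U)
    (M : Matrix (Fin m) (Fin m) ℝ) : U :=
  ∑ i, ∑ j, M i j • A (EuclideanSpace.single i 1) (EuclideanSpace.single j 1)

/-- `(Z, ZZ)` is a weakly geometric `α`-Hölder rough path over `ℝᵐ` on `[0, T]`: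
`ZZ s t i j` is the `(i, j)` coordinate of the second level `∫ (Z_r - Z_s) ⊗ dZ_r` over `[s, t]`.
Only the values at `0 ≤ s ≤ t ≤ T` matter. -/
structure IsWeaklyGeometricRoughPath {m : ℕ} (α T : ℝ) (Z : ℝ → EuclideanSpace ℝ (Fin m))
    (ZZ : ℝ → ℝ → Matrix (Fin m) (Fin m) ℝ) : Prop where
  holder_path : ∃ C : ℝ, ∀ s t, 0 ≤ s → s < t → t ≤ T → ‖Z t - Z s‖ ≤ C * (t - s) ^ α
  holder_area : ∃ C : ℝ, ∀ s t, 0 ≤ s → s < t → t ≤ T →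
    ∀ i j, |ZZ s t i j| ≤ C * (t - s) ^ (2 * α)
  chen : ∀ s u t, 0 ≤ s → s ≤ u → u ≤ t → t ≤ T →
    ∀ i j, ZZ s t i j = ZZ s u i j + ZZ u t i j + (Z u i - Z s i) * (Z t j - Z u j)
  bracket_eq_zero : ∀ s t, 0 ≤ s → s ≤ t → t ≤ T →
    ∀ i j, (Z t i - Z s i) * (Z t j - Z s j) - (ZZ s t i j + ZZ s t j i) = 0

/-- `(Y, Y')` is a `Z`-controlled rough path on `[a, b]`. -/
structure IsControlled {m : ℕ} {U : Type*} [NormedAddCommGroup U] [NormedSpace ℝ U]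
    (α a b : ℝ) (Z : ℝ → EuclideanSpace ℝ (Fin m))
    (Y : ℝ → U) (Y' : ℝ → EuclideanSpace ℝ (Fin m) →L[ℝ] U) : Prop where
  expansion : ∃ C : ℝ, ∀ s t, a ≤ s → s < t → t ≤ b →
    ‖Y t - Y s - Y' s (Z t - Z s)‖ ≤ C * (t - s) ^ (2 * α)
  holder_deriv : ∃ C : ℝ, ∀ s t, a ≤ s → s < t → t ≤ b → ‖Y' t - Y' s‖ ≤ C * (t - s) ^ α

/-- `(Y, Y', Y'', Ydot)` is a strongly `(Z, ZZ)`-controlled rough path on `[0, T]`.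
An element of `L(V ⊗ V; U)` is a continuous bilinear map, with `Y'' (v ⊗ w) = Y'' v w`. -/
structure IsStronglyControlled {m : ℕ} {U : Type*} [NormedAddCommGroup U] [NormedSpace ℝ U]
    (α T : ℝ) (Z : ℝ → EuclideanSpace ℝ (Fin m)) (ZZ : ℝ → ℝ → Matrix (Fin m) (Fin m) ℝ)
    (Y : ℝ → U) (Y' : ℝ → EuclideanSpace ℝ (Fin m) →L[ℝ] U)
    (Y'' : ℝ → EuclideanSpace ℝ (Fin m) →L[ℝ] EuclideanSpace ℝ (Fin m) →L[ℝ] U)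
    (Ydot : ℝ → U) : Prop where
  expansion : ∃ C : ℝ, ∀ s t, 0 ≤ s → s < t → t ≤ T →
    ‖Y t - Y s - Y' s (Z t - Z s) - contract (Y'' s) (ZZ s t) - (t - s) • Ydot s‖
      ≤ C * (t - s) ^ (3 * α)
  controlled_deriv : IsControlled α 0 T Z Y' Y''
  holder_dot : ∃ C : ℝ, ∀ s t, 0 ≤ s → s < t → t ≤ T → ‖Ydot t - Ydot s‖ ≤ C * (t - s) ^ α

/-- `I` is the rough integral `∫ (H, H') d(Z, ZZ)` over `[s, t]`: the limit of the compensated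
Riemann sums along all partitions `s = p 0 ≤ p 1 ≤ ... ≤ p n = t` as the mesh tends to zero. -/
def HasRoughIntegral {m : ℕ} {U : Type*} [NormedAddCommGroup U] [NormedSpace ℝ U]
    (Z : ℝ → EuclideanSpace ℝ (Fin m)) (ZZ : ℝ → ℝ → Matrix (Fin m) (Fin m) ℝ)
    (H : ℝ → EuclideanSpace ℝ (Fin m) →L[ℝ] U)
    (H' : ℝ → EuclideanSpace ℝ (Fin m) →L[ℝ] EuclideanSpace ℝ (Fin m) →L[ℝ] U)
    (s t : ℝ) (I : U) : Prop :=
  ∀ ε > 0, ∃ δ > 0, ∀ (n : ℕ) (p : ℕ → ℝ), p 0 = s → p n = t →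
    (∀ k < n, p k ≤ p (k + 1) ∧ p (k + 1) - p k < δ) →
    ‖(∑ k ∈ Finset.range n, (H (p k) (Z (p (k + 1)) - Z (p k))
        + contract (H' (p k)) (ZZ (p k) (p (k + 1))))) - I‖ < ε

/-- The operator `Γ u = (D u) σ`. -/
def gammaOp {m : ℕ} {W U : Type*} [NormedAddCommGroup W] [NormedSpace ℝ W]
    [NormedAddCommGroup U] [NormedSpace ℝ U]
    (σ : W → EuclideanSpace ℝ (Fin m) →L[ℝ] W) (u : W → U) (x : W) :
    EuclideanSpace ℝ (Fin m) →L[ℝ] U :=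
  (fderiv ℝ u x).comp (σ x)

/-- `X` solves the rough differential equation `dX_s = μ(X_s) ds + σ(X_s) d(Z, ZZ)_s` on `[t, T]`
with `X_t = x`: the pair `(X, σ(X))` is `Z`-controlled and the integral equation holds, where
`σ(X)` has the Gubinelli derivative `Dσ(X) σ(X) = (Γ σ)(X)`. -/
structure IsRDESolution {m : ℕ} {W : Type*} [NormedAddCommGroup W] [NormedSpace ℝ W]
    (α T : ℝ) (Z : ℝ → EuclideanSpace ℝ (Fin m)) (ZZ : ℝ → ℝ → Matrix (Fin m) (Fin m) ℝ)
    (μ : W → W) (σ : W → EuclideanSpace ℝ (Fin m) →L[ℝ] W) (t : ℝ) (x : W) (X : ℝ → W) :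
    Prop where
  initial : X t = x
  controlled : IsControlled α t T Z X (fun r => σ (X r))
  equation : ∀ s ∈ Set.Icc t T,
    HasRoughIntegral Z ZZ (fun r => σ (X r)) (fun r => gammaOp σ σ (X r)) t s
      (X s - x - ∫ r in t..s, μ (X r))

/-- The integrand `DF_r(Y_r) (Y'_r - σ(Y_r))`. -/
def agIntegrand {m : ℕ} {W U : Type*} [NormedAddCommGroup W] [NormedSpace ℝ W]
    [NormedAddCommGroup U] [NormedSpace ℝ U]
    (σ : W → EuclideanSpace ℝ (Fin m) →L[ℝ] W) (F : ℝ → W → U)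
    (Y : ℝ → W) (Y' : ℝ → EuclideanSpace ℝ (Fin m) →L[ℝ] W) (r : ℝ) :
    EuclideanSpace ℝ (Fin m) →L[ℝ] U :=
  (fderiv ℝ (F r) (Y r)).comp (Y' r - σ (Y r))

/-- The Gubinelli derivative of `agIntegrand`,
`DF(Y) Y'' + (Γ²F)ᵀ(Y) - D(ΓF)(Y) Y' - (D(ΓF)(Y) Y')ᵀ + D²F(Y)(Y', Y')`, the transpose being the
exchange of the two arguments of a bilinear map; this is the chain rule for a field `F` whose
Gubinelli derivatives of first and second order are `-ΓF` and `(Γ²F)ᵀ`. -/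
def agIntegrandDeriv {m : ℕ} {W U : Type*} [NormedAddCommGroup W] [NormedSpace ℝ W]
    [NormedAddCommGroup U] [NormedSpace ℝ U]
    (σ : W → EuclideanSpace ℝ (Fin m) →L[ℝ] W) (F : ℝ → W → U)
    (Y : ℝ → W) (Y' : ℝ → EuclideanSpace ℝ (Fin m) →L[ℝ] W)
    (Y'' : ℝ → EuclideanSpace ℝ (Fin m) →L[ℝ] EuclideanSpace ℝ (Fin m) →L[ℝ] W) (r : ℝ) :
    EuclideanSpace ℝ (Fin m) →L[ℝ] EuclideanSpace ℝ (Fin m) →L[ℝ] U :=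
  (ContinuousLinearMap.compL ℝ (EuclideanSpace ℝ (Fin m)) W U (fderiv ℝ (F r) (Y r))).comp (Y'' r)
    + (gammaOp σ (gammaOp σ (F r)) (Y r)).flip
    - (fderiv ℝ (gammaOp σ (F r)) (Y r)).comp (Y' r)
    - ((fderiv ℝ (gammaOp σ (F r)) (Y r)).comp (Y' r)).flip
    + (fderiv ℝ (fderiv ℝ (F r)) (Y r)).bilinearComp (Y' r) (Y' r)

end

/-! Write `Φ u v` for the flow of the rough equation from time `u` to `v`. Since solutions are
unique, `F u = F v ∘ Φ u v`, so that `F v (Y v) - F u (Y u) = F v (Y v) - F v (Φ u v (Y u))`. Both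
arguments on the right are close to `Y u`, and both have expansions there in terms of `Z v - Z u`,
`ZZ u v` and `v - u` with error of order `(v - u) ^ (3 * α)`. A second order Taylor expansion of `F
v` at `Y u`, followed by the replacement of the derivatives of `F v` by those of `F u`, leaves
exactly one compensated term of the rough integral plus one drift term, up to the same error
(`IsTransported.expansion`). As `3 * α > 1`, such errors disappear when summed over fine partitions
(`hasRoughIntegral_of_local`). The replacement of `F v` by `F u` is the backward equation in
integrated form: `F u - F v` is `ΓF (Z v - Z u)` to first order (`IsTransported.transportOrd`). Weak
geometricity enters through `contract_agIntegrandDeriv`: symmetric bilinear forms contracted with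
`ZZ u v` become half their value at `Z v - Z u`, which matches the quadratic Taylor terms.

This needs a flow with two derivatives, the second one Lipschitz. Solutions are understood in the
sense of Davie: the increment over `[u, v]` agrees with one second order Euler step up to `(v - u) ^
(3 * α)`. Euler schemes on uniform grids are estimated by a discrete sewing lemma
(`discrete_sewing`, `scheme_apriori`, `scheme_stability`). A Davie solution sampled on a grid, and
an Euler scheme of half the step sampled at every second node, are both approximate Euler schemes;
so the single estimate `approx_scheme_stability` yields uniqueness, Lipschitz dependence,
convergence and existence. `IsRDESolution.isDavie` and `IsDavie.isRDESolution` translate to and from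
the integral equation.

Differentiability of the flow comes from the tangent map `(x, v) ↦ (f x, Df(x) v)`, which commutes
with Euler steps (`eulerStep_tan`). Derivatives of Euler iterates are therefore Euler iterates of
the tangent system, and applying the convergence theorem to the twice iterated tangent system gives
uniform convergence of the first two derivatives (`local_flow`). Two tangents cost two derivatives
and the basic estimates need two more for `σ` and none for `μ`, which accounts for the classes
`IsSteinLip 4` and `IsSteinLip 2`. -/

section

open Set Filter Topology

set_option linter.unusedSectionVars false
set_option maxSynthPendingDepth 3

/-! ### Contraction of bilinear maps with the second level. -/

section Contract

variable {m : ℕ} {U U' : Type*} [NormedAddCommGroup U] [NormedSpace ℝ U]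
  [NormedAddCommGroup U'] [NormedSpace ℝ U']

/-- `contract · M` as a continuous linear map. -/
noncomputable def contractL (U : Type*) [NormedAddCommGroup U] [NormedSpace ℝ U]
    (M : Matrix (Fin m) (Fin m) ℝ) :
    (EuclideanSpace ℝ (Fin m) →L[ℝ] EuclideanSpace ℝ (Fin m) →L[ℝ] U) →L[ℝ] U :=
  ∑ i, ∑ j, M i j • ((ContinuousLinearMap.apply ℝ U (EuclideanSpace.single j (1 : ℝ))).comp
    (ContinuousLinearMap.apply ℝ (EuclideanSpace ℝ (Fin m) →L[ℝ] U)
      (EuclideanSpace.single i (1 : ℝ))))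

theorem contractL_apply (M : Matrix (Fin m) (Fin m) ℝ)
    (A : EuclideanSpace ℝ (Fin m) →L[ℝ] EuclideanSpace ℝ (Fin m) →L[ℝ] U) :
    contractL U M A = contract A M := by
  simp [contractL, contract]

theorem contract_add (A B : EuclideanSpace ℝ (Fin m) →L[ℝ] EuclideanSpace ℝ (Fin m) →L[ℝ] U)
    (M : Matrix (Fin m) (Fin m) ℝ) : contract (A + B) M = contract A M + contract B M := by
  simp only [← contractL_apply, map_add]

theorem contract_sub (A B : EuclideanSpace ℝ (Fin m) →L[ℝ] EuclideanSpace ℝ (Fin m) →L[ℝ] U)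
    (M : Matrix (Fin m) (Fin m) ℝ) : contract (A - B) M = contract A M - contract B M := by
  simp only [← contractL_apply, map_sub]

theorem contract_map (g : U →L[ℝ] U')
    {A : EuclideanSpace ℝ (Fin m) →L[ℝ] EuclideanSpace ℝ (Fin m) →L[ℝ] U}
    {B : EuclideanSpace ℝ (Fin m) →L[ℝ] EuclideanSpace ℝ (Fin m) →L[ℝ] U'}
    (h : ∀ v w, B v w = g (A v w)) (M : Matrix (Fin m) (Fin m) ℝ) :
    contract B M = g (contract A M) := by
  simp [contract, h, map_sum]

theorem norm_contract_le (A : EuclideanSpace ℝ (Fin m) →L[ℝ] EuclideanSpace ℝ (Fin m) →L[ℝ] U)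
    (M : Matrix (Fin m) (Fin m) ℝ) : ‖contract A M‖ ≤ ‖A‖ * ∑ i, ∑ j, |M i j| := by
  unfold contract
  rw [Finset.mul_sum]
  refine (norm_sum_le _ _).trans (Finset.sum_le_sum fun i _ => ?_)
  rw [Finset.mul_sum]
  refine (norm_sum_le _ _).trans (Finset.sum_le_sum fun j _ => ?_)
  rw [norm_smul, Real.norm_eq_abs, mul_comm]
  gcongr
  refine (A.le_opNorm₂ _ _).trans (le_of_eq ?_)
  simp

theorem contract_vecMulVec
    (A : EuclideanSpace ℝ (Fin m) →L[ℝ] EuclideanSpace ℝ (Fin m) →L[ℝ] U)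
    (v w : EuclideanSpace ℝ (Fin m)) : contract A (Matrix.of fun i j => v i * w j) = A v w := by
  have hv : ∀ v : EuclideanSpace ℝ (Fin m), v = ∑ i, v i • EuclideanSpace.single i (1 : ℝ) := by
    intro v
    conv_lhs => rw [← (EuclideanSpace.basisFun (Fin m) ℝ).sum_repr v]
    simp
  conv_rhs => rw [hv v, hv w]
  simp only [contract, Matrix.of_apply, map_sum, map_smul, sum_apply, Finset.smul_sum,
    smul_apply, smul_smul]
  rw [Finset.sum_comm]
  refine Finset.sum_congr rfl fun i _ => Finset.sum_congr rfl fun j _ => ?_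
  rw [mul_comm]

theorem contract_add_matrix
    (A : EuclideanSpace ℝ (Fin m) →L[ℝ] EuclideanSpace ℝ (Fin m) →L[ℝ] U)
    (M N : Matrix (Fin m) (Fin m) ℝ) : contract A (M + N) = contract A M + contract A N := by
  simp [contract, add_smul, Finset.sum_add_distrib]

theorem contract_flip
    (A : EuclideanSpace ℝ (Fin m) →L[ℝ] EuclideanSpace ℝ (Fin m) →L[ℝ] U)
    (M : Matrix (Fin m) (Fin m) ℝ) : contract A.flip M = contract A M.transpose := by
  simp only [contract, ContinuousLinearMap.flip_apply, Matrix.transpose_apply]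
  rw [Finset.sum_comm]

end Contract

/-! ### A discrete sewing lemma. -/

section Sewing

theorem rpow_add_rpow_le_of_balanced {γ a b : ℝ} (hγ : 1 < γ) (ha : 0 < a) (hb : 0 < b)
    (hab : a ≤ 2 / 3 * (a + b)) (hba : b ≤ 2 / 3 * (a + b)) :
    a ^ γ + b ^ γ ≤ (2 / 3) ^ (γ - 1) * (a + b) ^ γ := by
  have key : ∀ c : ℝ, 0 < c → c ≤ 2 / 3 * (a + b) →
      c ^ γ ≤ c * ((2 / 3) ^ (γ - 1) * (a + b) ^ (γ - 1)) := by
    intro c hc h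
    have : c ^ γ = c * c ^ (γ - 1) := by
      rw [← Real.rpow_one_add' hc.le (by linarith)]; congr 1; ring
    rw [this, ← Real.mul_rpow (by norm_num) (by linarith)]
    gcongr
  have : (a + b) ^ γ = (a + b) * (a + b) ^ (γ - 1) := by
    rw [← Real.rpow_one_add' (by linarith) (by linarith)]; congr 1; ring
  rw [this]
  nlinarith [key a ha hab, key b hb hba]

/-- Discrete sewing along a uniform grid of step `d`. -/
theorem discrete_sewing {U : Type*} [NormedAddCommGroup U] {γ d ρ : ℝ} (hγ : 1 < γ) (hd : 0 < d)
    (hρ : 0 ≤ ρ) {N : ℕ} {R : ℕ → ℕ → U} (h1 : ∀ k < N, R k (k + 1) = 0)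
    (h : ∀ k n p, 0 < n → 0 < p → k + n + p ≤ N → ‖R k (k + n)‖ ≤ ρ * (n * d) ^ γ →
      ‖R k (k + n + p) - R k (k + n) - R (k + n) (k + n + p)‖
        ≤ (1 - (2 / 3) ^ (γ - 1)) * ρ * ((n + p : ℕ) * d) ^ γ) :
    ∀ n k, 0 < n → k + n ≤ N → ‖R k (k + n)‖ ≤ ρ * (n * d) ^ γ := by
  intro n
  induction n using Nat.strong_induction_on with
  | _ n ih =>
    intro k hn hk
    rcases Nat.lt_or_ge n 2 with h2 | h2
    · obtain rfl : n = 1 := by omega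
      rw [h1 k (by omega), norm_zero]
      positivity
    -- Cutting a block of at least two steps in the middle leaves pieces of at most two thirds of
    -- its length; the worst case is three steps.
    · obtain ⟨a, b, ha, hb, rfl, h3, h4⟩ : ∃ a b : ℕ, 0 < a ∧ 0 < b ∧ n = a + b ∧
          3 * a ≤ 2 * (a + b) ∧ 3 * b ≤ 2 * (a + b) :=
        ⟨n / 2, n - n / 2, by omega, by omega, by omega, by omega, by omega⟩
      have ea := ih a (by omega) k ha (by omega)
      have eb := ih b (by omega) (k + a) hb (by omega)
      have hdef := h k a b ha hb (by omega) ea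
      have hsplit : R k (k + (a + b)) = (R k (k + a + b) - R k (k + a) - R (k + a) (k + a + b))
          + R k (k + a) + R (k + a) (k + a + b) := by
        rw [← add_assoc]; abel
      rw [hsplit]
      have h3' : (3 : ℝ) * a ≤ 2 * (a + b) := by exact_mod_cast h3
      have h4' : (3 : ℝ) * b ≤ 2 * (a + b) := by exact_mod_cast h4
      have ha' : (0 : ℝ) < a := by exact_mod_cast ha
      have hb' : (0 : ℝ) < b := by exact_mod_cast hb
      have hp := rpow_add_rpow_le_of_balanced (a := a * d) (b := b * d) hγ (by positivity)
        (by positivity) (by nlinarith) (by nlinarith)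
      rw [← add_mul] at hp
      push_cast at hdef ⊢
      -- The two halves contribute at most the fraction `(2 / 3) ^ (γ - 1)` of the claimed bound,
      -- and the defect is allowed precisely the rest, so the constant `ρ` does not grow through the
      -- induction.
      calc _ ≤ (1 - (2 / 3) ^ (γ - 1)) * ρ * (((a : ℝ) + b) * d) ^ γ + ρ * (a * d) ^ γ
            + ρ * (b * d) ^ γ := norm_add₃_le.trans (by gcongr)
        _ ≤ _ := by nlinarith [mul_le_mul_of_nonneg_left hp hρ]

end Sewing

/-! ### Taylor estimates along segments, and differences of such estimates. -/

section Taylor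

variable {W U : Type*} [NormedAddCommGroup W] [NormedSpace ℝ W]
  [NormedAddCommGroup U] [NormedSpace ℝ U]

theorem hasDerivAt_comp_segment {g : W → U} (hg : Differentiable ℝ g) (x x' : W) (θ : ℝ) :
    HasDerivAt (fun θ : ℝ => g (x + θ • (x' - x))) (fderiv ℝ g (x + θ • (x' - x)) (x' - x)) θ := by
  have h1 : HasDerivAt (fun θ : ℝ => x + θ • (x' - x)) (x' - x) θ := by
    simpa using ((hasDerivAt_id θ).smul_const (x' - x)).const_add x
  exact (hg _).hasFDerivAt.comp_hasDerivAt θ h1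

theorem segment_mem {S : Set W} (hS : Convex ℝ S) {x x' : W} (hx : x ∈ S) (hx' : x' ∈ S) {θ : ℝ}
    (h0 : 0 ≤ θ) (h1 : θ < 1) : x + θ • (x' - x) ∈ S := by
  exact hS.add_smul_sub_mem hx hx' ⟨h0, h1.le⟩

theorem norm_segment_sub_le (x x' y y' : W) {θ : ℝ} (h0 : 0 ≤ θ) (h1 : θ < 1) :
    ‖x + θ • (x' - x) - (y + θ • (y' - y))‖ ≤ ‖x - y‖ + ‖x' - y'‖ := by
  have : x + θ • (x' - x) - (y + θ • (y' - y)) = (1 - θ) • (x - y) + θ • (x' - y') := by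
    module
  rw [this]
  refine (norm_add_le _ _).trans ?_
  rw [norm_smul, norm_smul, Real.norm_of_nonneg h0, Real.norm_of_nonneg (by linarith)]
  nlinarith [norm_nonneg (x - y), norm_nonneg (x' - y')]

theorem norm_segment_sub_left_le (x x' : W) {θ : ℝ} (h0 : 0 ≤ θ) (h1 : θ < 1) :
    ‖x + θ • (x' - x) - x‖ ≤ ‖x' - x‖ := by
  rw [add_sub_cancel_left, norm_smul, Real.norm_of_nonneg h0]
  nlinarith [norm_nonneg (x' - x)]

theorem norm_taylor_one_le {g : W → U} (hg : Differentiable ℝ g) {S : Set W} (hS : Convex ℝ S)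
    {L : ℝ} (hlip : ∀ x ∈ S, ∀ y ∈ S, ‖fderiv ℝ g x - fderiv ℝ g y‖ ≤ L * ‖x - y‖) {x x' : W}
    (hL : 0 ≤ L) (hx : x ∈ S) (hx' : x' ∈ S) :
    ‖g x' - g x - fderiv ℝ g x (x' - x)‖ ≤ L * ‖x' - x‖ ^ 2 := by
  have hd : ∀ θ ∈ Icc (0 : ℝ) 1, HasDerivWithinAt
      (fun θ : ℝ => g (x + θ • (x' - x)) - θ • fderiv ℝ g x (x' - x))
      (fderiv ℝ g (x + θ • (x' - x)) (x' - x) - fderiv ℝ g x (x' - x)) (Icc 0 1) θ := by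
    intro θ _
    have := ((hasDerivAt_id θ).smul_const (fderiv ℝ g x (x' - x)))
    rw [one_smul] at this
    exact ((hasDerivAt_comp_segment hg x x' θ).sub this).hasDerivWithinAt
  have := norm_image_sub_le_of_norm_deriv_le_segment_01' (C := L * ‖x' - x‖ ^ 2) hd ?_
  · simpa [sub_right_comm] using this
  · intro θ hθ
    rw [← sub_apply]
    refine (ContinuousLinearMap.le_opNorm _ _).trans ?_
    have h1 := hlip _ (segment_mem hS hx hx' hθ.1 hθ.2) _ hx
    have h2 := norm_segment_sub_left_le x x' hθ.1 hθ.2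
    calc _ ≤ (L * ‖x' - x‖) * ‖x' - x‖ := by gcongr; exact h1.trans (by gcongr)
      _ = _ := by ring

/-- Along the two segments run in parallel, the derivative of the difference splits into `Dg` on the
difference of the increments plus a difference of `Dg` on the second increment. -/
theorem norm_increment_sub_le {g : W → U} (hg : Differentiable ℝ g) {S : Set W}
    (hS : Convex ℝ S) {L : ℝ} (hbd : ∀ x ∈ S, ‖fderiv ℝ g x‖ ≤ L)
    (hlip : ∀ x ∈ S, ∀ y ∈ S, ‖fderiv ℝ g x - fderiv ℝ g y‖ ≤ L * ‖x - y‖) {x x' y y' : W}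
    (hL : 0 ≤ L) (hx : x ∈ S) (hx' : x' ∈ S) (hy : y ∈ S) (hy' : y' ∈ S) :
    ‖g x' - g x - (g y' - g y)‖
      ≤ L * ‖x' - x - (y' - y)‖ + L * (‖x - y‖ + ‖x' - y'‖) * ‖y' - y‖ := by
  have hd : ∀ θ ∈ Icc (0 : ℝ) 1, HasDerivWithinAt
      (fun θ : ℝ => g (x + θ • (x' - x)) - g (y + θ • (y' - y)))
      (fderiv ℝ g (x + θ • (x' - x)) (x' - x) - fderiv ℝ g (y + θ • (y' - y)) (y' - y))
      (Icc 0 1) θ := fun θ _ =>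
    ((hasDerivAt_comp_segment hg x x' θ).sub (hasDerivAt_comp_segment hg y y' θ)).hasDerivWithinAt
  have := norm_image_sub_le_of_norm_deriv_le_segment_01'
    (C := L * ‖x' - x - (y' - y)‖ + L * (‖x - y‖ + ‖x' - y'‖) * ‖y' - y‖) hd ?_
  · convert this using 2
    simp only [one_smul, zero_smul, add_zero, add_sub_cancel]
    abel
  · intro θ hθ
    have e : fderiv ℝ g (x + θ • (x' - x)) (x' - x) - fderiv ℝ g (y + θ • (y' - y)) (y' - y)
        = fderiv ℝ g (x + θ • (x' - x)) (x' - x - (y' - y))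
          + (fderiv ℝ g (x + θ • (x' - x)) - fderiv ℝ g (y + θ • (y' - y))) (y' - y) := by
      simp only [sub_apply, map_sub]; abel
    rw [e]
    have hp := segment_mem hS hx hx' hθ.1 hθ.2
    have hq := segment_mem hS hy hy' hθ.1 hθ.2
    refine (norm_add_le _ _).trans (add_le_add ?_ ?_)
    · exact (ContinuousLinearMap.le_opNorm _ _).trans (by gcongr; exact hbd _ hp)
    · refine (ContinuousLinearMap.le_opNorm _ _).trans ?_
      gcongr
      exact (hlip _ hp _ hq).trans (by gcongr; exact norm_segment_sub_le x x' y y' hθ.1 hθ.2)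

/-- Comparing two schemes requires Taylor remainders whose difference is linear in the distance of
the schemes while keeping the quadratic smallness in the increments. The first derivative's
increments along both segments are compared with `norm_increment_sub_le`. -/
theorem norm_taylor_one_sub_le {g : W → U} (hg : Differentiable ℝ g)
    (hg' : Differentiable ℝ (fderiv ℝ g)) {S : Set W}
    (hS : Convex ℝ S) {L : ℝ} (hlip' : ∀ x ∈ S, ∀ y ∈ S, ‖fderiv ℝ g x - fderiv ℝ g y‖ ≤ L * ‖x - y‖)
    (hbd : ∀ x ∈ S, ‖fderiv ℝ (fderiv ℝ g) x‖ ≤ L)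
    (hlip : ∀ x ∈ S, ∀ y ∈ S, ‖fderiv ℝ (fderiv ℝ g) x - fderiv ℝ (fderiv ℝ g) y‖ ≤ L * ‖x - y‖)
    {x x' y y' : W}
    (hL : 0 ≤ L) (hx : x ∈ S) (hx' : x' ∈ S) (hy : y ∈ S) (hy' : y' ∈ S) :
    ‖g x' - g x - fderiv ℝ g x (x' - x) - (g y' - g y - fderiv ℝ g y (y' - y))‖
      ≤ L * ‖x' - x - (y' - y)‖ * (‖x' - x‖ + ‖y' - y‖)
        + 2 * L * (‖x - y‖ + ‖x' - y'‖) * ‖y' - y‖ ^ 2 := by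
  have hd : ∀ θ ∈ Icc (0 : ℝ) 1, HasDerivWithinAt
      (fun θ : ℝ => g (x + θ • (x' - x)) - θ • fderiv ℝ g x (x' - x)
        - (g (y + θ • (y' - y)) - θ • fderiv ℝ g y (y' - y)))
      (fderiv ℝ g (x + θ • (x' - x)) (x' - x) - fderiv ℝ g x (x' - x)
        - (fderiv ℝ g (y + θ • (y' - y)) (y' - y) - fderiv ℝ g y (y' - y))) (Icc 0 1) θ := by
    intro θ _
    have h1 := ((hasDerivAt_id θ).smul_const (fderiv ℝ g x (x' - x)))
    have h2 := ((hasDerivAt_id θ).smul_const (fderiv ℝ g y (y' - y)))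
    rw [one_smul] at h1 h2
    exact (((hasDerivAt_comp_segment hg x x' θ).sub h1).sub
      ((hasDerivAt_comp_segment hg y y' θ).sub h2)).hasDerivWithinAt
  have := norm_image_sub_le_of_norm_deriv_le_segment_01'
    (C := L * ‖x' - x - (y' - y)‖ * (‖x' - x‖ + ‖y' - y‖)
        + 2 * L * (‖x - y‖ + ‖x' - y'‖) * ‖y' - y‖ ^ 2) hd ?_
  · convert this using 2
    simp only [one_smul, zero_smul, add_zero, add_sub_cancel, sub_zero]
    abel
  · intro θ hθ
    set p := x + θ • (x' - x) with hpdef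
    set q := y + θ • (y' - y) with hqdef
    have e : fderiv ℝ g p (x' - x) - fderiv ℝ g x (x' - x)
        - (fderiv ℝ g q (y' - y) - fderiv ℝ g y (y' - y))
        = (fderiv ℝ g p - fderiv ℝ g x) (x' - x - (y' - y))
          + (fderiv ℝ g p - fderiv ℝ g x - (fderiv ℝ g q - fderiv ℝ g y)) (y' - y) := by
      simp only [sub_apply, map_sub]; abel
    rw [e]
    have hp := segment_mem hS hx hx' hθ.1 hθ.2
    have hq := segment_mem hS hy hy' hθ.1 hθ.2
    have hpx : ‖p - x‖ ≤ ‖x' - x‖ := norm_segment_sub_left_le x x' hθ.1 hθ.2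
    have hqy : ‖q - y‖ ≤ ‖y' - y‖ := norm_segment_sub_left_le y y' hθ.1 hθ.2
    have h3 := norm_increment_sub_le hg' hS hbd hlip hL hx hp hy hq
    have h4 : ‖p - x - (q - y)‖ ≤ ‖x' - x - (y' - y)‖ := by
      have : p - x - (q - y) = θ • (x' - x - (y' - y)) := by rw [hpdef, hqdef]; module
      rw [this, norm_smul, Real.norm_of_nonneg hθ.1]
      nlinarith [norm_nonneg (x' - x - (y' - y)), hθ.2]
    have h5 : ‖p - q‖ ≤ ‖x - y‖ + ‖x' - y'‖ := norm_segment_sub_le x x' y y' hθ.1 hθ.2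
    have h6 : ‖fderiv ℝ g p - fderiv ℝ g x - (fderiv ℝ g q - fderiv ℝ g y)‖
        ≤ L * ‖x' - x - (y' - y)‖ + 2 * L * (‖x - y‖ + ‖x' - y'‖) * ‖y' - y‖ := by
      have h7 : ‖x - y‖ + ‖p - q‖ ≤ 2 * (‖x - y‖ + ‖x' - y'‖) := by
        linarith [norm_nonneg (x - y), norm_nonneg (x' - y')]
      calc _ ≤ _ := h3
        _ ≤ L * ‖x' - x - (y' - y)‖ + L * (2 * (‖x - y‖ + ‖x' - y'‖)) * ‖y' - y‖ := by gcongr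
        _ = _ := by ring
    have h8 : ‖fderiv ℝ g p - fderiv ℝ g x‖ ≤ L * ‖x' - x‖ :=
      (hlip' _ hp _ hx).trans (by gcongr)
    calc _ ≤ (L * ‖x' - x‖) * ‖x' - x - (y' - y)‖
          + (L * ‖x' - x - (y' - y)‖ + 2 * L * (‖x - y‖ + ‖x' - y'‖) * ‖y' - y‖) * ‖y' - y‖ :=
        (norm_add_le _ _).trans (add_le_add
          ((ContinuousLinearMap.le_opNorm _ _).trans (by gcongr))
          ((ContinuousLinearMap.le_opNorm _ _).trans (by gcongr)))
      _ = _ := by ring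

end Taylor

/-! ### Powers of the step size. -/

section Powers

/-- With `q = t ^ α` as the unit of smallness, time itself has order `q ^ 2`; this is one place
where `α ≤ 1 / 2` matters. -/
theorem le_rpow_sq {α t : ℝ} (hα' : α ≤ 1 / 2) (h0 : 0 ≤ t) (h1 : t ≤ 1) : t ≤ (t ^ α) ^ 2 := by
  rcases h0.eq_or_lt with rfl | h
  · positivity
  · rw [← Real.rpow_natCast, ← Real.rpow_mul h0]
    conv_lhs => rw [← Real.rpow_one t]
    exact Real.rpow_le_rpow_of_exponent_ge h h1 (by push_cast; linarith)

theorem rpow_cube {t : ℝ} (α : ℝ) (h0 : 0 ≤ t) : t ^ (3 * α) = (t ^ α) ^ 3 := by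
  rw [← Real.rpow_natCast, ← Real.rpow_mul h0, mul_comm]; norm_num

theorem rpow_sq {t : ℝ} (α : ℝ) (h0 : 0 ≤ t) : t ^ (2 * α) = (t ^ α) ^ 2 := by
  rw [← Real.rpow_natCast, ← Real.rpow_mul h0, mul_comm]; norm_num

theorem exists_step {α : ℝ} (hα : 0 < α) {A : ℝ} (hA : 0 ≤ A) :
    ∃ h₀ : ℝ, 0 < h₀ ∧ h₀ ≤ 1 ∧ A * h₀ ^ α ≤ 1 := by
  refine ⟨(1 / (A + 1)) ^ (1 / α), by positivity, ?_, ?_⟩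
  · apply Real.rpow_le_one (by positivity) _ (by positivity)
    rw [div_le_one (by linarith)]; linarith
  · rw [← Real.rpow_mul (by positivity), one_div_mul_cancel hα.ne', Real.rpow_one,
      mul_one_div, div_le_one (by linarith)]
    linarith

end Powers

/-! ### Perturbed second order schemes: a priori bounds and stability. -/

section Rough

variable {m : ℕ} {W : Type*} [NormedAddCommGroup W] [NormedSpace ℝ W]

/-- The analytic and algebraic bounds of a rough path with one constant. -/
structure RoughBound (α T M : ℝ) (Z : ℝ → EuclideanSpace ℝ (Fin m))
    (ZZ : ℝ → ℝ → Matrix (Fin m) (Fin m) ℝ) : Prop where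
  nonneg : 0 ≤ M
  path : ∀ u v, 0 ≤ u → u ≤ v → v ≤ T → ‖Z v - Z u‖ ≤ M * (v - u) ^ α
  area : ∀ u v, 0 ≤ u → u ≤ v → v ≤ T → ∑ i, ∑ j, |ZZ u v i j| ≤ M * ((v - u) ^ α) ^ 2
  chen : ∀ s u t, 0 ≤ s → s ≤ u → u ≤ t → t ≤ T →
    ∀ i j, ZZ s t i j = ZZ s u i j + ZZ u t i j + (Z u i - Z s i) * (Z t j - Z u j)

theorem RoughBound.contract_chen {α T M : ℝ} {Z : ℝ → EuclideanSpace ℝ (Fin m)}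
    {ZZ : ℝ → ℝ → Matrix (Fin m) (Fin m) ℝ} (hZ : RoughBound α T M Z ZZ)
    (A : EuclideanSpace ℝ (Fin m) →L[ℝ] EuclideanSpace ℝ (Fin m) →L[ℝ] W)
    {s u t : ℝ} (h0 : 0 ≤ s) (h1 : s ≤ u) (h2 : u ≤ t) (h3 : t ≤ T) :
    contract A (ZZ s t) = contract A (ZZ s u) + contract A (ZZ u t)
      + A (Z u - Z s) (Z t - Z u) := by
  rw [← contract_vecMulVec A, ← contract_add_matrix, ← contract_add_matrix]
  congr 1
  ext i j
  exact hZ.chen s u t h0 h1 h2 h3 i j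

/-- The second order germ of the integral of `σ(X)` at `X_u = x`. -/
noncomputable def germ (Z : ℝ → EuclideanSpace ℝ (Fin m))
    (ZZ : ℝ → ℝ → Matrix (Fin m) (Fin m) ℝ)
    (σ : W → EuclideanSpace ℝ (Fin m) →L[ℝ] W) (u v : ℝ) (x : W) : W :=
  σ x (Z v - Z u) + contract (gammaOp σ σ x) (ZZ u v)

/-- The failure of additivity of `germ` when the base point moves from `x` to `x'`. -/
noncomputable def defect (Z : ℝ → EuclideanSpace ℝ (Fin m))
    (ZZ : ℝ → ℝ → Matrix (Fin m) (Fin m) ℝ)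
    (σ : W → EuclideanSpace ℝ (Fin m) →L[ℝ] W) (u w v : ℝ) (x x' : W) : W :=
  (σ x' - σ x - gammaOp σ σ x (Z w - Z u)) (Z v - Z w)
    + contract (gammaOp σ σ x' - gammaOp σ σ x) (ZZ w v)

/-- By Chen's relation the cross term `Γσ(x)` applied to the two increments of `Z` is what
compensates the first order change of `σ` between `x` and `x'`. -/
theorem RoughBound.germ_add_germ {α T M : ℝ} {Z : ℝ → EuclideanSpace ℝ (Fin m)}
    {ZZ : ℝ → ℝ → Matrix (Fin m) (Fin m) ℝ} (hZ : RoughBound α T M Z ZZ)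
    (σ : W → EuclideanSpace ℝ (Fin m) →L[ℝ] W) {u w v : ℝ} (h0 : 0 ≤ u) (h1 : u ≤ w)
    (h2 : w ≤ v) (h3 : v ≤ T) (x x' : W) :
    germ Z ZZ σ u w x + germ Z ZZ σ w v x' - germ Z ZZ σ u v x = defect Z ZZ σ u w v x x' := by
  simp only [germ, defect, hZ.contract_chen (gammaOp σ σ x) h0 h1 h2 h3, contract_sub,
    sub_apply, map_sub]
  abel

/-- Bounds on a set `S` for the coefficients of a rough differential equation. -/
structure CoefBound (S : Set W) (L : ℝ) (μ : W → W)
    (σ : W → EuclideanSpace ℝ (Fin m) →L[ℝ] W) : Prop where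
  nonneg : 0 ≤ L
  norm_le : ∀ x ∈ S, ‖σ x‖ ≤ L
  lip : ∀ x ∈ S, ∀ y ∈ S, ‖σ x - σ y‖ ≤ L * ‖x - y‖
  norm_fderiv_le : ∀ x ∈ S, ‖fderiv ℝ σ x‖ ≤ L
  lip_fderiv : ∀ x ∈ S, ∀ y ∈ S, ‖fderiv ℝ σ x - fderiv ℝ σ y‖ ≤ L * ‖x - y‖
  taylor : ∀ x ∈ S, ∀ x' ∈ S, ‖σ x' - σ x - fderiv ℝ σ x (x' - x)‖ ≤ L * ‖x' - x‖ ^ 2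
  taylor_sub : ∀ x ∈ S, ∀ x' ∈ S, ∀ y ∈ S, ∀ y' ∈ S,
    ‖σ x' - σ x - fderiv ℝ σ x (x' - x) - (σ y' - σ y - fderiv ℝ σ y (y' - y))‖
      ≤ L * ‖x' - x - (y' - y)‖ * (‖x' - x‖ + ‖y' - y‖)
        + 2 * L * (‖x - y‖ + ‖x' - y'‖) * ‖y' - y‖ ^ 2
  gamma_le : ∀ x ∈ S, ‖gammaOp σ σ x‖ ≤ L
  gamma_lip : ∀ x ∈ S, ∀ y ∈ S, ‖gammaOp σ σ x - gammaOp σ σ y‖ ≤ L * ‖x - y‖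
  gamma_sub : ∀ x ∈ S, ∀ x' ∈ S, ∀ y ∈ S, ∀ y' ∈ S,
    ‖gammaOp σ σ x' - gammaOp σ σ x - (gammaOp σ σ y' - gammaOp σ σ y)‖
      ≤ L * ‖x' - x - (y' - y)‖ + L * (‖x - y‖ + ‖x' - y'‖) * ‖y' - y‖
  drift_le : ∀ x ∈ S, ‖μ x‖ ≤ L
  drift_lip : ∀ x ∈ S, ∀ y ∈ S, ‖μ x - μ y‖ ≤ L * ‖x - y‖

variable {S : Set W} {L M α T : ℝ} {μ : W → W} {σ : W → EuclideanSpace ℝ (Fin m) →L[ℝ] W}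
  {Z : ℝ → EuclideanSpace ℝ (Fin m)} {ZZ : ℝ → ℝ → Matrix (Fin m) (Fin m) ℝ}

/-- Third order smallness: the remainder of `σ` is of order `q ^ 2` (a Taylor remainder plus `Dσ` on
the controlled remainder of the path) and meets an increment of `Z`, while the increment of `Γσ` is
of order `q` and meets the second level. -/
theorem CoefBound.defect_le (hc : CoefBound S L μ σ) {u w v A q : ℝ} {x x' : W}
    (hA : 0 ≤ A) (hq : 0 ≤ q) (hx : x ∈ S) (hx' : x' ∈ S)
    (h1 : ‖x' - x‖ ≤ A * q) (h2 : ‖x' - x - σ x (Z w - Z u)‖ ≤ A * q ^ 2)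
    (h3 : ‖Z v - Z w‖ ≤ M * q) (h4 : ∑ i, ∑ j, |ZZ w v i j| ≤ M * q ^ 2) :
    ‖defect Z ZZ σ u w v x x'‖ ≤ (L * A ^ 2 + 2 * (L * A)) * M * q ^ 3 := by
  have hL := hc.nonneg
  have e : σ x' - σ x - gammaOp σ σ x (Z w - Z u)
      = (σ x' - σ x - fderiv ℝ σ x (x' - x)) + fderiv ℝ σ x (x' - x - σ x (Z w - Z u)) := by
    simp only [gammaOp, ContinuousLinearMap.comp_apply, map_sub]; abel
  have h5 : ‖σ x' - σ x - gammaOp σ σ x (Z w - Z u)‖ ≤ L * (A * q) ^ 2 + L * (A * q ^ 2) := by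
    rw [e]
    refine (norm_add_le _ _).trans (add_le_add ?_ ?_)
    · exact (hc.taylor x hx x' hx').trans (by gcongr)
    · exact (ContinuousLinearMap.le_opNorm _ _).trans
        (mul_le_mul (hc.norm_fderiv_le x hx) h2 (norm_nonneg _) hL)
  have h6 : ‖gammaOp σ σ x' - gammaOp σ σ x‖ ≤ L * (A * q) :=
    (hc.gamma_lip x' hx' x hx).trans (by gcongr)
  calc _ ≤ (L * (A * q) ^ 2 + L * (A * q ^ 2)) * (M * q) + (L * (A * q)) * (M * q ^ 2) := by
        refine (norm_add_le _ _).trans (add_le_add ?_ ?_)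
        · exact (ContinuousLinearMap.le_opNorm _ _).trans (by gcongr)
        · exact (norm_contract_le _ _).trans (by gcongr)
    _ = _ := by ring

/-- The same count of powers of `q`, with one factor `E` for the distance of the two paths in every
term. -/
theorem CoefBound.defect_sub_le (hc : CoefBound S L μ σ) {u w v A q E : ℝ} {x x' y y' : W}
    (hA : 0 ≤ A) (hq : 0 ≤ q) (hE : 0 ≤ E) (hx : x ∈ S) (hx' : x' ∈ S)
    (hy : y ∈ S) (hy' : y' ∈ S) (hxy : ‖x - y‖ ≤ E) (hxy' : ‖x' - y'‖ ≤ E)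
    (h1 : ‖x' - x‖ ≤ A * q) (h1' : ‖y' - y‖ ≤ A * q)
    (h2 : ‖y' - y - σ y (Z w - Z u)‖ ≤ A * q ^ 2)
    (h5 : ‖x' - x - (y' - y)‖ ≤ A * E * q)
    (h6 : ‖x' - x - σ x (Z w - Z u) - (y' - y - σ y (Z w - Z u))‖ ≤ A * E * q ^ 2)
    (h3 : ‖Z v - Z w‖ ≤ M * q) (h4 : ∑ i, ∑ j, |ZZ w v i j| ≤ M * q ^ 2) :
    ‖defect Z ZZ σ u w v x x' - defect Z ZZ σ u w v y y'‖
      ≤ (6 * L * A ^ 2 + 5 * L * A) * M * E * q ^ 3 := by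
  have hL := hc.nonneg
  have e : σ x' - σ x - gammaOp σ σ x (Z w - Z u) - (σ y' - σ y - gammaOp σ σ y (Z w - Z u))
      = (σ x' - σ x - fderiv ℝ σ x (x' - x) - (σ y' - σ y - fderiv ℝ σ y (y' - y)))
        + fderiv ℝ σ x (x' - x - σ x (Z w - Z u) - (y' - y - σ y (Z w - Z u)))
        + (fderiv ℝ σ x - fderiv ℝ σ y) (y' - y - σ y (Z w - Z u)) := by
    simp only [gammaOp, ContinuousLinearMap.comp_apply, map_sub, sub_apply]; abel
  have h7 : ‖σ x' - σ x - gammaOp σ σ x (Z w - Z u)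
      - (σ y' - σ y - gammaOp σ σ y (Z w - Z u))‖
      ≤ (L * (A * E * q) * (A * q + A * q) + 2 * L * (E + E) * (A * q) ^ 2)
        + L * (A * E * q ^ 2) + L * E * (A * q ^ 2) := by
    rw [e]
    refine norm_add₃_le.trans (add_le_add (add_le_add ?_ ?_) ?_)
    · exact (hc.taylor_sub x hx x' hx' y hy y' hy').trans (by gcongr)
    · exact (ContinuousLinearMap.le_opNorm _ _).trans
        (mul_le_mul (hc.norm_fderiv_le x hx) h6 (norm_nonneg _) hL)
    · refine (ContinuousLinearMap.le_opNorm _ _).trans ?_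
      gcongr
      exact (hc.lip_fderiv x hx y hy).trans (by gcongr)
  have h8 : ‖gammaOp σ σ x' - gammaOp σ σ x - (gammaOp σ σ y' - gammaOp σ σ y)‖
      ≤ L * (A * E * q) + L * (E + E) * (A * q) :=
    (hc.gamma_sub x hx x' hx' y hy y' hy').trans (by gcongr)
  have e2 : defect Z ZZ σ u w v x x' - defect Z ZZ σ u w v y y'
      = (σ x' - σ x - gammaOp σ σ x (Z w - Z u)
        - (σ y' - σ y - gammaOp σ σ y (Z w - Z u))) (Z v - Z w)
        + contract (gammaOp σ σ x' - gammaOp σ σ x - (gammaOp σ σ y' - gammaOp σ σ y))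
          (ZZ w v) := by
    simp only [defect, contract_sub, sub_apply]; abel
  rw [e2]
  calc _ ≤ ((L * (A * E * q) * (A * q + A * q) + 2 * L * (E + E) * (A * q) ^ 2)
        + L * (A * E * q ^ 2) + L * E * (A * q ^ 2)) * (M * q)
        + (L * (A * E * q) + L * (E + E) * (A * q)) * (M * q ^ 2) := by
        refine (norm_add_le _ _).trans (add_le_add ?_ ?_)
        · exact (ContinuousLinearMap.le_opNorm _ _).trans (by gcongr)
        · exact (norm_contract_le _ _).trans (by gcongr)
    _ = _ := by ring

theorem norm_sum_Ico_add_le {U : Type*} [SeminormedAddCommGroup U] {b : ℕ → U} {c : ℝ} {k n : ℕ}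
    (h : ∀ j, k ≤ j → j < k + n → ‖b j‖ ≤ c) : ‖∑ j ∈ Finset.Ico k (k + n), b j‖ ≤ n * c := by
  have : ‖∑ j ∈ Finset.Ico k (k + n), b j‖ ≤ ∑ j ∈ Finset.Ico k (k + n), c :=
    norm_sum_le_of_le _ fun j hj => by
      rw [Finset.mem_Ico] at hj; exact h j hj.1 hj.2
  simpa using this

/-- A second order remainder after the germ suffices to recover both the Hölder bound and the
controlled expansion, because the contracted term of the germ is itself of order `q ^ 2`. -/
theorem CoefBound.increment_le (hc : CoefBound S L μ σ) {u v q K : ℝ} {x x' : W} (hx : x ∈ S)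
    (hq : 0 ≤ q) (hq1 : q ≤ 1) (hM : 0 ≤ M) (hK : 0 ≤ K) (hz : ‖Z v - Z u‖ ≤ M * q)
    (hzz : ∑ i, ∑ j, |ZZ u v i j| ≤ M * q ^ 2)
    (hr : ‖x' - x - germ Z ZZ σ u v x‖ ≤ K * q ^ 2) :
    ‖x' - x‖ ≤ (L * M + (L * M + K)) * q ∧
      ‖x' - x - σ x (Z v - Z u)‖ ≤ (L * M + (L * M + K)) * q ^ 2 := by
  have hL := hc.nonneg
  have hga : ‖contract (gammaOp σ σ x) (ZZ u v)‖ ≤ L * (M * q ^ 2) :=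
    (norm_contract_le _ _).trans (mul_le_mul (hc.gamma_le _ hx) hzz (by positivity) hL)
  have e : x' - x - σ x (Z v - Z u)
      = contract (gammaOp σ σ x) (ZZ u v) + (x' - x - germ Z ZZ σ u v x) := by
    simp only [germ]; abel
  have h3 : ‖x' - x - σ x (Z v - Z u)‖ ≤ (L * M + K) * q ^ 2 := by
    rw [e]
    refine (norm_add_le _ _).trans ?_
    linarith
  have hLM : 0 ≤ L * M := by positivity
  refine ⟨?_, h3.trans (by gcongr; linarith)⟩
  have h4 : ‖σ x (Z v - Z u)‖ ≤ L * (M * q) :=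
    (ContinuousLinearMap.le_opNorm _ _).trans
      (mul_le_mul (hc.norm_le _ hx) hz (norm_nonneg _) hL)
  have : q ^ 2 ≤ q := by nlinarith
  calc ‖x' - x‖ ≤ ‖x' - x - σ x (Z v - Z u)‖ + ‖σ x (Z v - Z u)‖ := norm_le_norm_sub_add _ _
    _ ≤ (L * M + K) * q ^ 2 + L * (M * q) := by gcongr
    _ ≤ (L * M + K) * q + L * (M * q) := by gcongr
    _ = _ := by ring

theorem CoefBound.increment_sub_le (hc : CoefBound S L μ σ) {u v q K E : ℝ} {x x' y y' : W}
    (hx : x ∈ S) (hy : y ∈ S) (hxy : ‖x - y‖ ≤ E)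
    (hq : 0 ≤ q) (hq1 : q ≤ 1) (hM : 0 ≤ M) (hK : 0 ≤ K) (hE : 0 ≤ E)
    (hz : ‖Z v - Z u‖ ≤ M * q) (hzz : ∑ i, ∑ j, |ZZ u v i j| ≤ M * q ^ 2)
    (hr : ‖x' - x - germ Z ZZ σ u v x - (y' - y - germ Z ZZ σ u v y)‖ ≤ K * E * q ^ 2) :
    ‖x' - x - (y' - y)‖ ≤ (L * M + (L * M + K)) * E * q ∧
      ‖x' - x - σ x (Z v - Z u) - (y' - y - σ y (Z v - Z u))‖
        ≤ (L * M + (L * M + K)) * E * q ^ 2 := by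
  have hL := hc.nonneg
  have hga : ‖contract (gammaOp σ σ x - gammaOp σ σ y) (ZZ u v)‖ ≤ (L * E) * (M * q ^ 2) := by
    refine (norm_contract_le _ _).trans ?_
    gcongr
    exact (hc.gamma_lip _ hx _ hy).trans (by gcongr)
  have e : x' - x - σ x (Z v - Z u) - (y' - y - σ y (Z v - Z u))
      = contract (gammaOp σ σ x - gammaOp σ σ y) (ZZ u v)
        + (x' - x - germ Z ZZ σ u v x - (y' - y - germ Z ZZ σ u v y)) := by
    simp only [germ, contract_sub]; abel
  have h3 : ‖x' - x - σ x (Z v - Z u) - (y' - y - σ y (Z v - Z u))‖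
      ≤ (L * M + K) * E * q ^ 2 := by
    rw [e]
    refine (norm_add_le _ _).trans ?_
    linarith
  have hLM : 0 ≤ L * M := by positivity
  refine ⟨?_, h3.trans (by gcongr; linarith)⟩
  have h4 : ‖(σ x - σ y) (Z v - Z u)‖ ≤ (L * E) * (M * q) := by
    refine (ContinuousLinearMap.le_opNorm _ _).trans ?_
    gcongr
    exact (hc.lip _ hx _ hy).trans (by gcongr)
  have : q ^ 2 ≤ q := by nlinarith
  have e5 : x' - x - (y' - y) = (x' - x - σ x (Z v - Z u) - (y' - y - σ y (Z v - Z u)))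
      + (σ x - σ y) (Z v - Z u) := by
    rw [sub_apply]; abel
  rw [e5]
  calc _ ≤ (L * M + K) * E * q ^ 2 + (L * E) * (M * q) := (norm_add_le _ _).trans (by gcongr)
    _ ≤ (L * M + K) * E * q + (L * E) * (M * q) := by gcongr
    _ = _ := by ring

/-- The remainder of a perturbed Euler scheme `x` with increments of the perturbation `b`,
along the grid `s + k d`. -/
noncomputable def schemeRem (Z : ℝ → EuclideanSpace ℝ (Fin m))
    (ZZ : ℝ → ℝ → Matrix (Fin m) (Fin m) ℝ)
    (σ : W → EuclideanSpace ℝ (Fin m) →L[ℝ] W) (s d : ℝ) (x b : ℕ → W) (k l : ℕ) : W :=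
  x l - x k - germ Z ZZ σ (s + k * d) (s + l * d) (x k) - ∑ j ∈ Finset.Ico k l, b j

theorem schemeRem_succ {s d : ℝ} {x b : ℕ → W} {k : ℕ}
    (h : x (k + 1) = x k + germ Z ZZ σ (s + k * d) (s + (k + 1 : ℕ) * d) (x k) + b k) :
    schemeRem Z ZZ σ s d x b k (k + 1) = 0 := by
  rw [schemeRem, h]
  simp
  abel

theorem grid_sub (s d : ℝ) (k n : ℕ) : s + (k + n : ℕ) * d - (s + k * d) = n * d := by
  push_cast; ring

theorem grid_mono (s : ℝ) {d : ℝ} (hd : 0 ≤ d) {k l : ℕ} (h : k ≤ l) :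
    s + (k : ℝ) * d ≤ s + l * d := by gcongr

theorem grid_rpow_mono {α d : ℝ} (hα : 0 ≤ α) (hd : 0 ≤ d) {k l : ℕ} (h : k ≤ l) :
    ((k : ℝ) * d) ^ α ≤ (l * d) ^ α :=
  Real.rpow_le_rpow (by positivity) (by gcongr) hα

/-- Position increments and sums of perturbations are additive over adjacent blocks, so they cancel
and only the germ contributes. -/
theorem RoughBound.schemeRem_sub (hZ : RoughBound α T M Z ZZ) {s d : ℝ} {x b : ℕ → W}
    (hs : 0 ≤ s) (hd : 0 ≤ d) {k n p : ℕ} (hT : s + (k + n + p : ℕ) * d ≤ T) :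
    schemeRem Z ZZ σ s d x b k (k + n + p) - schemeRem Z ZZ σ s d x b k (k + n)
      - schemeRem Z ZZ σ s d x b (k + n) (k + n + p)
      = defect Z ZZ σ (s + k * d) (s + (k + n : ℕ) * d) (s + (k + n + p : ℕ) * d)
        (x k) (x (k + n)) := by
  rw [← hZ.germ_add_germ σ (by positivity) (grid_mono s hd (Nat.le_add_right k n))
    (grid_mono s hd (Nat.le_add_right (k + n) p)) hT]
  simp only [schemeRem]
  rw [← Finset.sum_Ico_consecutive b (Nat.le_add_right k n) (Nat.le_add_right (k + n) p)]
  abel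

theorem RoughBound.grid_bounds (hZ : RoughBound α T M Z ZZ) {s d : ℝ} (hs : 0 ≤ s) (hd : 0 ≤ d)
    {k n : ℕ} (hT : s + (k + n : ℕ) * d ≤ T) :
    ‖Z (s + (k + n : ℕ) * d) - Z (s + k * d)‖ ≤ M * (n * d) ^ α ∧
      ∑ i, ∑ j, |ZZ (s + k * d) (s + (k + n : ℕ) * d) i j| ≤ M * ((n * d) ^ α) ^ 2 := by
  have hk := grid_mono s hd (Nat.le_add_right k n)
  have hz := hZ.path _ _ (by positivity) hk hT
  have hzz := hZ.area _ _ (by positivity) hk hT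
  rw [grid_sub] at hz hzz
  exact ⟨hz, hzz⟩

theorem one_sub_two_thirds_rpow_pos {γ : ℝ} (hγ : 1 < γ) : 0 < 1 - (2 / 3 : ℝ) ^ (γ - 1) := by
  have : (2 / 3 : ℝ) ^ (γ - 1) < 1 := Real.rpow_lt_one (by norm_num) (by norm_num) (by linarith)
  linarith

/-- The bootstrap is isolated in `hexp`: a bound on the remainder of a block gives expansions on
that block, which bound the defect of a larger block. The value of `ρ` is the one for which the
defect bound is the share permitted by `discrete_sewing`. -/
theorem schemeRem_sewing (hα : 1 / 3 < α) (hZ : RoughBound α T M Z ZZ)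
    (hc : CoefBound S L μ σ) {A : ℝ} (hA : 0 ≤ A) {s d : ℝ} {N : ℕ} {x b : ℕ → W} (hs : 0 ≤ s)
    (hd : 0 < d) (hT : s + N * d ≤ T) (hxS : ∀ k < N, x k ∈ S)
    (hstep : ∀ k < N,
      x (k + 1) = x k + germ Z ZZ σ (s + k * d) (s + (k + 1 : ℕ) * d) (x k) + b k)
    {ρ : ℝ} (hρ : ρ = (L * A ^ 2 + 2 * (L * A)) * M / (1 - (2 / 3 : ℝ) ^ (3 * α - 1)))
    (hexp : ∀ k n : ℕ, 0 < n → k + n ≤ N →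
      ‖schemeRem Z ZZ σ s d x b k (k + n)‖ ≤ ρ * (n * d) ^ (3 * α) →
      ‖x (k + n) - x k‖ ≤ A * (n * d) ^ α ∧
      ‖x (k + n) - x k - σ (x k) (Z (s + (k + n : ℕ) * d) - Z (s + k * d))‖
        ≤ A * ((n * d) ^ α) ^ 2) :
    ∀ n k : ℕ, 0 < n → k + n ≤ N →
      ‖schemeRem Z ZZ σ s d x b k (k + n)‖ ≤ ρ * (n * d) ^ (3 * α) := by
  have hL := hc.nonneg
  have hM := hZ.nonneg
  have hθ := one_sub_two_thirds_rpow_pos (γ := 3 * α) (by linarith)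
  refine discrete_sewing (γ := 3 * α) (by linarith) hd (by rw [hρ]; positivity) ?_ ?_
  · intro k hk
    exact schemeRem_succ (hstep k hk)
  · intro k n p hn hp hN' hR
    obtain ⟨h1, h2⟩ := hexp k n hn (by omega) hR
    have hT' : s + (k + n + p : ℕ) * d ≤ T := (grid_mono s hd.le hN').trans hT
    rw [hZ.schemeRem_sub hs hd.le hT']
    have hnp := grid_rpow_mono (α := α) (by linarith) hd.le (Nat.le_add_right n p)
    have hpp := grid_rpow_mono (α := α) (by linarith) hd.le (Nat.le_add_left p n)
    obtain ⟨hz, hzz⟩ := hZ.grid_bounds hs hd.le hT'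
    have := hc.defect_le (u := s + k * d) (x := x k) (x' := x (k + n)) hA
      (q := ((n + p : ℕ) * d) ^ α) (by positivity)
      (hxS k (by omega)) (hxS (k + n) (by omega)) (h1.trans (by gcongr)) (h2.trans (by gcongr))
      (hz.trans (by gcongr)) (hzz.trans (by gcongr))
    refine this.trans (le_of_eq ?_)
    rw [rpow_cube α (by positivity), hρ, mul_div_cancel₀ _ hθ.ne']

/-- The circularity between remainder and increment is broken by the order of choices: `A₁` does not
depend on `ρ`, then `ρ` is computed from `A₁`, and finally `h₀` is so small that the cubic remainder
`ρ * q ^ 3` is below `q ^ 2`. -/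
theorem scheme_apriori (hα : 1 / 3 < α) (hα' : α ≤ 1 / 2) (hZ : RoughBound α T M Z ZZ)
    (hc : CoefBound S L μ σ) {B : ℝ} (hB : 0 ≤ B) :
    ∃ A h₀ : ℝ, 0 ≤ A ∧ 0 < h₀ ∧ h₀ ≤ 1 ∧ A * h₀ ^ α ≤ 1 ∧
      ∀ (s d : ℝ) (N : ℕ) (x b : ℕ → W), 0 ≤ s → 0 < d → s + N * d ≤ T → N * d ≤ h₀ →
        (∀ k < N, x k ∈ S) →
        (∀ k < N, x (k + 1) = x k + germ Z ZZ σ (s + k * d) (s + (k + 1 : ℕ) * d) (x k) + b k) →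
        (∀ k < N, ‖b k‖ ≤ B * d) → ∀ k n : ℕ, 0 < n → k + n ≤ N →
          ‖x (k + n) - x k‖ ≤ A * (n * d) ^ α ∧
          ‖x (k + n) - x k - σ (x k) (Z (s + (k + n : ℕ) * d) - Z (s + k * d))‖
            ≤ A * ((n * d) ^ α) ^ 2 ∧
          ‖schemeRem Z ZZ σ s d x b k (k + n)‖ ≤ A * ((n * d) ^ α) ^ 3 := by
  have hL := hc.nonneg
  have hM := hZ.nonneg
  -- The constant of `CoefBound.increment_le` with `K = B + 1`: the perturbations give `B`, and the
  -- remainder gives `1` on short intervals.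
  obtain ⟨A₁, hA₁⟩ : ∃ A₁, A₁ = L * M + (L * M + (B + 1)) := ⟨_, rfl⟩
  have hA₁0 : 0 ≤ A₁ := by rw [hA₁]; positivity
  have hθ := one_sub_two_thirds_rpow_pos (γ := 3 * α) (by linarith)
  obtain ⟨ρ, hρ⟩ : ∃ ρ, ρ = (L * A₁ ^ 2 + 2 * (L * A₁)) * M / (1 - (2 / 3 : ℝ) ^ (3 * α - 1)) :=
    ⟨_, rfl⟩
  have hρ0 : 0 ≤ ρ := by rw [hρ]; positivity
  obtain ⟨h₀, hh0, hh1, hA⟩ := exists_step (α := α) (by linarith) (A := A₁ + ρ) (by positivity)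
  refine ⟨A₁ + ρ, h₀, by positivity, hh0, hh1, hA, ?_⟩
  intro s d N x b hs hd hT hN hxS hstep hb
  have hexp : ∀ k n : ℕ, 0 < n → k + n ≤ N →
      ‖schemeRem Z ZZ σ s d x b k (k + n)‖ ≤ ρ * (n * d) ^ (3 * α) →
      ‖x (k + n) - x k‖ ≤ A₁ * (n * d) ^ α ∧
      ‖x (k + n) - x k - σ (x k) (Z (s + (k + n : ℕ) * d) - Z (s + k * d))‖
        ≤ A₁ * ((n * d) ^ α) ^ 2 := by
    intro k n hn hkn hR
    have hnd : (n : ℝ) * d ≤ h₀ := le_trans (by gcongr; omega) hN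
    obtain ⟨hz, hzz⟩ := hZ.grid_bounds hs hd.le ((grid_mono s hd.le hkn).trans hT)
    have htq := le_rpow_sq hα' (by positivity) (hnd.trans hh1)
    rw [rpow_cube α (by positivity)] at hR
    have hq0 : 0 ≤ ((n : ℝ) * d) ^ α := by positivity
    have h1 : ((n : ℝ) * d) ^ α ≤ 1 :=
      Real.rpow_le_one (by positivity) (hnd.trans hh1) (by linarith)
    have h2 : ρ * ((n : ℝ) * d) ^ α ≤ 1 :=
      (mul_le_mul (by linarith) (Real.rpow_le_rpow (by positivity) hnd (by linarith)) hq0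
        (by linarith)).trans hA
    rw [hA₁]
    refine hc.increment_le (hxS k (by omega)) hq0 h1 hM (by linarith) hz hzz ?_
    have hbs := norm_sum_Ico_add_le (k := k) (n := n) fun j _ hj => hb j (by omega)
    have e : x (k + n) - x k - germ Z ZZ σ (s + k * d) (s + (k + n : ℕ) * d) (x k)
        = schemeRem Z ZZ σ s d x b k (k + n) + ∑ j ∈ Finset.Ico k (k + n), b j := by
      simp only [schemeRem]; abel
    rw [e]
    generalize ((n : ℝ) * d) ^ α = q at *
    calc _ ≤ ρ * q ^ 3 + n * (B * d) := (norm_add_le _ _).trans (by gcongr)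
      _ = (ρ * q) * q ^ 2 + B * (n * d) := by ring
      _ ≤ 1 * q ^ 2 + B * q ^ 2 := by gcongr
      _ = _ := by ring
  have hsew := schemeRem_sewing hα hZ hc hA₁0 hs hd hT hxS hstep hρ hexp
  intro k n hn hkn
  have hR := hsew n k hn hkn
  obtain ⟨h1, h2⟩ := hexp k n hn hkn hR
  rw [rpow_cube α (by positivity)] at hR
  refine ⟨h1.trans ?_, h2.trans ?_, hR.trans ?_⟩ <;> gcongr <;> linarith

/-- Sewing for the difference of two remainders; the a priori bounds of both schemes are inputs, so
the bootstrap is now linear in `E`. -/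
theorem schemeRem_sub_sewing (hα : 1 / 3 < α) (hZ : RoughBound α T M Z ZZ)
    (hc : CoefBound S L μ σ) {A E : ℝ} (hA : 0 ≤ A) (hE : 0 ≤ E) {s d : ℝ} {N : ℕ}
    {x b y b' : ℕ → W} (hs : 0 ≤ s)
    (hd : 0 < d) (hT : s + N * d ≤ T) (hxS : ∀ k < N, x k ∈ S) (hyS : ∀ k < N, y k ∈ S)
    (hstep : ∀ k < N,
      x (k + 1) = x k + germ Z ZZ σ (s + k * d) (s + (k + 1 : ℕ) * d) (x k) + b k)
    (hstep' : ∀ k < N,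
      y (k + 1) = y k + germ Z ZZ σ (s + k * d) (s + (k + 1 : ℕ) * d) (y k) + b' k)
    (hxy : ∀ k ≤ N, ‖x k - y k‖ ≤ E)
    (hx1 : ∀ k n : ℕ, 0 < n → k + n ≤ N → ‖x (k + n) - x k‖ ≤ A * (n * d) ^ α)
    (hy1 : ∀ k n : ℕ, 0 < n → k + n ≤ N → ‖y (k + n) - y k‖ ≤ A * (n * d) ^ α)
    (hy2 : ∀ k n : ℕ, 0 < n → k + n ≤ N →
      ‖y (k + n) - y k - σ (y k) (Z (s + (k + n : ℕ) * d) - Z (s + k * d))‖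
        ≤ A * ((n * d) ^ α) ^ 2)
    {ρ : ℝ} (hρ : ρ = (6 * L * A ^ 2 + 5 * L * A) * M / (1 - (2 / 3 : ℝ) ^ (3 * α - 1)))
    (hexp : ∀ k n : ℕ, 0 < n → k + n ≤ N →
      ‖schemeRem Z ZZ σ s d x b k (k + n) - schemeRem Z ZZ σ s d y b' k (k + n)‖
        ≤ ρ * E * (n * d) ^ (3 * α) →
      ‖x (k + n) - x k - (y (k + n) - y k)‖ ≤ A * E * (n * d) ^ α ∧
      ‖x (k + n) - x k - σ (x k) (Z (s + (k + n : ℕ) * d) - Z (s + k * d))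
        - (y (k + n) - y k - σ (y k) (Z (s + (k + n : ℕ) * d) - Z (s + k * d)))‖
        ≤ A * E * ((n * d) ^ α) ^ 2) :
    ∀ n k : ℕ, 0 < n → k + n ≤ N →
      ‖schemeRem Z ZZ σ s d x b k (k + n) - schemeRem Z ZZ σ s d y b' k (k + n)‖
        ≤ ρ * E * (n * d) ^ (3 * α) := by
  have hL := hc.nonneg
  have hM := hZ.nonneg
  have hθ := one_sub_two_thirds_rpow_pos (γ := 3 * α) (by linarith)
  refine discrete_sewing (γ := 3 * α) (by linarith) hd (by rw [hρ]; positivity)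
    (R := fun k l => schemeRem Z ZZ σ s d x b k l - schemeRem Z ZZ σ s d y b' k l) ?_ ?_
  · intro k hk
    simp only [schemeRem_succ (hstep k hk), schemeRem_succ (hstep' k hk), sub_zero]
  · intro k n p hn hp hN' hR
    obtain ⟨h1, h2⟩ := hexp k n hn (by omega) hR
    have hT' : s + (k + n + p : ℕ) * d ≤ T := (grid_mono s hd.le hN').trans hT
    have e : ∀ a b c a' b' c' : W, a - a' - (b - b') - (c - c') = a - b - c - (a' - b' - c') := by
      intros; abel
    rw [e, hZ.schemeRem_sub hs hd.le hT', hZ.schemeRem_sub hs hd.le hT']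
    have hnp := grid_rpow_mono (α := α) (by linarith) hd.le (Nat.le_add_right n p)
    have hpp := grid_rpow_mono (α := α) (by linarith) hd.le (Nat.le_add_left p n)
    obtain ⟨hz, hzz⟩ := hZ.grid_bounds hs hd.le hT'
    have := hc.defect_sub_le (u := s + k * d) (x := x k) (x' := x (k + n))
      (y := y k) (y' := y (k + n)) hA (q := ((n + p : ℕ) * d) ^ α) (by positivity) hE
      (hxS k (by omega)) (hxS (k + n) (by omega)) (hyS k (by omega)) (hyS (k + n) (by omega))
      (hxy k (by omega)) (hxy (k + n) (by omega))
      ((hx1 k n hn (by omega)).trans (by gcongr)) ((hy1 k n hn (by omega)).trans (by gcongr))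
      ((hy2 k n hn (by omega)).trans (by gcongr)) (h1.trans (by gcongr)) (h2.trans (by gcongr))
      (hz.trans (by gcongr)) (hzz.trans (by gcongr))
    refine this.trans (le_of_eq ?_)
    rw [rpow_cube α (by positivity), hρ, ← mul_assoc, mul_div_cancel₀ _ hθ.ne']

/-- All differences are measured in units of the largest distance `E` on the grid (plus `ε`). Over a
short interval the distance can only grow from its initial value by `A₁ * h₀ ^ α * E ≤ E / 2`, which
is absorbed and produces the factor `2`. -/
theorem scheme_stability (hα : 1 / 3 < α) (hα' : α ≤ 1 / 2) (hZ : RoughBound α T M Z ZZ)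
    (hc : CoefBound S L μ σ) {A : ℝ} (hA : 0 ≤ A) :
    ∃ h₀ : ℝ, 0 < h₀ ∧ h₀ ≤ 1 ∧
      ∀ (s d ε : ℝ) (N : ℕ) (x b y b' : ℕ → W), 0 ≤ s → 0 < d → s + N * d ≤ T → N * d ≤ h₀ →
        0 ≤ ε → (∀ k < N, x k ∈ S) → (∀ k < N, y k ∈ S) →
        (∀ k < N, x (k + 1) = x k + germ Z ZZ σ (s + k * d) (s + (k + 1 : ℕ) * d) (x k) + b k) →
        (∀ k < N, y (k + 1) = y k + germ Z ZZ σ (s + k * d) (s + (k + 1 : ℕ) * d) (y k) + b' k) →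
        (∀ k < N, ‖b k - b' k‖ ≤ (L * ‖x k - y k‖ + ε) * d) →
        (∀ k n : ℕ, 0 < n → k + n ≤ N → ‖x (k + n) - x k‖ ≤ A * (n * d) ^ α) →
        (∀ k n : ℕ, 0 < n → k + n ≤ N → ‖y (k + n) - y k‖ ≤ A * (n * d) ^ α) →
        (∀ k n : ℕ, 0 < n → k + n ≤ N →
          ‖y (k + n) - y k - σ (y k) (Z (s + (k + n : ℕ) * d) - Z (s + k * d))‖
            ≤ A * ((n * d) ^ α) ^ 2) →
        ∀ k ≤ N, ‖x k - y k‖ ≤ 2 * ‖x 0 - y 0‖ + ε := by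
  have hL := hc.nonneg
  have hM := hZ.nonneg
  obtain ⟨A₁, hA₁⟩ : ∃ A₁, A₁ = A + (L * M + (L * M + (L + 2))) := ⟨_, rfl⟩
  have hLM : 0 ≤ L * M := by positivity
  have hA₁0 : 0 ≤ A₁ := by rw [hA₁]; positivity
  have hAA₁ : A ≤ A₁ := by linarith
  have hθ := one_sub_two_thirds_rpow_pos (γ := 3 * α) (by linarith)
  obtain ⟨ρ, hρ⟩ : ∃ ρ, ρ = (6 * L * A₁ ^ 2 + 5 * L * A₁) * M
    / (1 - (2 / 3 : ℝ) ^ (3 * α - 1)) := ⟨_, rfl⟩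
  have hρ0 : 0 ≤ ρ := by rw [hρ]; positivity
  obtain ⟨h₀, hh0, hh1, hAh⟩ :=
    exists_step (α := α) (by linarith) (A := 2 * A₁ + ρ) (by positivity)
  refine ⟨h₀, hh0, hh1, ?_⟩
  intro s d ε N x b y b' hs hd hT hN hε hxS hyS hstep hstep' hb hx1 hy1 hy2
  -- The node of largest distance; the final estimate is run from node `0` to this one.
  obtain ⟨K, hKN, hK⟩ : ∃ K ≤ N, ∀ j ≤ N, ‖x j - y j‖ ≤ ‖x K - y K‖ := by
    obtain ⟨K, hK, h⟩ := Finset.exists_max_image (Finset.range (N + 1))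
      (fun j => ‖x j - y j‖) ⟨0, by simp⟩
    exact ⟨K, by simpa [Nat.lt_succ_iff] using hK, fun j hj => h j (by simp; omega)⟩
  obtain ⟨E, hE⟩ : ∃ E, E = ‖x K - y K‖ + ε := ⟨_, rfl⟩
  have hE0 : 0 ≤ E := by rw [hE]; positivity
  have hDE : ∀ j ≤ N, ‖x j - y j‖ ≤ E := fun j hj => (hK j hj).trans (by linarith)
  have hεE : ε ≤ E := by linarith [norm_nonneg (x K - y K)]
  have hexp : ∀ k n : ℕ, 0 < n → k + n ≤ N →
      ‖schemeRem Z ZZ σ s d x b k (k + n) - schemeRem Z ZZ σ s d y b' k (k + n)‖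
        ≤ ρ * E * (n * d) ^ (3 * α) →
      ‖x (k + n) - x k - (y (k + n) - y k)‖ ≤ A₁ * E * (n * d) ^ α ∧
      ‖x (k + n) - x k - σ (x k) (Z (s + (k + n : ℕ) * d) - Z (s + k * d))
        - (y (k + n) - y k - σ (y k) (Z (s + (k + n : ℕ) * d) - Z (s + k * d)))‖
        ≤ A₁ * E * ((n * d) ^ α) ^ 2 := by
    intro k n hn hkn hR
    have hnd : (n : ℝ) * d ≤ h₀ := le_trans (by gcongr; omega) hN
    obtain ⟨hz, hzz⟩ := hZ.grid_bounds hs hd.le ((grid_mono s hd.le hkn).trans hT)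
    have htq := le_rpow_sq hα' (by positivity) (hnd.trans hh1)
    rw [rpow_cube α (by positivity)] at hR
    have hq0 : 0 ≤ ((n : ℝ) * d) ^ α := by positivity
    have h1 : ((n : ℝ) * d) ^ α ≤ 1 :=
      Real.rpow_le_one (by positivity) (hnd.trans hh1) (by linarith)
    have h2 : ρ * ((n : ℝ) * d) ^ α ≤ 1 :=
      (mul_le_mul (by linarith) (Real.rpow_le_rpow (by positivity) hnd (by linarith)) hq0
        (by linarith)).trans hAh
    have hbs : ‖∑ j ∈ Finset.Ico k (k + n), (b j - b' j)‖ ≤ n * ((L * E + E) * d) := by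
      refine norm_sum_Ico_add_le fun j _ hj => (hb j (by omega)).trans ?_
      gcongr
      exact hDE j (by omega)
    have := hc.increment_sub_le (K := L + 2) (x' := x (k + n)) (y' := y (k + n))
      (hxS k (by omega)) (hyS k (by omega)) (hDE k (by omega))
      hq0 h1 hM (by linarith) hE0 hz hzz ?_
    · refine ⟨this.1.trans ?_, this.2.trans ?_⟩ <;> gcongr <;> linarith
    have e : x (k + n) - x k - germ Z ZZ σ (s + k * d) (s + (k + n : ℕ) * d) (x k)
        - (y (k + n) - y k - germ Z ZZ σ (s + k * d) (s + (k + n : ℕ) * d) (y k))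
        = (schemeRem Z ZZ σ s d x b k (k + n) - schemeRem Z ZZ σ s d y b' k (k + n))
          + ∑ j ∈ Finset.Ico k (k + n), (b j - b' j) := by
      simp only [schemeRem, Finset.sum_sub_distrib]; abel
    rw [e]
    generalize ((n : ℝ) * d) ^ α = q at *
    calc _ ≤ ρ * E * q ^ 3 + n * ((L * E + E) * d) := (norm_add_le _ _).trans (by gcongr)
      _ = (ρ * q) * (E * q ^ 2) + (L * E + E) * (n * d) := by ring
      _ ≤ 1 * (E * q ^ 2) + (L * E + E) * q ^ 2 := by gcongr
      _ = _ := by ring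
  have hsew := schemeRem_sub_sewing hα hZ hc hA₁0 hE0 hs hd hT hxS hyS hstep hstep' hDE
    (fun k n h h' => (hx1 k n h h').trans (by gcongr))
    (fun k n h h' => (hy1 k n h h').trans (by gcongr))
    (fun k n h h' => (hy2 k n h h').trans (by gcongr)) hρ hexp
  have hq0 : 0 ≤ h₀ ^ α := by positivity
  -- The factor `2` put in front of `A₁` in the choice of `h₀` is used here.
  have hhalf : A₁ * h₀ ^ α ≤ 1 / 2 := by
    have : 0 ≤ ρ * h₀ ^ α := by positivity
    linarith
  have hmain : ‖x K - y K‖ ≤ ‖x 0 - y 0‖ + A₁ * E * h₀ ^ α := by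
    rcases Nat.eq_zero_or_pos K with h | h
    · rw [h]
      have : 0 ≤ A₁ * E * h₀ ^ α := by positivity
      linarith
    · have h1 := (hexp 0 K h (by omega) (hsew K 0 h (by omega))).1
      rw [zero_add] at h1
      have e : x K - y K = (x 0 - y 0) + (x K - x 0 - (y K - y 0)) := by abel
      rw [e]
      refine (norm_add_le _ _).trans ?_
      gcongr
      refine h1.trans ?_
      gcongr
      exact le_trans (by gcongr) hN
  have : A₁ * E * h₀ ^ α ≤ 1 / 2 * E := by
    calc A₁ * E * h₀ ^ α = (A₁ * h₀ ^ α) * E := by ring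
      _ ≤ _ := by gcongr
  intro k hk
  refine (hK k hk).trans ?_
  linarith

end Rough

/-! ### Euler schemes and solutions in the sense of Davie. -/

section Davie

variable {m : ℕ} {W : Type*} [NormedAddCommGroup W] [NormedSpace ℝ W]

/-- One step of the second order Euler scheme. -/
noncomputable def eulerStep (Z : ℝ → EuclideanSpace ℝ (Fin m))
    (ZZ : ℝ → ℝ → Matrix (Fin m) (Fin m) ℝ) (μ : W → W)
    (σ : W → EuclideanSpace ℝ (Fin m) →L[ℝ] W) (u v : ℝ) (x : W) : W :=
  x + germ Z ZZ σ u v x + (v - u) • μ x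

/-- The second order Euler scheme along the grid `s + k d`. -/
noncomputable def eulerIter (Z : ℝ → EuclideanSpace ℝ (Fin m))
    (ZZ : ℝ → ℝ → Matrix (Fin m) (Fin m) ℝ) (μ : W → W)
    (σ : W → EuclideanSpace ℝ (Fin m) →L[ℝ] W) (s d : ℝ) : ℕ → W → W
  | 0, x => x
  | k + 1, x => eulerStep Z ZZ μ σ (s + k * d) (s + (k + 1 : ℕ) * d)
      (eulerIter Z ZZ μ σ s d k x)

/-- Solutions of a rough differential equation in the sense of Davie. -/
def IsDavie (α : ℝ) (Z : ℝ → EuclideanSpace ℝ (Fin m))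
    (ZZ : ℝ → ℝ → Matrix (Fin m) (Fin m) ℝ) (μ : W → W)
    (σ : W → EuclideanSpace ℝ (Fin m) →L[ℝ] W) (C a b : ℝ) (X : ℝ → W) : Prop :=
  ∀ u v, a ≤ u → u ≤ v → v ≤ b →
    ‖X v - eulerStep Z ZZ μ σ u v (X u)‖ ≤ C * ((v - u) ^ α) ^ 3

variable {S : Set W} {L M α T : ℝ} {μ : W → W} {σ : W → EuclideanSpace ℝ (Fin m) →L[ℝ] W}
  {Z : ℝ → EuclideanSpace ℝ (Fin m)} {ZZ : ℝ → ℝ → Matrix (Fin m) (Fin m) ℝ}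

theorem IsDavie.mono {C a b a' b' : ℝ} {X : ℝ → W} (h : IsDavie α Z ZZ μ σ C a b X)
    (ha : a ≤ a') (hb : b' ≤ b) : IsDavie α Z ZZ μ σ C a' b' X :=
  fun u v h1 h2 h3 => h u v (ha.trans h1) h2 (h3.trans hb)

/-- On an interval of length zero the area bound forces the second level to vanish. -/
theorem RoughBound.eulerStep_self (hα : 0 < α) (hZ : RoughBound α T M Z ZZ) {u : ℝ} (h0 : 0 ≤ u)
    (hT : u ≤ T) (x : W) : eulerStep Z ZZ μ σ u u x = x := by
  have h := (norm_contract_le (gammaOp σ σ x) (ZZ u u)).trans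
    (mul_le_mul_of_nonneg_left (hZ.area u u h0 le_rfl hT) (by positivity))
  rw [sub_self, Real.zero_rpow hα.ne'] at h
  have h' : contract (gammaOp σ σ x) (ZZ u u) = 0 := norm_le_zero_iff.1 (by simpa using h)
  simp [eulerStep, germ, h']

theorem exists_step_rpow {α : ℝ} (hα : 1 / 3 < α) {A : ℝ} (hA : 0 ≤ A) :
    ∃ h₀ : ℝ, 0 < h₀ ∧ h₀ ≤ 1 ∧ ∀ d, 0 < d → d ≤ h₀ → A * d ^ (3 * α - 1) ≤ 1 := by
  obtain ⟨h₀, h1, h2, h3⟩ := exists_step (α := 3 * α - 1) (by linarith) hA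
  refine ⟨h₀, h1, h2, fun d hd hd' => le_trans ?_ h3⟩
  gcongr
  linarith

theorem rpow_cube_eq {α d : ℝ} (hd : 0 < d) : (d ^ α) ^ 3 = d ^ (3 * α - 1) * d := by
  rw [← rpow_cube α hd.le]
  conv_rhs => rw [← Real.rpow_one d, ← Real.rpow_mul hd.le, one_mul, ← Real.rpow_add hd]
  congr 1; ring

/-- Sequences which satisfy the Euler recursion up to an error `ε * d` per step are perturbed
schemes with perturbation `d • μ (x k)` plus that error, so the preceding estimates apply. Keeping
the error proportional to `d` makes the total error of order `ε`, independently of the number of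
steps. -/
theorem approx_scheme_stability (hα : 1 / 3 < α) (hα' : α ≤ 1 / 2) (hZ : RoughBound α T M Z ZZ)
    (hc : CoefBound S L μ σ) :
    ∃ A h₀ : ℝ, 0 ≤ A ∧ 0 < h₀ ∧ h₀ ≤ 1 ∧ A * h₀ ^ α ≤ 1 ∧
      (∀ (s d ε : ℝ) (N : ℕ) (x : ℕ → W), 0 ≤ s → 0 < d → s + N * d ≤ T → N * d ≤ h₀ →
        (∀ k < N, x k ∈ S) → ε ≤ 1 →
        (∀ k < N, ‖x (k + 1) - eulerStep Z ZZ μ σ (s + k * d) (s + (k + 1 : ℕ) * d) (x k)‖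
          ≤ ε * d) → ∀ k n, k + n ≤ N → ‖x (k + n) - x k‖ ≤ A * (n * d) ^ α) ∧
      (∀ (s d : ℝ) (N : ℕ) (x : ℕ → W), 0 ≤ s → 0 < d → s + N * d ≤ T → N * d ≤ h₀ →
        (∀ k < N, x k ∈ S) →
        (∀ k < N, x (k + 1) = eulerStep Z ZZ μ σ (s + k * d) (s + (k + 1 : ℕ) * d) (x k)) →
        ∀ k n, k + n ≤ N →
          ‖x (k + n) - eulerStep Z ZZ μ σ (s + k * d) (s + (k + n : ℕ) * d) (x k)‖
            ≤ A * ((n * d) ^ α) ^ 3) ∧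
      ∀ (s d ε : ℝ) (N : ℕ) (x y : ℕ → W), 0 ≤ s → 0 < d → s + N * d ≤ T → N * d ≤ h₀ →
        0 ≤ ε → ε ≤ 1 → (∀ k < N, x k ∈ S) → (∀ k < N, y k ∈ S) →
        (∀ k < N, ‖x (k + 1) - eulerStep Z ZZ μ σ (s + k * d) (s + (k + 1 : ℕ) * d) (x k)‖
          ≤ ε * d) →
        (∀ k < N, ‖y (k + 1) - eulerStep Z ZZ μ σ (s + k * d) (s + (k + 1 : ℕ) * d) (y k)‖
          ≤ ε * d) →
        ∀ k ≤ N, ‖x k - y k‖ ≤ 2 * ‖x 0 - y 0‖ + 2 * ε := by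
  have hL := hc.nonneg
  obtain ⟨A, h₁, hA, h₁0, h₁1, hAh, hap⟩ := scheme_apriori hα hα' hZ hc (B := L + 1) (by linarith)
  obtain ⟨h₂, h₂0, h₂1, hst⟩ := scheme_stability hα hα' hZ hc hA
  obtain ⟨h₃, h₃0, h₃1, hAh₃⟩ :=
    exists_step (α := α) (by linarith) (A := A + L * A) (by positivity)
  have key : ∀ (s d ε : ℝ) (N : ℕ) (x : ℕ → W), 0 ≤ s → 0 < d → s + N * d ≤ T → N * d ≤ h₁ →
      ε ≤ 1 → (∀ k < N, x k ∈ S) →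
      (∀ k < N, ‖x (k + 1) - eulerStep Z ZZ μ σ (s + k * d) (s + (k + 1 : ℕ) * d) (x k)‖
        ≤ ε * d) → ∃ b : ℕ → W,
      (∀ k < N, x (k + 1) = x k + germ Z ZZ σ (s + k * d) (s + (k + 1 : ℕ) * d) (x k) + b k) ∧
      (∀ k < N, ‖b k - d • μ (x k)‖ ≤ ε * d) ∧ ∀ k n : ℕ, 0 < n → k + n ≤ N →
          ‖x (k + n) - x k‖ ≤ A * (n * d) ^ α ∧
          ‖x (k + n) - x k - σ (x k) (Z (s + (k + n : ℕ) * d) - Z (s + k * d))‖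
            ≤ A * ((n * d) ^ α) ^ 2 ∧
          ‖schemeRem Z ZZ σ s d x b k (k + n)‖ ≤ A * ((n * d) ^ α) ^ 3 := by
    intro s d ε N x hs hd hT hN hε hxS hx
    refine ⟨fun k => x (k + 1) - x k - germ Z ZZ σ (s + k * d) (s + (k + 1 : ℕ) * d) (x k),
      fun k _ => by beta_reduce; abel, ?_, ?_⟩
    · intro k hk
      refine le_trans (le_of_eq ?_) (hx k hk)
      congr 1
      rw [eulerStep, grid_sub]
      simp; abel
    · refine hap s d N x _ hs hd hT hN hxS (fun k _ => by abel) ?_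
      intro k hk
      have e : x (k + 1) - x k - germ Z ZZ σ (s + k * d) (s + (k + 1 : ℕ) * d) (x k)
          = (x (k + 1) - eulerStep Z ZZ μ σ (s + k * d) (s + (k + 1 : ℕ) * d) (x k))
            + d • μ (x k) := by
        rw [eulerStep, grid_sub]
        simp; abel
      rw [e]
      refine (norm_add_le _ _).trans ?_
      have h1 := hx k hk
      have h2 : ‖d • μ (x k)‖ ≤ d * L := by
        rw [norm_smul, Real.norm_of_nonneg hd.le]
        gcongr
        exact hc.drift_le _ (hxS k hk)
      nlinarith
  have hmin0 : 0 < min h₁ (min h₂ h₃) := by positivity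
  have hle1 : min h₁ (min h₂ h₃) ≤ h₁ := min_le_left _ _
  have hle2 : min h₁ (min h₂ h₃) ≤ h₂ := (min_le_right _ _).trans (min_le_left _ _)
  have hle3 : min h₁ (min h₂ h₃) ≤ h₃ := (min_le_right _ _).trans (min_le_right _ _)
  -- `A` bounds the scheme remainder; `L * A` pays for freezing the drift at the left endpoint of a
  -- block.
  refine ⟨A + L * A, min h₁ (min h₂ h₃), by positivity, hmin0, hle1.trans h₁1, ?_, ?_, ?_, ?_⟩
  · refine le_trans ?_ hAh₃
    gcongr
  · intro s d ε N x hs hd hT hN hxS hε hx k n hkn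
    obtain ⟨b, hb, hb', hbd⟩ := key s d ε N x hs hd hT (hN.trans hle1) hε hxS hx
    rcases Nat.eq_zero_or_pos n with rfl | hn
    · simp; positivity
    · refine (hbd k n hn hkn).1.trans ?_
      have : 0 ≤ L * A := by positivity
      gcongr
      linarith
  · intro s d N x hs hd hT hN hxS hx k n hkn
    rcases Nat.eq_zero_or_pos n with rfl | hn
    · have hk : s + (k : ℝ) * d ≤ T := (grid_mono s hd.le (by omega)).trans hT
      rw [add_zero, hZ.eulerStep_self (by linarith) (by positivity) hk]
      simp; positivity
    -- For an exact scheme the error is zero, which identifies the perturbation as the drift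
    -- increment.
    obtain ⟨b, hb, hb', hbd⟩ := key s d 0 N x hs hd hT (hN.trans hle1) zero_le_one hxS
      (fun k hk => by rw [hx k hk]; simp)
    have hbe : ∀ k < N, b k = d • μ (x k) := fun k hk => by
      have := hb' k hk
      rwa [zero_mul, norm_le_zero_iff, sub_eq_zero] at this
    have hnd : (n : ℝ) * d ≤ 1 :=
      le_trans (by gcongr; omega) (hN.trans (hle1.trans h₁1))
    have htq := le_rpow_sq hα' (by positivity) hnd
    have hsum : ‖∑ j ∈ Finset.Ico k (k + n), (d • μ (x j) - d • μ (x k))‖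
        ≤ n * (d * (L * (A * (n * d) ^ α))) := by
      refine norm_sum_Ico_add_le fun j h1 h2 => ?_
      rw [← smul_sub, norm_smul, Real.norm_of_nonneg hd.le]
      gcongr
      refine (hc.drift_lip _ (hxS j (by omega)) _ (hxS k (by omega))).trans ?_
      gcongr
      rcases h1.eq_or_lt with rfl | h1
      · simp; positivity
      · obtain ⟨i, rfl⟩ := Nat.exists_eq_add_of_lt h1
        refine (hbd k (i + 1) (by omega) (by omega)).1.trans ?_
        gcongr
        omega
    have e : x (k + n) - eulerStep Z ZZ μ σ (s + k * d) (s + (k + n : ℕ) * d) (x k)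
        = schemeRem Z ZZ σ s d x b k (k + n)
          + ∑ j ∈ Finset.Ico k (k + n), (d • μ (x j) - d • μ (x k)) := by
      have : ∑ j ∈ Finset.Ico k (k + n), b j = ∑ j ∈ Finset.Ico k (k + n), d • μ (x j) :=
        Finset.sum_congr rfl fun j hj => hbe j (by rw [Finset.mem_Ico] at hj; omega)
      rw [schemeRem, this, Finset.sum_sub_distrib, eulerStep, grid_sub]
      simp only [Finset.sum_const, Nat.card_Ico, add_tsub_cancel_left]
      rw [← Nat.cast_smul_eq_nsmul ℝ, smul_smul]
      abel
    rw [e]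
    have hR := (hbd k n hn hkn).2.2
    generalize hq : ((n : ℝ) * d) ^ α = q at *
    have hq0 : 0 ≤ q := by rw [← hq]; positivity
    calc _ ≤ A * q ^ 3 + n * (d * (L * (A * q))) := (norm_add_le _ _).trans (by gcongr)
      _ = A * q ^ 3 + (n * d) * (L * A * q) := by ring
      _ ≤ A * q ^ 3 + q ^ 2 * (L * A * q) := by gcongr
      _ = _ := by ring
  · intro s d ε N x y hs hd hT hN hε hε1 hxS hyS hx hy
    obtain ⟨b, hb, hb', hbd⟩ := key s d ε N x hs hd hT (hN.trans hle1) hε1 hxS hx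
    obtain ⟨c, hc1, hc', hcd⟩ := key s d ε N y hs hd hT (hN.trans hle1) hε1 hyS hy
    refine hst s d (2 * ε) N x b y c hs hd hT (hN.trans hle2)
      (by positivity) hxS hyS hb hc1 ?_ (fun k n h h' => (hbd k n h h').1)
      (fun k n h h' => (hcd k n h h').1) (fun k n h h' => (hcd k n h h').2.1)
    intro k hk
    have e : b k - c k = (b k - d • μ (x k)) - (c k - d • μ (y k)) + d • (μ (x k) - μ (y k)) := by
      rw [smul_sub]; abel
    rw [e]
    have h1 : ‖d • (μ (x k) - μ (y k))‖ ≤ d * (L * ‖x k - y k‖) := by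
      rw [norm_smul, Real.norm_of_nonneg hd.le]
      gcongr
      exact hc.drift_lip _ (hxS k hk) _ (hyS k hk)
    calc _ ≤ ε * d + ε * d + d * (L * ‖x k - y k‖) :=
          (norm_add_le _ _).trans (add_le_add ((norm_sub_le _ _).trans
            (add_le_add (hb' k hk) (hc' k hk))) h1)
      _ = _ := by ring

/-- The estimates hold only while the iterates remain in `S`. Since earlier iterates in `S` already
bound the next displacement by `A * h₀ ^ α ≤ 1`, induction keeps the scheme in the unit
neighbourhood of its starting point. -/
theorem eulerIter_bounds (hα : 1 / 3 < α) (hα' : α ≤ 1 / 2) (hZ : RoughBound α T M Z ZZ)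
    (hc : CoefBound S L μ σ) {S₀ : Set W} (hS₀ : ∀ x ∈ S₀, ∀ y, ‖y - x‖ ≤ 1 → y ∈ S) :
    ∃ A h₀ : ℝ, 0 ≤ A ∧ 0 < h₀ ∧ h₀ ≤ 1 ∧
      ∀ (s d : ℝ) (N : ℕ) (x : W), 0 ≤ s → 0 < d → s + N * d ≤ T → N * d ≤ h₀ → x ∈ S₀ →
        (∀ k ≤ N, eulerIter Z ZZ μ σ s d k x ∈ S) ∧
        (∀ k n, k + n ≤ N →
          ‖eulerIter Z ZZ μ σ s d (k + n) x - eulerIter Z ZZ μ σ s d k x‖ ≤ A * (n * d) ^ α) ∧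
        ∀ k n, k + n ≤ N →
          ‖eulerIter Z ZZ μ σ s d (k + n) x
            - eulerStep Z ZZ μ σ (s + k * d) (s + (k + n : ℕ) * d)
              (eulerIter Z ZZ μ σ s d k x)‖ ≤ A * ((n * d) ^ α) ^ 3 := by
  obtain ⟨A, h₀, hA, h0, h1, hAh, hap, hda, -⟩ := approx_scheme_stability hα hα' hZ hc
  refine ⟨A, h₀, hA, h0, h1, ?_⟩
  intro s d N x hs hd hT hN hx
  have hstep : ∀ k, eulerIter Z ZZ μ σ s d (k + 1) x = eulerStep Z ZZ μ σ (s + k * d)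
      (s + (k + 1 : ℕ) * d) (eulerIter Z ZZ μ σ s d k x) := fun k => rfl
  have hmem : ∀ k ≤ N, eulerIter Z ZZ μ σ s d k x ∈ S := by
    intro k
    induction k using Nat.strong_induction_on with
    | _ k ih =>
      intro hk
      have hkd : (k : ℝ) * d ≤ h₀ := le_trans (by gcongr) hN
      have := hap s d 0 k (fun k => eulerIter Z ZZ μ σ s d k x) hs hd
        ((grid_mono s hd.le hk).trans hT) hkd
        (fun j hj => ih j hj (by omega)) zero_le_one (fun j _ => by simp [hstep]) 0 k (by simp)
      rw [zero_add] at this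
      refine hS₀ x hx _ (this.trans (le_trans ?_ hAh))
      gcongr
  refine ⟨hmem, ?_, ?_⟩
  · exact hap s d 0 N (fun k => eulerIter Z ZZ μ σ s d k x) hs hd hT hN
      (fun k hk => hmem k hk.le) zero_le_one (fun k _ => by simp [hstep])
  · exact hda s d N (fun k => eulerIter Z ZZ μ σ s d k x) hs hd hT hN
      (fun k hk => hmem k hk.le) (fun k _ => hstep k)

/-- A local error of order `d ^ (3 * α)` is a rate `C * d ^ (3 * α - 1)` per unit of time, and this
rate tends to zero with the mesh. -/
theorem IsDavie.grid {C a b s d : ℝ} {X : ℝ → W} {N : ℕ}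
    (h : IsDavie α Z ZZ μ σ C a b X) (ha : a ≤ s) (hd : 0 < d) (hb : s + N * d ≤ b) :
    ∀ k < N, ‖X (s + (k + 1 : ℕ) * d) - eulerStep Z ZZ μ σ (s + k * d) (s + (k + 1 : ℕ) * d)
      (X (s + k * d))‖ ≤ C * d ^ (3 * α - 1) * d := by
  intro k hk
  have := h (s + k * d) (s + (k + 1 : ℕ) * d) (ha.trans (by
    have : 0 ≤ (k : ℝ) * d := by positivity
    linarith)) (grid_mono s hd.le (by omega)) ((grid_mono s hd.le hk).trans hb)
  rw [grid_sub] at this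
  refine this.trans (le_of_eq ?_)
  rw [Nat.cast_one, one_mul, rpow_cube_eq hd]
  ring

theorem tendsto_mesh_rpow (hα : 1 / 3 < α) (C τ : ℝ) :
    Tendsto (fun n : ℕ => C * (τ / 2 ^ n) ^ (3 * α - 1)) atTop (𝓝 0) := by
  have h1 : Tendsto (fun n : ℕ => τ / (2 : ℝ) ^ n) atTop (𝓝 0) :=
    tendsto_const_nhds.div_atTop (tendsto_pow_atTop_atTop_of_one_lt (by norm_num))
  have h2 := (h1.rpow_const (p := 3 * α - 1) (Or.inr (by linarith))).const_mul C
  rwa [Real.zero_rpow (by linarith), mul_zero] at h2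

/-- Sampled on dyadic grids, both solutions are approximate schemes; the error term vanishes as the
mesh shrinks and only the initial distance survives. -/
theorem davie_stability (hα : 1 / 3 < α) (hα' : α ≤ 1 / 2) (hZ : RoughBound α T M Z ZZ)
    (hc : CoefBound S L μ σ) :
    ∃ h₀ : ℝ, 0 < h₀ ∧ ∀ (s t C : ℝ) (X Y : ℝ → W), 0 ≤ s → s ≤ t → t ≤ T → t - s ≤ h₀ →
      (∀ r ∈ Icc s t, X r ∈ S) → (∀ r ∈ Icc s t, Y r ∈ S) →
      IsDavie α Z ZZ μ σ C s t X → IsDavie α Z ZZ μ σ C s t Y →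
      ‖X t - Y t‖ ≤ 2 * ‖X s - Y s‖ := by
  obtain ⟨A, h₀, hA, h0, h1, hAh, -, -, hst⟩ := approx_scheme_stability hα hα' hZ hc
  refine ⟨h₀, h0, ?_⟩
  intro s t C X Y hs hst' hT hh hXS hYS hX hY
  rcases hst'.eq_or_lt with rfl | hlt
  · linarith [norm_nonneg (X s - Y s)]
  have hlim := tendsto_mesh_rpow hα (max C 0) (t - s)
  have hlim2 : Tendsto (fun n : ℕ => 2 * ‖X s - Y s‖
      + 2 * (max C 0 * ((t - s) / 2 ^ n) ^ (3 * α - 1))) atTop (𝓝 (2 * ‖X s - Y s‖ + 2 * 0)) :=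
    (hlim.const_mul 2).const_add _
  rw [mul_zero, add_zero] at hlim2
  refine ge_of_tendsto hlim2 ?_
  filter_upwards [hlim.eventually (ge_mem_nhds (show (0 : ℝ) < 1 by norm_num))] with n hn
  set d := (t - s) / 2 ^ n with hd
  have hd0 : 0 < d := div_pos (by linarith) (by positivity)
  have hNd : ((2 ^ n : ℕ) : ℝ) * d = t - s := by rw [hd]; push_cast; field_simp
  have hgm : ∀ k : ℕ, k < 2 ^ n → s + (k : ℝ) * d ∈ Icc s t := fun k hk =>
    ⟨le_add_of_nonneg_right (by positivity), (grid_mono s hd0.le hk.le).trans (by rw [hNd]; linarith)⟩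
  have hC : ∀ X, IsDavie α Z ZZ μ σ C s t X → IsDavie α Z ZZ μ σ (max C 0) s t X :=
    fun X h u v h1 h2 h3 => (h u v h1 h2 h3).trans (by
      have : 0 ≤ ((v - u) ^ α) ^ 3 := pow_nonneg (Real.rpow_nonneg (by linarith) _) _
      gcongr
      exact le_max_left _ _)
  have := hst s d (max C 0 * d ^ (3 * α - 1)) (2 ^ n) (fun k => X (s + k * d))
    (fun k => Y (s + k * d)) hs hd0 (by rw [hNd]; linarith) (by rw [hNd]; linarith)
    (by positivity) hn (fun k hk => hXS _ (hgm k hk)) (fun k hk => hYS _ (hgm k hk))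
    ((hC X hX).grid le_rfl hd0 (by rw [hNd]; linarith))
    ((hC Y hY).grid le_rfl hd0 (by rw [hNd]; linarith)) (2 ^ n) le_rfl
  simpa only [hNd, add_sub_cancel, Nat.cast_zero, zero_mul, add_zero] using this

/-- The scheme and the solution start at the same point, so only the local error of the solution
contributes. The rate does not depend on the starting point, which later makes convergence uniform.
-/
theorem eulerIter_sub_davie_le (hα : 1 / 3 < α) (hα' : α ≤ 1 / 2) (hZ : RoughBound α T M Z ZZ)
    (hc : CoefBound S L μ σ) {S₀ : Set W} (hS₀ : ∀ x ∈ S₀, ∀ y, ‖y - x‖ ≤ 1 → y ∈ S) :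
    ∃ h₀ : ℝ, 0 < h₀ ∧ ∀ (s t C : ℝ) (X : ℝ → W) (n : ℕ), 0 ≤ s → s < t → t ≤ T → t - s ≤ h₀ →
      0 ≤ C → X s ∈ S₀ → (∀ r ∈ Icc s t, X r ∈ S) → IsDavie α Z ZZ μ σ C s t X →
      C * ((t - s) / 2 ^ n) ^ (3 * α - 1) ≤ 1 →
      ‖eulerIter Z ZZ μ σ s ((t - s) / 2 ^ n) (2 ^ n) (X s) - X t‖
        ≤ 2 * (C * ((t - s) / 2 ^ n) ^ (3 * α - 1)) := by
  obtain ⟨A, h₀, hA, h0, h1, hAh, -, -, hst⟩ := approx_scheme_stability hα hα' hZ hc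
  obtain ⟨A', h₁, hA', h₁0, h₁1, hit⟩ := eulerIter_bounds hα hα' hZ hc hS₀
  refine ⟨min h₀ h₁, by positivity, ?_⟩
  intro s t C X n hs hlt hT hh hC hXs hXS hX hn
  have hh0 := hh.trans (min_le_left _ _)
  have hh1 := hh.trans (min_le_right _ _)
  set d := (t - s) / 2 ^ n with hd
  have hd0 : 0 < d := div_pos (by linarith) (by positivity)
  have hNd : ((2 ^ n : ℕ) : ℝ) * d = t - s := by rw [hd]; push_cast; field_simp
  have hgm : ∀ k : ℕ, k < 2 ^ n → s + (k : ℝ) * d ∈ Icc s t := fun k hk =>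
    ⟨le_add_of_nonneg_right (by positivity), (grid_mono s hd0.le hk.le).trans (by rw [hNd]; linarith)⟩
  obtain ⟨hmem, -, -⟩ := hit s d (2 ^ n) (X s) hs hd0 (by rw [hNd]; linarith)
    (by rw [hNd]; linarith) hXs
  have := hst s d (C * d ^ (3 * α - 1)) (2 ^ n) (fun k => eulerIter Z ZZ μ σ s d k (X s))
    (fun k => X (s + k * d)) hs hd0 (by rw [hNd]; linarith) (by rw [hNd]; linarith)
    (by positivity) hn (fun k hk => hmem k hk.le) (fun k hk => hXS _ (hgm k hk))
    (fun k _ => by simp only [eulerIter, sub_self, norm_zero]; positivity)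
    (hX.grid le_rfl hd0 (by rw [hNd]; linarith)) (2 ^ n) le_rfl
  simpa only [hNd, eulerIter, add_sub_cancel, Nat.cast_zero, zero_mul, add_zero, sub_self,
    norm_zero, mul_zero, zero_add] using this

theorem IsDavie.increment_le (hα : 1 / 3 < α) (hα' : α ≤ 1 / 2) (hZ : RoughBound α T M Z ZZ)
    (hc : CoefBound S L μ σ) {C a b u v : ℝ} {X : ℝ → W} (hC : 0 ≤ C) (ha : 0 ≤ a) (hb : b ≤ T)
    (h : IsDavie α Z ZZ μ σ C a b X) (h1 : a ≤ u) (h2 : u ≤ v) (h3 : v ≤ b) (huv : v - u ≤ 1)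
    (hXu : X u ∈ S) :
    ‖X v - X u‖ ≤ (L * M + (L * M + (L + C))) * (v - u) ^ α ∧
      ‖X v - X u - σ (X u) (Z v - Z u)‖ ≤ (L * M + (L * M + (L + C))) * ((v - u) ^ α) ^ 2 := by
  have hL := hc.nonneg
  have h0 : 0 ≤ v - u := by linarith
  have hq0 : 0 ≤ (v - u) ^ α := by positivity
  have hq1 : (v - u) ^ α ≤ 1 := Real.rpow_le_one h0 huv (by linarith)
  refine hc.increment_le hXu hq0 hq1 hZ.nonneg (by positivity)
    (hZ.path u v (by linarith) h2 (by linarith)) (hZ.area u v (by linarith) h2 (by linarith)) ?_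
  have e : X v - X u - germ Z ZZ σ u v (X u)
      = (X v - eulerStep Z ZZ μ σ u v (X u)) + (v - u) • μ (X u) := by
    rw [eulerStep]; abel
  rw [e]
  have hd := h u v h1 h2 h3
  have ht := le_rpow_sq hα' h0 huv
  have hmu : ‖(v - u) • μ (X u)‖ ≤ (v - u) * L := by
    rw [norm_smul, Real.norm_of_nonneg h0]
    gcongr
    exact hc.drift_le _ hXu
  generalize (v - u) ^ α = q at *
  calc _ ≤ C * q ^ 3 + (v - u) * L := (norm_add_le _ _).trans (by gcongr)
    _ ≤ C * q ^ 2 + q ^ 2 * L := by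
        have : q ^ 3 ≤ q ^ 2 := by nlinarith [sq_nonneg q]
        gcongr
    _ = _ := by ring

end Davie

/-! ### Convergence of dyadic Euler schemes to a Davie solution. -/

section Existence

variable {m : ℕ} {W : Type*} [NormedAddCommGroup W] [NormedSpace ℝ W]
variable {S : Set W} {L M α T : ℝ} {μ : W → W} {σ : W → EuclideanSpace ℝ (Fin m) →L[ℝ] W}
  {Z : ℝ → EuclideanSpace ℝ (Fin m)} {ZZ : ℝ → ℝ → Matrix (Fin m) (Fin m) ℝ}

theorem tendsto_rpow_sub_zero {ι : Type*} {l : Filter ι} (hα : 0 < α) {f : ι → ℝ} {a : ℝ}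
    (h : Tendsto f l (𝓝 a)) : Tendsto (fun n => (a - f n) ^ α) l (𝓝 0) := by
  have h1 : Tendsto (fun n => a - f n) l (𝓝 0) := by simpa using h.const_sub a
  simpa [Real.zero_rpow hα.ne'] using h1.rpow_const (p := α) (Or.inr hα.le)

theorem RoughBound.tendsto_path {ι : Type*} {l : Filter ι} (hα : 0 < α)
    (hZ : RoughBound α T M Z ZZ) {f : ι → ℝ} {a : ℝ} (h0 : ∀ n, 0 ≤ f n) (h1 : ∀ n, f n ≤ a)
    (haT : a ≤ T) (h : Tendsto f l (𝓝 a)) : Tendsto (fun n => Z (f n)) l (𝓝 (Z a)) := by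
  rw [tendsto_iff_norm_sub_tendsto_zero]
  have h2 := (tendsto_rpow_sub_zero hα h).const_mul M
  rw [mul_zero] at h2
  refine squeeze_zero (fun _ => norm_nonneg _) (fun n => ?_) h2
  rw [norm_sub_rev]
  exact hZ.path _ _ (h0 n) (h1 n) haT

/-- Chen's relation expresses the second level over the smaller interval through the one over `[a,
b]` and those of two short intervals, which tend to zero. -/
theorem RoughBound.tendsto_area {ι : Type*} {l : Filter ι} (hα : 0 < α)
    (hZ : RoughBound α T M Z ZZ) {f g : ι → ℝ} {a b : ℝ} (h0 : ∀ n, 0 ≤ f n)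
    (h1 : ∀ n, f n ≤ a) (hfg : ∀ n, f n ≤ g n) (h2 : ∀ n, g n ≤ b) (hab : a ≤ b)
    (hbT : b ≤ T) (hf : Tendsto f l (𝓝 a)) (hg : Tendsto g l (𝓝 b)) (i j : Fin m) :
    Tendsto (fun n => ZZ (f n) (g n) i j) l (𝓝 (ZZ a b i j)) := by
  have hent : ∀ u v, 0 ≤ u → u ≤ v → v ≤ T → |ZZ u v i j| ≤ M * ((v - u) ^ α) ^ 2 := by
    intro u v hu huv hv
    refine le_trans ?_ (hZ.area u v hu huv hv)
    refine le_trans ?_ (Finset.single_le_sum (f := fun i => ∑ j, |ZZ u v i j|)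
      (fun i _ => Finset.sum_nonneg fun j _ => abs_nonneg _) (Finset.mem_univ i))
    exact Finset.single_le_sum (f := fun j => |ZZ u v i j|) (fun j _ => abs_nonneg _)
      (Finset.mem_univ j)
  have hZf := hZ.tendsto_path hα h0 h1 (hab.trans hbT) hf
  have hZg := hZ.tendsto_path hα (fun n => (h0 n).trans (hfg n)) h2 hbT hg
  have hco : ∀ k : Fin m, Continuous fun v : EuclideanSpace ℝ (Fin m) => v k := fun k => by
    fun_prop
  have t1 : Tendsto (fun n => ZZ (f n) a i j) l (𝓝 0) := by
    refine squeeze_zero_norm (fun n => hent _ _ (h0 n) (h1 n) (hab.trans hbT)) ?_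
    simpa using ((tendsto_rpow_sub_zero hα hf).pow 2).const_mul M
  have t2 : Tendsto (fun n => ZZ (g n) b i j) l (𝓝 0) := by
    refine squeeze_zero_norm (fun n => hent _ _ ((h0 n).trans (hfg n)) (h2 n) hbT) ?_
    simpa using ((tendsto_rpow_sub_zero hα hg).pow 2).const_mul M
  have hZfi := (hco i).continuousAt.tendsto.comp hZf
  have hZgi := (hco i).continuousAt.tendsto.comp hZg
  have hZgj := (hco j).continuousAt.tendsto.comp hZg
  have key : ∀ n, ZZ (f n) (g n) i j = ZZ (f n) a i j + ZZ a b i j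
      + (Z a i - Z (f n) i) * (Z b j - Z a j) - ZZ (g n) b i j
      - (Z (g n) i - Z (f n) i) * (Z b j - Z (g n) j) := by
    intro n
    have e1 := hZ.chen (f n) a b (h0 n) (h1 n) hab hbT i j
    have e2 := hZ.chen (f n) (g n) b (h0 n) (hfg n) (h2 n) hbT i j
    linarith
  simp only [key]
  have := (((t1.add_const (ZZ a b i j)).add
    ((hZfi.const_sub (Z a i)).mul_const (Z b j - Z a j))).sub t2).sub
    ((hZgi.sub hZfi).mul (hZgj.const_sub (Z b j)))
  simpa using this

theorem tendsto_clm_apply {ι V U : Type*} [NormedAddCommGroup U] [NormedSpace ℝ U]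
    [NormedAddCommGroup V] [NormedSpace ℝ V] {l : Filter ι} {A : ι → V →L[ℝ] U} {B : V →L[ℝ] U}
    {v : ι → V} {w : V} (hA : Tendsto A l (𝓝 B)) (hv : Tendsto v l (𝓝 w)) :
    Tendsto (fun n => A n (v n)) l (𝓝 (B w)) :=
  (isBoundedBilinearMap_apply.continuous.tendsto (B, w)).comp (hA.prodMk_nhds hv)

theorem tendsto_contract {ι U : Type*} [NormedAddCommGroup U] [NormedSpace ℝ U] {l : Filter ι}
    {A : ι → EuclideanSpace ℝ (Fin m) →L[ℝ] EuclideanSpace ℝ (Fin m) →L[ℝ] U}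
    {B : EuclideanSpace ℝ (Fin m) →L[ℝ] EuclideanSpace ℝ (Fin m) →L[ℝ] U}
    {N : ι → Matrix (Fin m) (Fin m) ℝ} {P : Matrix (Fin m) (Fin m) ℝ}
    (hA : Tendsto A l (𝓝 B)) (hN : ∀ i j, Tendsto (fun n => N n i j) l (𝓝 (P i j))) :
    Tendsto (fun n => contract (A n) (N n)) l (𝓝 (contract B P)) := by
  unfold contract
  refine tendsto_finsetSum _ fun i _ => tendsto_finsetSum _ fun j _ => (hN i j).smul ?_
  exact tendsto_clm_apply (tendsto_clm_apply hA tendsto_const_nhds) tendsto_const_nhds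

theorem tendsto_of_lipschitz_on {ι W' U : Type*} [NormedAddCommGroup W'] [NormedAddCommGroup U]
    {S : Set W'} {L : ℝ} {l : Filter ι} {f : W' → U}
    (hf : ∀ x ∈ S, ∀ y ∈ S, ‖f x - f y‖ ≤ L * ‖x - y‖) {x : ι → W'} {y : W'}
    (hx : ∀ n, x n ∈ S) (hy : y ∈ S) (h : Tendsto x l (𝓝 y)) :
    Tendsto (fun n => f (x n)) l (𝓝 (f y)) := by
  rw [tendsto_iff_norm_sub_tendsto_zero] at h ⊢
  refine squeeze_zero (fun _ => norm_nonneg _) (fun n => hf _ (hx n) _ hy) ?_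
  simpa using h.const_mul L

theorem CoefBound.tendsto_eulerStep {ι : Type*} {l : Filter ι} (hα : 0 < α)
    (hZ : RoughBound α T M Z ZZ) (hc : CoefBound S L μ σ) {f g : ι → ℝ} {a b : ℝ}
    (h0 : ∀ n, 0 ≤ f n)
    (h1 : ∀ n, f n ≤ a) (hfg : ∀ n, f n ≤ g n) (h2 : ∀ n, g n ≤ b) (hab : a ≤ b)
    (hbT : b ≤ T) (hf : Tendsto f l (𝓝 a)) (hg : Tendsto g l (𝓝 b)) {x : ι → W} {y : W}
    (hx : ∀ n, x n ∈ S) (hy : y ∈ S) (h : Tendsto x l (𝓝 y)) :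
    Tendsto (fun n => eulerStep Z ZZ μ σ (f n) (g n) (x n)) l
      (𝓝 (eulerStep Z ZZ μ σ a b y)) := by
  unfold eulerStep germ
  refine (h.add ((tendsto_clm_apply (tendsto_of_lipschitz_on hc.lip hx hy h) ?_).add ?_)).add ?_
  · exact (hZ.tendsto_path hα (fun n => (h0 n).trans (hfg n)) h2 hbT hg).sub
      (hZ.tendsto_path hα h0 h1 (hab.trans hbT) hf)
  · exact tendsto_contract (tendsto_of_lipschitz_on hc.gamma_lip hx hy h)
      (hZ.tendsto_area hα h0 h1 hfg h2 hab hbT hf hg)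
  · exact (hg.sub hf).smul (tendsto_of_lipschitz_on hc.drift_lip hx hy h)

/-- Two steps of the fine scheme differ from one coarse step by `A * d ^ (3 * α)`, so the fine
scheme at even nodes is an approximate coarse scheme. Stability costs `2 * A`, and a possible last
unpaired half step costs another `A`. -/
theorem eulerIter_refine (hα : 1 / 3 < α) (hα' : α ≤ 1 / 2) (hZ : RoughBound α T M Z ZZ)
    (hc : CoefBound S L μ σ) {S₀ : Set W} (hS₀ : ∀ x ∈ S₀, ∀ y, ‖y - x‖ ≤ 1 → y ∈ S) :
    ∃ A h₀ : ℝ, 0 ≤ A ∧ 0 < h₀ ∧ h₀ ≤ 1 ∧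
      ∀ (s d : ℝ) (N : ℕ) (x : W), 0 ≤ s → 0 < d → s + N * d ≤ T → N * d ≤ h₀ → 0 < N → x ∈ S₀ →
        ∀ r, s ≤ r → r ≤ s + N * d →
          ‖eulerIter Z ZZ μ σ s d ⌊(r - s) / d⌋₊ x
            - eulerIter Z ZZ μ σ s (d / 2) ⌊(r - s) / (d / 2)⌋₊ x‖ ≤ A * d ^ (3 * α - 1) := by
  obtain ⟨-, h₁, -, h₁0, h₁1, -, -, -, hst⟩ := approx_scheme_stability hα hα' hZ hc
  obtain ⟨A, h₂, hA, h₂0, h₂1, hit⟩ := eulerIter_bounds hα hα' hZ hc hS₀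
  obtain ⟨h₃, h₃0, h₃1, hAd⟩ := exists_step_rpow hα hA
  refine ⟨3 * A, min h₁ (min h₂ h₃), by positivity, by positivity,
    (min_le_left _ _).trans h₁1, ?_⟩
  intro s d N x hs hd hT hN hN0 hx r hsr hr
  have hle1 := hN.trans (min_le_left _ _)
  have hle2 := (hN.trans (min_le_right _ _)).trans (min_le_left _ _)
  have hle3 := (hN.trans (min_le_right _ _)).trans (min_le_right _ _)
  have hdh : d ≤ N * d := by
    have : (1 : ℝ) ≤ N := by exact_mod_cast hN0
    nlinarith
  obtain ⟨hm, -, -⟩ := hit s d N x hs hd hT hle2 hx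
  have hN2 : ((2 * N : ℕ) : ℝ) * (d / 2) = N * d := by push_cast; ring
  obtain ⟨hm', hh', hd'⟩ := hit s (d / 2) (2 * N) x hs (by positivity) (by rw [hN2]; exact hT)
    (by rw [hN2]; exact hle2) hx
  set k := ⌊(r - s) / d⌋₊ with hk
  have hkd : (k : ℝ) ≤ (r - s) / d := Nat.floor_le (div_nonneg (by linarith) hd.le)
  have hkd' : (r - s) / d < k + 1 := Nat.lt_floor_add_one _
  have hkN : k ≤ N := by
    have : (r - s) / d ≤ N := by rw [div_le_iff₀ hd]; linarith
    exact_mod_cast hkd.trans this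
  have e2 : (r - s) / (d / 2) = 2 * ((r - s) / d) := by field_simp
  -- The fine index of time `r` is either `2 * k` or `2 * k + 1`.
  have hk1 : 2 * k ≤ ⌊(r - s) / (d / 2)⌋₊ := by
    apply Nat.le_floor
    rw [e2]; push_cast; linarith
  have hk2 : ⌊(r - s) / (d / 2)⌋₊ < 2 * k + 2 := by
    rw [Nat.floor_lt (by rw [e2]; have := div_nonneg (sub_nonneg.2 hsr) hd.le; linarith), e2]
    push_cast; linarith
  have hk3 : ⌊(r - s) / (d / 2)⌋₊ ≤ 2 * N := by
    have : (r - s) / (d / 2) ≤ (2 * N : ℕ) := by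
      rw [div_le_iff₀ (by positivity), hN2]; linarith
    exact Nat.floor_le_of_le this
  have hcmp := hst s d (A * d ^ (3 * α - 1)) N (fun k => eulerIter Z ZZ μ σ s d k x)
    (fun k => eulerIter Z ZZ μ σ s (d / 2) (2 * k) x) hs hd hT hle1 (by positivity)
    (hAd d hd (hdh.trans hle3)) (fun k hk => hm k hk.le) (fun k hk => hm' (2 * k) (by omega))
    (fun k _ => by simp only [eulerIter, sub_self, norm_zero]; positivity)
    (fun k hk => by
      have h := hd' (2 * k) 2 (by omega)
      have e1 : s + ((2 * k : ℕ) : ℝ) * (d / 2) = s + k * d := by push_cast; ring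
      have e3 : s + ((2 * k + 2 : ℕ) : ℝ) * (d / 2) = s + (k + 1 : ℕ) * d := by push_cast; ring
      have e4 : ((2 : ℕ) : ℝ) * (d / 2) = d := by push_cast; ring
      rw [e1, e3, e4, rpow_cube_eq hd] at h
      rw [mul_assoc]
      exact h) k hkN
  have e0 : ‖eulerIter Z ZZ μ σ s d 0 x - eulerIter Z ZZ μ σ s (d / 2) (2 * 0) x‖ = 0 := by
    simp [eulerIter]
  rw [e0] at hcmp
  have hlast : ‖eulerIter Z ZZ μ σ s (d / 2) ⌊(r - s) / (d / 2)⌋₊ x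
      - eulerIter Z ZZ μ σ s (d / 2) (2 * k) x‖ ≤ A * d ^ (3 * α - 1) := by
    obtain ⟨i, hi⟩ := Nat.exists_eq_add_of_le hk1
    have hi1 : (i : ℝ) ≤ 1 := by
      have : i ≤ 1 := by omega
      exact_mod_cast this
    rw [hi]
    refine (hh' (2 * k) i (by omega)).trans ?_
    gcongr
    calc ((i : ℝ) * (d / 2)) ^ α ≤ d ^ α := by
          apply Real.rpow_le_rpow (by positivity) _ (by linarith)
          nlinarith
      -- Valid because `3 * α - 1 ≤ α`, that is `α ≤ 1 / 2`, and `d ≤ 1`.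
      _ ≤ d ^ (3 * α - 1) :=
          Real.rpow_le_rpow_of_exponent_ge hd (hdh.trans (hle1.trans h₁1)) (by linarith)
  calc _ ≤ ‖eulerIter Z ZZ μ σ s d k x - eulerIter Z ZZ μ σ s (d / 2) (2 * k) x‖
        + ‖eulerIter Z ZZ μ σ s (d / 2) (2 * k) x
          - eulerIter Z ZZ μ σ s (d / 2) ⌊(r - s) / (d / 2)⌋₊ x‖ := norm_sub_le_norm_sub_add_norm_sub _ _ _
    _ ≤ (2 * 0 + 2 * (A * d ^ (3 * α - 1))) + A * d ^ (3 * α - 1) :=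
        add_le_add hcmp (by rw [norm_sub_rev]; exact hlast)
    _ = _ := by ring

/-- By `eulerIter_refine` successive dyadic schemes differ by a geometric sequence of ratio `(1 / 2)
^ (3 * α - 1) < 1`. The Davie bound between nodes is uniform in the mesh and passes to the limit by
continuity of the Euler step; closedness of `S` keeps the limit in `S`. -/
theorem davie_exists [CompleteSpace W] (hα : 1 / 3 < α) (hα' : α ≤ 1 / 2)
    (hZ : RoughBound α T M Z ZZ) (hc : CoefBound S L μ σ) (hS : IsClosed S) {S₀ : Set W}
    (hS₀ : ∀ x ∈ S₀, ∀ y, ‖y - x‖ ≤ 1 → y ∈ S) :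
    ∃ C h₀ : ℝ, 0 ≤ C ∧ 0 < h₀ ∧ h₀ ≤ 1 ∧
      ∀ s t : ℝ, 0 ≤ s → s ≤ t → t ≤ T → t - s ≤ h₀ → ∀ x ∈ S₀, ∃ X : ℝ → W, X s = x ∧
        (∀ r ∈ Icc s t, X r ∈ S) ∧ IsDavie α Z ZZ μ σ C s t X := by
  obtain ⟨A, h₁, hA, h₁0, h₁1, href⟩ := eulerIter_refine hα hα' hZ hc hS₀
  obtain ⟨A', h₂, hA', h₂0, h₂1, hit⟩ := eulerIter_bounds hα hα' hZ hc hS₀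
  refine ⟨A', min h₁ h₂, hA', by positivity, (min_le_left _ _).trans h₁1, ?_⟩
  intro s t hs hst hT hh x hx
  have hα0 : 0 < α := by linarith
  rcases hst.eq_or_lt with rfl | hlt
  · refine ⟨fun _ => x, rfl, fun _ _ => hS₀ x hx x (by simp), ?_⟩
    intro u v h1 h2 h3
    obtain rfl : u = v := by linarith
    rw [hZ.eulerStep_self hα0 (by linarith) (by linarith), sub_self, norm_zero]
    have : 0 ≤ u - u := by simp
    positivity
  set τ := t - s with hτ
  have hτ0 : 0 < τ := by linarith
  have hd0 : ∀ n : ℕ, 0 < τ / 2 ^ n := fun n => by positivity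
  have hNd : ∀ n : ℕ, ((2 ^ n : ℕ) : ℝ) * (τ / 2 ^ n) = τ := fun n => by
    push_cast; field_simp
  -- Each approximation is piecewise constant: its value at `r` is the iterate at the last grid node
  -- not after `r`.
  set P : ℕ → ℝ → W := fun n r => eulerIter Z ZZ μ σ s (τ / 2 ^ n) ⌊(r - s) / (τ / 2 ^ n)⌋₊ x
    with hP
  have hfl : ∀ n, ∀ r ∈ Icc s t, ⌊(r - s) / (τ / 2 ^ n)⌋₊ ≤ 2 ^ n := by
    intro n r hr
    apply Nat.floor_le_of_le
    rw [div_le_iff₀ (hd0 n), hNd]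
    linarith [hr.2]
  have hb := fun n : ℕ => hit s (τ / 2 ^ n) (2 ^ n) x hs (hd0 n) (by rw [hNd]; linarith)
    (by rw [hNd]; exact hh.trans (min_le_right _ _)) hx
  have hPS : ∀ n, ∀ r ∈ Icc s t, P n r ∈ S := fun n r hr => (hb n).1 _ (hfl n r hr)
  have hcau : ∀ r ∈ Icc s t, CauchySeq fun n => P n r := by
    intro r hr
    refine cauchySeq_of_le_geometric ((1 / 2 : ℝ) ^ (3 * α - 1)) (A * τ ^ (3 * α - 1))
      (Real.rpow_lt_one (by norm_num) (by norm_num) (by linarith)) fun n => ?_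
    rw [dist_eq_norm]
    have h := href s (τ / 2 ^ n) (2 ^ n) x hs (hd0 n) (by rw [hNd]; linarith)
      (by rw [hNd]; exact hh.trans (min_le_left _ _)) (by positivity) hx r hr.1
      (by rw [hNd]; linarith [hr.2])
    have e1 : τ / 2 ^ n / 2 = τ / 2 ^ (n + 1) := by rw [pow_succ]; field_simp
    have e2 : (τ / 2 ^ n) ^ (3 * α - 1)
        = τ ^ (3 * α - 1) * ((1 / 2 : ℝ) ^ (3 * α - 1)) ^ n := by
      rw [Real.rpow_pow_comm (by norm_num), ← Real.mul_rpow hτ0.le (by positivity)]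
      congr 1
      rw [one_div, inv_pow, div_eq_mul_inv]
    rw [e1, e2, ← mul_assoc] at h
    exact h
  choose! X hX using fun r (hr : r ∈ Icc s t) => cauchySeq_tendsto_of_complete (hcau r hr)
  have hXS : ∀ r ∈ Icc s t, X r ∈ S := fun r hr =>
    hS.mem_of_tendsto (hX r hr) (Eventually.of_forall fun n => hPS n r hr)
  have hss : s ∈ Icc s t := ⟨le_rfl, hst⟩
  refine ⟨X, ?_, hXS, ?_⟩
  · refine tendsto_nhds_unique (hX s hss) ?_
    have : ∀ n, P n s = x := fun n => by simp [hP, eulerIter]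
    simp only [this]
    exact tendsto_const_nhds
  · intro u v h1 h2 h3
    have hu : u ∈ Icc s t := ⟨h1, h2.trans h3⟩
    have hv : v ∈ Icc s t := ⟨h1.trans h2, h3⟩
    have hgle : ∀ r ∈ Icc s t, ∀ n : ℕ,
        s + ⌊(r - s) / (τ / 2 ^ n)⌋₊ * (τ / 2 ^ n) ≤ r := by
      intro r hr n
      have := Nat.floor_le (div_nonneg (sub_nonneg.2 hr.1) (hd0 n).le)
      rw [le_div_iff₀ (hd0 n)] at this
      linarith
    have hmesh : Tendsto (fun n : ℕ => τ / (2 : ℝ) ^ n) atTop (𝓝 0) :=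
      tendsto_const_nhds.div_atTop (tendsto_pow_atTop_atTop_of_one_lt (by norm_num))
    have hgt : ∀ r ∈ Icc s t, Tendsto
        (fun n : ℕ => s + ⌊(r - s) / (τ / 2 ^ n)⌋₊ * (τ / 2 ^ n)) atTop (𝓝 r) := by
      intro r hr
      have hlow : Tendsto (fun n : ℕ => r - τ / (2 : ℝ) ^ n) atTop (𝓝 r) := by
        simpa using hmesh.const_sub r
      refine tendsto_of_tendsto_of_tendsto_of_le_of_le hlow tendsto_const_nhds (fun n => ?_)
        (hgle r hr)
      have := Nat.lt_floor_add_one ((r - s) / (τ / 2 ^ n))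
      rw [div_lt_iff₀ (hd0 n)] at this
      simp only
      linarith
    have hmono : ∀ n : ℕ, ⌊(u - s) / (τ / 2 ^ n)⌋₊ ≤ ⌊(v - s) / (τ / 2 ^ n)⌋₊ := fun n =>
      Nat.floor_le_floor (by gcongr)
    have hle : ∀ n : ℕ, ‖P n v - eulerStep Z ZZ μ σ (s + ⌊(u - s) / (τ / 2 ^ n)⌋₊ * (τ / 2 ^ n))
        (s + ⌊(v - s) / (τ / 2 ^ n)⌋₊ * (τ / 2 ^ n)) (P n u)‖
        ≤ A' * (((s + ⌊(v - s) / (τ / 2 ^ n)⌋₊ * (τ / 2 ^ n))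
          - (s + ⌊(u - s) / (τ / 2 ^ n)⌋₊ * (τ / 2 ^ n))) ^ α) ^ 3 := by
      intro n
      obtain ⟨i, hi⟩ := Nat.exists_eq_add_of_le (hmono n)
      have h := (hb n).2.2 ⌊(u - s) / (τ / 2 ^ n)⌋₊ i (by rw [← hi]; exact hfl n v hv)
      rw [← hi] at h
      convert h using 4
      rw [hi, grid_sub]
    refine le_of_tendsto_of_tendsto' ((hX v hv).sub (hc.tendsto_eulerStep hα0 hZ ?_ (hgle u hu)
      ?_ (hgle v hv) h2 (h3.trans hT) (hgt u hu) (hgt v hv) (fun n => hPS n u hu) (hXS u hu)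
      (hX u hu))).norm ?_ hle
    · intro n
      have := hd0 n
      positivity
    · exact fun n => grid_mono s (hd0 n).le (hmono n)
    · exact ((((hgt v hv).sub (hgt u hu)).rpow_const (Or.inr hα0.le)).pow 3).const_mul A'

end Existence

/-! ### Functions with bounded Lipschitz derivatives on a set. -/

section BoundedLipschitz

/-- `f` is bounded and Lipschitz continuous on `S`. -/
def BddLip {W U : Type} [NormedAddCommGroup W] [NormedAddCommGroup U] (S : Set W) (f : W → U) :
    Prop :=
  ∃ C : ℝ, 0 ≤ C ∧ (∀ x ∈ S, ‖f x‖ ≤ C) ∧ ∀ x ∈ S, ∀ y ∈ S, ‖f x - f y‖ ≤ C * ‖x - y‖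

/-- `f` is `k` times differentiable, and `f` and its derivatives up to order `k` are bounded and
Lipschitz continuous on `S`. -/
def IsBL {W : Type} [NormedAddCommGroup W] [NormedSpace ℝ W] (S : Set W) :
    ℕ → ∀ {U : Type} [NormedAddCommGroup U] [NormedSpace ℝ U], (W → U) → Prop
  | 0, _, _, _, f => BddLip S f
  | k + 1, _, _, _, f => Differentiable ℝ f ∧ BddLip S f ∧ IsBL S k (fderiv ℝ f)

variable {W W' U U' U'' : Type} [NormedAddCommGroup W] [NormedSpace ℝ W]
  [NormedAddCommGroup W'] [NormedSpace ℝ W']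
  [NormedAddCommGroup U] [NormedSpace ℝ U] [NormedAddCommGroup U'] [NormedSpace ℝ U']
  [NormedAddCommGroup U''] [NormedSpace ℝ U''] {S : Set W} {S' : Set W'}

theorem BddLip.add {f g : W → U} (hf : BddLip S f) (hg : BddLip S g) :
    BddLip S fun x => f x + g x := by
  obtain ⟨C, hC, h1, h2⟩ := hf
  obtain ⟨D, hD, h3, h4⟩ := hg
  refine ⟨C + D, by positivity, fun x hx => (norm_add_le _ _).trans
    (add_le_add (h1 x hx) (h3 x hx)), fun x hx y hy => ?_⟩
  rw [add_sub_add_comm, add_mul]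
  exact (norm_add_le _ _).trans (add_le_add (h2 x hx y hy) (h4 x hx y hy))

theorem BddLip.bilin (B : U →L[ℝ] U' →L[ℝ] U'') {f : W → U} {g : W → U'} (hf : BddLip S f)
    (hg : BddLip S g) : BddLip S fun x => B (f x) (g x) := by
  obtain ⟨C, hC, h1, h2⟩ := hf
  obtain ⟨D, hD, h3, h4⟩ := hg
  refine ⟨‖B‖ * C * D + ‖B‖ * C * D, by positivity, fun x hx => ?_, fun x hx y hy => ?_⟩
  · have := B.le_opNorm₂ (f x) (g x)
    have h5 : ‖B‖ * ‖f x‖ * ‖g x‖ ≤ ‖B‖ * C * D := by gcongr; exacts [h1 x hx, h3 x hx]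
    have : 0 ≤ ‖B‖ * C * D := by positivity
    linarith
  · have e : B (f x) (g x) - B (f y) (g y) = B (f x - f y) (g x) + B (f y) (g x - g y) := by
      simp only [map_sub, sub_apply]; abel
    rw [e, add_mul]
    refine (norm_add_le _ _).trans (add_le_add ?_ ?_)
    · calc _ ≤ ‖B‖ * ‖f x - f y‖ * ‖g x‖ := B.le_opNorm₂ _ _
        _ ≤ ‖B‖ * (C * ‖x - y‖) * D := by gcongr; exacts [h2 x hx y hy, h3 x hx]
        _ = _ := by ring
    · calc _ ≤ ‖B‖ * ‖f y‖ * ‖g x - g y‖ := B.le_opNorm₂ _ _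
        _ ≤ ‖B‖ * C * (D * ‖x - y‖) := by gcongr; exacts [h1 y hy, h4 x hx y hy]
        _ = _ := by ring

theorem BddLip.clm (ℓ : U →L[ℝ] U') {f : W → U} (hf : BddLip S f) :
    BddLip S fun x => ℓ (f x) := by
  obtain ⟨C, hC, h1, h2⟩ := hf
  refine ⟨‖ℓ‖ * C, by positivity, fun x hx => (ℓ.le_opNorm _).trans (by gcongr; exact h1 x hx),
    fun x hx y hy => ?_⟩
  rw [← map_sub, mul_assoc]
  exact (ℓ.le_opNorm _).trans (by gcongr; exact h2 x hx y hy)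

theorem BddLip.comp_clm (ℓ : W' →L[ℝ] W) (hℓ : ∀ x ∈ S', ℓ x ∈ S) {f : W → U}
    (hf : BddLip S f) : BddLip S' fun x => f (ℓ x) := by
  obtain ⟨C, hC, h1, h2⟩ := hf
  refine ⟨C + C * ‖ℓ‖, by positivity, fun x hx => (h1 _ (hℓ x hx)).trans
    (by have : 0 ≤ C * ‖ℓ‖ := by positivity
        linarith), fun x hx y hy => ?_⟩
  refine (h2 _ (hℓ x hx) _ (hℓ y hy)).trans ?_
  rw [← map_sub]
  calc C * ‖ℓ (x - y)‖ ≤ C * (‖ℓ‖ * ‖x - y‖) := by gcongr; exact ℓ.le_opNorm _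
    _ ≤ C * ‖x - y‖ + C * (‖ℓ‖ * ‖x - y‖) := le_add_of_nonneg_left (by positivity)
    _ = _ := by ring

theorem BddLip.const (c : U) : BddLip S fun _ => c :=
  ⟨‖c‖, norm_nonneg _, fun _ _ => le_rfl, fun x _ y _ => by simp; positivity⟩

theorem IsBL.bddLip : ∀ {k : ℕ} {f : W → U}, IsBL S k f → BddLip S f
  | 0, _, h => h
  | _ + 1, _, h => h.2.1

theorem IsBL.of_succ {k : ℕ} {f : W → U} (h : IsBL S (k + 1) f) : IsBL S k f := by
  induction k generalizing U with
  | zero => exact h.bddLip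
  | succ k ih => exact ⟨h.1, h.2.1, ih h.2.2⟩

theorem IsBL.add {k : ℕ} {f g : W → U} (hf : IsBL S k f) (hg : IsBL S k g) :
    IsBL S k fun x => f x + g x := by
  induction k generalizing U with
  | zero => exact BddLip.add hf hg
  | succ k ih =>
    refine ⟨hf.1.add hg.1, hf.2.1.add hg.2.1, ?_⟩
    have : fderiv ℝ (fun x => f x + g x) = fun x => fderiv ℝ f x + fderiv ℝ g x := by
      ext1 x; exact fderiv_fun_add (hf.1 x) (hg.1 x)
    rw [this]
    exact ih hf.2.2 hg.2.2

theorem IsBL.clm (ℓ : U →L[ℝ] U') {k : ℕ} {f : W → U} (hf : IsBL S k f) :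
    IsBL S k fun x => ℓ (f x) := by
  induction k generalizing U U' with
  | zero => exact BddLip.clm ℓ hf
  | succ k ih =>
    refine ⟨ℓ.differentiable.comp hf.1, hf.2.1.clm ℓ, ?_⟩
    have : fderiv ℝ (fun x => ℓ (f x))
        = fun x => ContinuousLinearMap.compL ℝ W U U' ℓ (fderiv ℝ f x) := by
      ext1 x; exact (ℓ.hasFDerivAt.comp x (hf.1 x).hasFDerivAt).fderiv
    rw [this]
    exact ih _ hf.2.2

theorem IsBL.bilin (B : U →L[ℝ] U' →L[ℝ] U'') {k : ℕ} {f : W → U} {g : W → U'}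
    (hf : IsBL S k f) (hg : IsBL S k g) : IsBL S k fun x => B (f x) (g x) := by
  induction k generalizing U U' U'' with
  | zero => exact BddLip.bilin B hf hg
  | succ k ih =>
    have hd : ∀ x, HasFDerivAt (fun x => B (f x) (g x))
        (B.precompR W (f x) (fderiv ℝ g x) + B.precompL W (fderiv ℝ f x) (g x)) x := fun x =>
      B.hasFDerivAt_of_bilinear (hf.1 x).hasFDerivAt (hg.1 x).hasFDerivAt
    refine ⟨fun x => (hd x).differentiableAt, hf.2.1.bilin B hg.2.1, ?_⟩
    have : fderiv ℝ (fun x => B (f x) (g x))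
        = fun x => B.precompR W (f x) (fderiv ℝ g x) + B.precompL W (fderiv ℝ f x) (g x) := by
      ext1 x; exact (hd x).fderiv
    rw [this]
    exact (ih _ (IsBL.of_succ hf) hg.2.2).add (ih _ hf.2.2 (IsBL.of_succ hg))

theorem IsBL.comp_clm (ℓ : W' →L[ℝ] W) (hℓ : ∀ x ∈ S', ℓ x ∈ S) {k : ℕ} {f : W → U}
    (hf : IsBL S k f) : IsBL S' k fun x => f (ℓ x) := by
  induction k generalizing U with
  | zero => exact BddLip.comp_clm ℓ hℓ hf
  | succ k ih =>
    refine ⟨hf.1.comp ℓ.differentiable, hf.2.1.comp_clm ℓ hℓ, ?_⟩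
    have : fderiv ℝ (fun x => f (ℓ x))
        = fun x => (ContinuousLinearMap.compL ℝ W' W U).flip ℓ (fderiv ℝ f (ℓ x)) := by
      ext1 x; exact ((hf.1 (ℓ x)).hasFDerivAt.comp x ℓ.hasFDerivAt).fderiv
    rw [this]
    exact (ih hf.2.2).clm _

theorem IsBL.const (k : ℕ) (c : U) : IsBL S k fun _ => c := by
  induction k generalizing U with
  | zero => exact BddLip.const c
  | succ k ih =>
    refine ⟨differentiable_const c, BddLip.const c, ?_⟩
    have : fderiv ℝ (fun _ : W => c) = fun _ => 0 := by ext1 x; simp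
    rw [this]
    exact ih 0

theorem IsBL.of_clm (ℓ : W →L[ℝ] U) {C : ℝ} (hC : ∀ x ∈ S, ‖ℓ x‖ ≤ C) (k : ℕ) :
    IsBL S k fun x => ℓ x := by
  have h : BddLip S fun x => ℓ x := by
    refine ⟨|C| + ‖ℓ‖, by positivity, fun x hx => (hC x hx).trans
      ((le_abs_self C).trans (le_add_of_nonneg_right (norm_nonneg _))), fun x _ y _ => ?_⟩
    rw [← map_sub]
    refine (ℓ.le_opNorm _).trans ?_
    gcongr
    exact le_add_of_nonneg_left (abs_nonneg C)
  cases k with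
  | zero => exact h
  | succ k =>
    refine ⟨ℓ.differentiable, h, ?_⟩
    have : fderiv ℝ (fun x => ℓ x) = fun _ => ℓ := by ext1 x; exact ℓ.fderiv
    rw [this]
    exact IsBL.const k ℓ

/-- Only the top derivative is assumed Lipschitz; for the lower ones this follows from the bound on
the next derivative and the mean value inequality. -/
theorem IsSteinLip.isBL {k : ℕ} {f : W → U} (h : IsSteinLip k f) : IsBL univ k f := by
  induction k generalizing U with
  | zero =>
    obtain ⟨-, M, h1, h2⟩ := h
    refine ⟨|M|, abs_nonneg M, fun x _ => ?_, fun x _ y _ => ?_⟩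
    · have := h1 0 le_rfl x
      rw [norm_iteratedFDeriv_zero] at this
      exact this.trans (le_abs_self M)
    · have := h2 x y
      rw [iteratedFDeriv_zero_eq_comp, Function.comp, Function.comp, ← map_sub,
        LinearIsometryEquiv.norm_map] at this
      exact this.trans (by gcongr; exact le_abs_self M)
  | succ k ih =>
    obtain ⟨hc, M, h1, h2⟩ := h
    have hd : Differentiable ℝ f := hc.differentiable (by simp)
    have hb : ∀ x, ‖fderiv ℝ f x‖ ≤ |M| := fun x => by
      have := h1 1 (by omega) x
      rw [norm_iteratedFDeriv_one] at this
      exact this.trans (le_abs_self M)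
    refine ⟨hd, ⟨|M|, abs_nonneg M, fun x _ => ?_, fun x _ y _ => ?_⟩, ih ⟨?_, M, ?_, ?_⟩⟩
    · have := h1 0 (by omega) x
      rw [norm_iteratedFDeriv_zero] at this
      exact this.trans (le_abs_self M)
    · exact convex_univ.norm_image_sub_le_of_norm_fderiv_le (fun x _ => hd x) (fun x _ => hb x)
        (mem_univ y) (mem_univ x)
    · exact ((contDiff_succ_iff_fderiv (n := k)).1 (by exact_mod_cast hc)).2.2
    · intro j hj x
      rw [norm_iteratedFDeriv_fderiv]
      exact h1 (j + 1) (by omega) x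
    · intro x y
      have := h2 x y
      simpa only [iteratedFDeriv_succ_eq_comp_right, Function.comp_apply, ← map_sub,
        LinearIsometryEquiv.norm_map] using this

variable {m : ℕ}

/-- Composition of continuous linear maps, as it enters `gammaOp σ σ`. -/
noncomputable def gammaL (m : ℕ) (W : Type) [NormedAddCommGroup W] [NormedSpace ℝ W] :
    (W →L[ℝ] EuclideanSpace ℝ (Fin m) →L[ℝ] W) →L[ℝ] (EuclideanSpace ℝ (Fin m) →L[ℝ] W) →L[ℝ]
      EuclideanSpace ℝ (Fin m) →L[ℝ] EuclideanSpace ℝ (Fin m) →L[ℝ] W :=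
  ContinuousLinearMap.compL ℝ (EuclideanSpace ℝ (Fin m)) W (EuclideanSpace ℝ (Fin m) →L[ℝ] W)

theorem hasFDerivAt_gammaOp {σ : W → EuclideanSpace ℝ (Fin m) →L[ℝ] W}
    (hσ : Differentiable ℝ σ) (hσ' : Differentiable ℝ (fderiv ℝ σ)) (x : W) :
    HasFDerivAt (gammaOp σ σ)
      ((gammaL m W).precompR W (fderiv ℝ σ x) (fderiv ℝ σ x)
        + (gammaL m W).precompL W (fderiv ℝ (fderiv ℝ σ) x) (σ x)) x :=
  (gammaL m W).hasFDerivAt_of_bilinear (hσ' x).hasFDerivAt (hσ x).hasFDerivAt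

theorem IsBL.gamma {σ : W → EuclideanSpace ℝ (Fin m) →L[ℝ] W} {k : ℕ} (h : IsBL S (k + 1) σ) :
    IsBL S k (gammaOp σ σ) :=
  IsBL.bilin (gammaL m W) h.2.2 h.of_succ

/-- Two derivatives of `σ` are consumed because stability compares first order Taylor remainders of
`σ` and increments of `Γσ`, which already contains `Dσ`. The drift, of second order in `q`, only
needs to be Lipschitz. -/
theorem IsBL.coefBound (hS : Convex ℝ S) {μ : W → W}
    {σ : W → EuclideanSpace ℝ (Fin m) →L[ℝ] W} (hμ : IsBL S 0 μ) (hσ : IsBL S 2 σ) :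
    ∃ L, CoefBound S L μ σ := by
  obtain ⟨L₀, h00, h01, h02⟩ := hμ.bddLip
  obtain ⟨L₁, h10, h11, h12⟩ := hσ.bddLip
  obtain ⟨L₂, h20, h21, h22⟩ := hσ.2.2.bddLip
  obtain ⟨L₃, h30, h31, h32⟩ := hσ.2.2.2.2.bddLip
  obtain ⟨L₄, h40, h41, h42⟩ := hσ.gamma.bddLip
  obtain ⟨L₅, h50, h51, h52⟩ := hσ.gamma.2.2.bddLip
  obtain ⟨L, hL⟩ : ∃ L, L = L₀ + L₁ + L₂ + L₃ + L₄ + L₅ := ⟨_, rfl⟩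
  have hL0 : 0 ≤ L := by rw [hL]; positivity
  have l0 : L₀ ≤ L := by linarith
  have l1 : L₁ ≤ L := by linarith
  have l2 : L₂ ≤ L := by linarith
  have l3 : L₃ ≤ L := by linarith
  have l4 : L₄ ≤ L := by linarith
  have l5 : L₅ ≤ L := by linarith
  have up : ∀ {a b c : ℝ}, 0 ≤ c → a ≤ b → b ≤ L → a * c ≤ L * c := fun hc hab hb => by
    gcongr; exact hab.trans hb
  have lip2 : ∀ x ∈ S, ∀ y ∈ S, ‖fderiv ℝ σ x - fderiv ℝ σ y‖ ≤ L * ‖x - y‖ := fun x hx y hy =>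
    (h22 x hx y hy).trans (by gcongr)
  have lip3 : ∀ x ∈ S, ∀ y ∈ S,
      ‖fderiv ℝ (fderiv ℝ σ) x - fderiv ℝ (fderiv ℝ σ) y‖ ≤ L * ‖x - y‖ := fun x hx y hy =>
    (h32 x hx y hy).trans (by gcongr)
  have lip5 : ∀ x ∈ S, ∀ y ∈ S,
      ‖fderiv ℝ (gammaOp σ σ) x - fderiv ℝ (gammaOp σ σ) y‖ ≤ L * ‖x - y‖ := fun x hx y hy =>
    (h52 x hx y hy).trans (by gcongr)
  exact ⟨L,
    { nonneg := hL0
      norm_le := fun x hx => (h11 x hx).trans l1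
      lip := fun x hx y hy => (h12 x hx y hy).trans (by gcongr)
      norm_fderiv_le := fun x hx => (h21 x hx).trans l2
      lip_fderiv := lip2
      taylor := fun x hx x' hx' => norm_taylor_one_le hσ.1 hS lip2 hL0 hx hx'
      taylor_sub := fun x hx x' hx' y hy y' hy' =>
        norm_taylor_one_sub_le hσ.1 hσ.2.2.1 hS lip2 (fun x hx => (h31 x hx).trans l3) lip3
          hL0 hx hx' hy hy'
      gamma_le := fun x hx => (h41 x hx).trans l4
      gamma_lip := fun x hx y hy => (h42 x hx y hy).trans (by gcongr)
      gamma_sub := fun x hx x' hx' y hy y' hy' =>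
        norm_increment_sub_le hσ.gamma.1 hS (fun x hx => (h51 x hx).trans l5) lip5
          hL0 hx hx' hy hy'
      drift_le := fun x hx => (h01 x hx).trans l0
      drift_lip := fun x hx y hy => (h02 x hx y hy).trans (by gcongr) }⟩

end BoundedLipschitz

/-! ### The tangent system and its compatibility with Euler steps. -/

section Tangent

variable {W U : Type} [NormedAddCommGroup W] [NormedSpace ℝ W]
  [NormedAddCommGroup U] [NormedSpace ℝ U] {S : Set W} {m : ℕ}

/-- The tangent map `(x, v) ↦ (f x, Df(x) v)`. -/
noncomputable def tanMap (f : W → U) (p : W × W) : U × U := (f p.1, fderiv ℝ f p.1 p.2)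

/-- The tangent of a family of vector fields. -/
noncomputable def tanField (σ : W → EuclideanSpace ℝ (Fin m) →L[ℝ] W) (p : W × W) :
    EuclideanSpace ℝ (Fin m) →L[ℝ] W × W :=
  (σ p.1).prod (fderiv ℝ σ p.1 p.2)

/-- The set over `S` on which the tangent system is considered. -/
def tanSet (S : Set W) (r : ℝ) : Set (W × W) := S ×ˢ Metric.closedBall 0 r

/-- The tangent component is linear in the vector, hence bounded only when the vector stays in a
ball; this is why all the estimates above are relative to a set `S`. -/
theorem IsBL.fderiv_apply {k : ℕ} {f : W → U} (h : IsBL S (k + 1) f) (r : ℝ) :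
    IsBL (tanSet S r) k fun p : W × W => fderiv ℝ f p.1 p.2 := by
  refine IsBL.bilin (ContinuousLinearMap.id ℝ (W →L[ℝ] U))
    (h.2.2.comp_clm (ContinuousLinearMap.fst ℝ W W) fun p hp => hp.1)
    (IsBL.of_clm (ContinuousLinearMap.snd ℝ W W) (C := r) (fun p hp => ?_) k)
  simpa [tanSet] using hp.2

theorem IsBL.tanMap {k : ℕ} {f : W → U} (h : IsBL S (k + 1) f) (r : ℝ) :
    IsBL (tanSet S r) k (tanMap f) := by
  have h1 := (h.of_succ.comp_clm (S' := tanSet S r) (ContinuousLinearMap.fst ℝ W W)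
    fun p hp => hp.1).clm (ContinuousLinearMap.inl ℝ U U)
  have h2 := (h.fderiv_apply r).clm (ContinuousLinearMap.inr ℝ U U)
  convert h1.add h2 using 2 with p
  simp [_root_.tanMap]

theorem IsBL.tanField {k : ℕ} {σ : W → EuclideanSpace ℝ (Fin m) →L[ℝ] W}
    (h : IsBL S (k + 1) σ) (r : ℝ) : IsBL (tanSet S r) k (tanField σ) := by
  have h1 := (h.of_succ.comp_clm (S' := tanSet S r) (ContinuousLinearMap.fst ℝ W W)
    fun p hp => hp.1).clm (ContinuousLinearMap.compL ℝ (EuclideanSpace ℝ (Fin m)) W (W × W)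
      (ContinuousLinearMap.inl ℝ W W))
  have h2 := (h.fderiv_apply r).clm (ContinuousLinearMap.compL ℝ (EuclideanSpace ℝ (Fin m)) W
    (W × W) (ContinuousLinearMap.inr ℝ W W))
  convert h1.add h2 using 2 with p
  ext v <;> simp [_root_.tanField]

theorem tanSet_thicken {S₀ : Set W} {r : ℝ} (h : ∀ x ∈ S₀, ∀ y, ‖y - x‖ ≤ 1 → y ∈ S) :
    ∀ p ∈ tanSet S₀ r, ∀ q, ‖q - p‖ ≤ 1 → q ∈ tanSet S (r + 1) := by
  intro p hp q hq
  rw [Prod.norm_def, max_le_iff] at hq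
  refine ⟨h _ hp.1 _ hq.1, ?_⟩
  have h2 : ‖p.2‖ ≤ r := by simpa using hp.2
  rw [mem_closedBall_zero_iff]
  have := norm_le_norm_sub_add q.2 p.2
  have h3 : ‖q.2 - p.2‖ ≤ 1 := hq.2
  linarith

theorem convex_tanSet (hS : Convex ℝ S) (r : ℝ) : Convex ℝ (tanSet S r) :=
  hS.prod (convex_closedBall _ _)

theorem isClosed_tanSet (hS : IsClosed S) (r : ℝ) : IsClosed (tanSet S r) :=
  hS.prod Metric.isClosed_closedBall

theorem tanMap_comp {U' : Type} [NormedAddCommGroup U'] [NormedSpace ℝ U'] {f : W → U}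
    {g : U → U'} (hf : Differentiable ℝ f) (hg : Differentiable ℝ g) (p : W × W) :
    tanMap (fun x => g (f x)) p = tanMap g (tanMap f p) := by
  simp only [tanMap]
  rw [fderiv_fun_comp p.1 (hg _) (hf _)]
  rfl

theorem hasFDerivAt_fderiv_apply {f : W → U} (hf : Differentiable ℝ (fderiv ℝ f)) (p : W × W) :
    HasFDerivAt (fun p : W × W => fderiv ℝ f p.1 p.2)
      ((fderiv ℝ f p.1).comp (ContinuousLinearMap.snd ℝ W W)
        + ((fderiv ℝ (fderiv ℝ f) p.1).comp (ContinuousLinearMap.fst ℝ W W)).flip p.2) p :=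
  HasFDerivAt.clm_apply ((hf p.1).hasFDerivAt.comp p hasFDerivAt_fst) hasFDerivAt_snd

variable {μ : W → W} {σ : W → EuclideanSpace ℝ (Fin m) →L[ℝ] W}
  {Z : ℝ → EuclideanSpace ℝ (Fin m)} {ZZ : ℝ → ℝ → Matrix (Fin m) (Fin m) ℝ}

/-- Differentiating `x ↦ Dσ(x) v` along the tangent field produces `D²σ` with the direction `σ(x) a`
first, whereas the derivative of `Γσ` has `v` first. Symmetry of `D²σ` identifies the two. -/
theorem gammaOp_tanField (hσ : Differentiable ℝ σ) (hσ' : Differentiable ℝ (fderiv ℝ σ))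
    (p : W × W) (a b : EuclideanSpace ℝ (Fin m)) :
    gammaOp (tanField σ) (tanField σ) p a b
      = (gammaOp σ σ p.1 a b, fderiv ℝ (gammaOp σ σ) p.1 p.2 a b) := by
  have h1 : HasFDerivAt (fun p : W × W => tanField σ p b)
      (((ContinuousLinearMap.apply ℝ W b).comp (fderiv ℝ σ p.1)).comp
        (ContinuousLinearMap.fst ℝ W W) |>.prod
        ((ContinuousLinearMap.apply ℝ W b).comp
        ((fderiv ℝ σ p.1).comp (ContinuousLinearMap.snd ℝ W W)
        + ((fderiv ℝ (fderiv ℝ σ) p.1).comp (ContinuousLinearMap.fst ℝ W W)).flip p.2))) p := by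
    refine HasFDerivAt.prodMk ?_ ?_
    · exact (((ContinuousLinearMap.apply ℝ W b).hasFDerivAt).comp p.1
        (hσ p.1).hasFDerivAt).comp p hasFDerivAt_fst
    · exact ((ContinuousLinearMap.apply ℝ W b).hasFDerivAt).comp p
        (hasFDerivAt_fderiv_apply hσ' p)
  have hdt : DifferentiableAt ℝ (tanField σ) p := by
    have e : tanField σ = fun p : W × W =>
        ContinuousLinearMap.prodₗᵢ ℝ (σ p.1, fderiv ℝ σ p.1 p.2) := by
      ext p v <;> rfl
    rw [e]
    exact (ContinuousLinearMap.prodₗᵢ ℝ).toContinuousLinearEquiv.differentiableAt.comp p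
      (((hσ p.1).comp p differentiableAt_fst).prodMk
        (hasFDerivAt_fderiv_apply hσ' p).differentiableAt)
  have h2 := ((ContinuousLinearMap.apply ℝ (W × W) b).hasFDerivAt.comp p hdt.hasFDerivAt).unique h1
  have h3 := DFunLike.congr_fun h2 (tanField σ p a)
  have h4 := hasFDerivAt_gammaOp hσ hσ' p.1
  have hsym := second_derivative_symmetric (fun y => (hσ y).hasFDerivAt) (hσ' p.1).hasFDerivAt
  rw [h4.fderiv]
  refine (show gammaOp (tanField σ) (tanField σ) p a b = _ from h3).trans ?_
  simp only [ContinuousLinearMap.prod_apply, ContinuousLinearMap.comp_apply, tanField,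
    ContinuousLinearMap.apply_apply, ContinuousLinearMap.coe_fst', ContinuousLinearMap.coe_snd',
    add_apply, ContinuousLinearMap.flip_apply, ContinuousLinearMap.precompR_apply,
    ContinuousLinearMap.precompL_apply, ContinuousLinearMap.compL_apply, gammaOp, gammaL]
  rw [hsym]

theorem hasFDerivAt_eulerStep (hμ : Differentiable ℝ μ) (hσ : Differentiable ℝ σ)
    (hσ' : Differentiable ℝ (fderiv ℝ σ)) (u v : ℝ) (x : W) :
    HasFDerivAt (eulerStep Z ZZ μ σ u v)
      (ContinuousLinearMap.id ℝ W
        + (((ContinuousLinearMap.apply ℝ W (Z v - Z u)).comp (fderiv ℝ σ x))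
          + (contractL W (ZZ u v)).comp (fderiv ℝ (gammaOp σ σ) x))
        + (v - u) • fderiv ℝ μ x) x := by
  have hΓ := (hasFDerivAt_gammaOp hσ hσ' x).differentiableAt
  have h1 := ((ContinuousLinearMap.apply ℝ W (Z v - Z u)).hasFDerivAt).comp x (hσ x).hasFDerivAt
  have h2 := (contractL W (ZZ u v)).hasFDerivAt.comp x hΓ.hasFDerivAt
  have h3 := ((hasFDerivAt_id x).add (h1.add h2)).add ((hμ x).hasFDerivAt.const_smul (v - u))
  refine h3.congr_of_eventuallyEq (Eventually.of_forall fun y => ?_)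
  simp [eulerStep, germ, contractL_apply]

/-- Every ingredient of the Euler step is linear in `σ`, `Γσ`, `μ`, and each of these is carried to
its tangent; for `Γσ` this is `gammaOp_tanField`. -/
theorem eulerStep_tan (hμ : Differentiable ℝ μ) (hσ : Differentiable ℝ σ)
    (hσ' : Differentiable ℝ (fderiv ℝ σ)) (u v : ℝ) (p : W × W) :
    eulerStep Z ZZ (tanMap μ) (tanField σ) u v p = tanMap (eulerStep Z ZZ μ σ u v) p := by
  have hg := gammaOp_tanField hσ hσ' p
  have e1 : contract (gammaOp σ σ p.1) (ZZ u v)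
      = (contract (gammaOp (tanField σ) (tanField σ) p) (ZZ u v)).1 :=
    contract_map (ContinuousLinearMap.fst ℝ W W) (fun a b => by rw [hg]; rfl) _
  have e2 : contract (fderiv ℝ (gammaOp σ σ) p.1 p.2) (ZZ u v)
      = (contract (gammaOp (tanField σ) (tanField σ) p) (ZZ u v)).2 :=
    contract_map (ContinuousLinearMap.snd ℝ W W) (fun a b => by rw [hg]; rfl) _
  simp only [tanMap]
  rw [(hasFDerivAt_eulerStep hμ hσ hσ' u v p.1).fderiv]
  refine Prod.ext ?_ ?_
  · simp [eulerStep, germ, tanField, tanMap, e1]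
  · simp [eulerStep, germ, tanField, tanMap, ← e2, contractL_apply]

theorem differentiable_eulerIter (hμ : Differentiable ℝ μ) (hσ : Differentiable ℝ σ)
    (hσ' : Differentiable ℝ (fderiv ℝ σ)) (s d : ℝ) (k : ℕ) :
    Differentiable ℝ (eulerIter Z ZZ μ σ s d k) := by
  induction k with
  | zero => exact differentiable_id
  | succ k ih =>
    exact Differentiable.comp
      (fun x => (hasFDerivAt_eulerStep hμ hσ hσ' _ _ x).differentiableAt) ih

/-- The chain rule says that tangent maps respect composition, so the one-step identity iterates.
Derivatives of the scheme are thereby a scheme of the same kind. -/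
theorem eulerIter_tan (hμ : Differentiable ℝ μ) (hσ : Differentiable ℝ σ)
    (hσ' : Differentiable ℝ (fderiv ℝ σ)) (s d : ℝ) (k : ℕ) (p : W × W) :
    eulerIter Z ZZ (tanMap μ) (tanField σ) s d k p = tanMap (eulerIter Z ZZ μ σ s d k) p := by
  induction k with
  | zero =>
    have : eulerIter Z ZZ μ σ s d 0 = id := rfl
    rw [this]
    simp [eulerIter, tanMap]
  | succ k ih =>
    rw [eulerIter, ih, eulerStep_tan hμ hσ hσ']
    exact (tanMap_comp (differentiable_eulerIter hμ hσ hσ' s d k)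
      (fun x => (hasFDerivAt_eulerStep hμ hσ hσ' _ _ x).differentiableAt) p).symm

end Tangent

/-! ### The flow over short intervals and its first two derivatives. -/

section LocalFlow

theorem hasFDerivAt_of_uniform_cauchy {W U : Type} [NormedAddCommGroup W] [NormedSpace ℝ W]
    [NormedAddCommGroup U] [NormedSpace ℝ U] [CompleteSpace U] {f : ℕ → W → U} {g : W → U}
    (hd : ∀ n, Differentiable ℝ (f n)) {ε : ℕ → ℝ} (hε : Tendsto ε atTop (𝓝 0)) {n₀ : ℕ}
    (hc : ∀ n ≥ n₀, ∀ k ≥ n₀, ∀ x, ‖fderiv ℝ (f n) x - fderiv ℝ (f k) x‖ ≤ ε n + ε k)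
    (hf : ∀ x, Tendsto (fun n => f n x) atTop (𝓝 (g x))) :
    Differentiable ℝ g ∧ ∀ x, Tendsto (fun n => fderiv ℝ (f n) x) atTop (𝓝 (fderiv ℝ g x)) := by
  have hcau : ∀ x, CauchySeq fun n => fderiv ℝ (f n) x := by
    intro x
    rw [Metric.cauchySeq_iff]
    intro η hη
    obtain ⟨n₁, hn₁⟩ := eventually_atTop.1 (hε.eventually (gt_mem_nhds (half_pos hη)))
    refine ⟨max n₀ n₁, fun n hn k hk => ?_⟩
    rw [dist_eq_norm]
    have h1 := hn₁ n ((le_max_right _ _).trans hn)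
    have h2 := hn₁ k ((le_max_right _ _).trans hk)
    linarith [hc n ((le_max_left _ _).trans hn) k ((le_max_left _ _).trans hk) x]
  choose G hG using fun x => cauchySeq_tendsto_of_complete (hcau x)
  have hu : TendstoUniformly (fun n x => fderiv ℝ (f n) x) G atTop := by
    rw [Metric.tendstoUniformly_iff]
    intro η hη
    filter_upwards [hε.eventually (gt_mem_nhds hη), eventually_ge_atTop n₀] with n hn hn0 x
    rw [dist_comm, dist_eq_norm]
    refine lt_of_le_of_lt ?_ hn
    have h1 : Tendsto (fun k => ‖fderiv ℝ (f n) x - fderiv ℝ (f k) x‖) atTop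
        (𝓝 ‖fderiv ℝ (f n) x - G x‖) := ((hG x).const_sub _).norm
    have h2 : Tendsto (fun k => ε n + ε k) atTop (𝓝 (ε n)) := by simpa using hε.const_add (ε n)
    refine le_of_tendsto_of_tendsto h1 h2 ?_
    filter_upwards [eventually_ge_atTop n₀] with k hk
    exact hc n hn0 k hk x
  have hg : ∀ x, HasFDerivAt g (G x) x := hasFDerivAt_of_tendstoUniformly hu
    (fun n x => (hd n x).hasFDerivAt) hf
  refine ⟨fun x => (hg x).differentiableAt, fun x => ?_⟩
  rw [(hg x).fderiv]
  exact hG x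

variable {W : Type} [NormedAddCommGroup W] [NormedSpace ℝ W] {m : ℕ}

/-- The zero in the last slot removes the term `Df` of that slot, so the last component is the pure
second derivative. -/
theorem tanMap_tanMap {f : W → W} (hf : Differentiable ℝ f) (hf' : Differentiable ℝ (fderiv ℝ f))
    (x v w : W) : tanMap (tanMap f) ((x, v), (w, 0))
      = ((f x, fderiv ℝ f x v), (fderiv ℝ f x w, fderiv ℝ (fderiv ℝ f) x w v)) := by
  have h : HasFDerivAt (tanMap f) _ (x, v) :=
    ((hf x).hasFDerivAt.comp (x, v) hasFDerivAt_fst).prodMk (hasFDerivAt_fderiv_apply hf' (x, v))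
  simp only [tanMap] at h ⊢
  rw [h.fderiv]
  simp

theorem norm_le_of_unit {U : Type} [NormedAddCommGroup U] [NormedSpace ℝ U]
    {A : W →L[ℝ] W →L[ℝ] U} {C : ℝ} (hC : 0 ≤ C)
    (h : ∀ v w, ‖v‖ ≤ 1 → ‖w‖ ≤ 1 → ‖A w v‖ ≤ C) : ‖A‖ ≤ C :=
  ContinuousLinearMap.opNorm_le_of_unit_norm hC fun w hw =>
    ContinuousLinearMap.opNorm_le_of_unit_norm hC fun v hv => h v w hv.le hw.le

theorem norm_le_of_unit' {U : Type} [NormedAddCommGroup U] [NormedSpace ℝ U]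
    {A : W →L[ℝ] U} {C : ℝ} (hC : 0 ≤ C)
    (h : ∀ v, ‖v‖ ≤ 1 → ‖A v‖ ≤ C) : ‖A‖ ≤ C :=
  ContinuousLinearMap.opNorm_le_of_unit_norm hC fun v hv => h v hv.le

variable {M α T : ℝ} {μ : W → W} {σ : W → EuclideanSpace ℝ (Fin m) →L[ℝ] W}
  {Z : ℝ → EuclideanSpace ℝ (Fin m)} {ZZ : ℝ → ℝ → Matrix (Fin m) (Fin m) ℝ}

/-- The properties of the flow map `Φ` of a rough differential equation over `[s, t]`. -/
structure IsFlowMap (α : ℝ) (Z : ℝ → EuclideanSpace ℝ (Fin m))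
    (ZZ : ℝ → ℝ → Matrix (Fin m) (Fin m) ℝ) (μ : W → W)
    (σ : W → EuclideanSpace ℝ (Fin m) →L[ℝ] W) (C s t : ℝ) (Φ : W → W) : Prop where
  davie : ∀ x, ∃ X : ℝ → W, X s = x ∧ X t = Φ x ∧ IsDavie α Z ZZ μ σ C s t X
  diff : Differentiable ℝ Φ
  diff_fderiv : Differentiable ℝ (fderiv ℝ Φ)
  fderiv_sub_le : ∀ x, ‖fderiv ℝ Φ x - ContinuousLinearMap.id ℝ W
    - (ContinuousLinearMap.apply ℝ W (Z t - Z s)).comp (fderiv ℝ σ x)‖ ≤ C * ((t - s) ^ α) ^ 2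
  fderiv_fderiv_le : ∀ x, ‖fderiv ℝ (fderiv ℝ Φ) x‖ ≤ C * (t - s) ^ α
  fderiv_fderiv_lip : ∀ x y,
    ‖fderiv ℝ (fderiv ℝ Φ) x - fderiv ℝ (fderiv ℝ Φ) y‖ ≤ C * ‖x - y‖

theorem differentiable_fderiv_eulerIter (hμ : IsBL (univ : Set W) 2 μ)
    (hσ : IsBL (univ : Set W) 4 σ) (s d : ℝ) (k : ℕ) :
    Differentiable ℝ (fderiv ℝ (eulerIter Z ZZ μ σ s d k)) := by
  have hstep : ∀ u v, Differentiable ℝ (fderiv ℝ (eulerStep Z ZZ μ σ u v)) := by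
    intro u v
    have : fderiv ℝ (eulerStep Z ZZ μ σ u v) = fun x => ContinuousLinearMap.id ℝ W
        + ((ContinuousLinearMap.compL ℝ W _ W (ContinuousLinearMap.apply ℝ W (Z v - Z u))
            (fderiv ℝ σ x))
          + ContinuousLinearMap.compL ℝ W _ W (contractL W (ZZ u v)) (fderiv ℝ (gammaOp σ σ) x))
        + (v - u) • fderiv ℝ μ x := by
      ext1 x
      exact (hasFDerivAt_eulerStep hμ.1 hσ.1 hσ.2.2.1 u v x).fderiv
    rw [this]
    have h1 := hσ.2.2.1
    have h2 := hσ.gamma.2.2.1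
    have h3 := hμ.2.2.1
    exact (((differentiable_const _).add
      (((ContinuousLinearMap.differentiable _).comp h1).add
        ((ContinuousLinearMap.differentiable _).comp h2))).add (h3.fun_const_smul _))
  induction k with
  | zero =>
    have : fderiv ℝ (eulerIter Z ZZ μ σ s d 0) = fun _ => ContinuousLinearMap.id ℝ W := by
      ext1 x; exact fderiv_id
    rw [this]
    exact differentiable_const _
  | succ k ih =>
    have hd := differentiable_eulerIter (Z := Z) (ZZ := ZZ) hμ.1 hσ.1 hσ.2.2.1 s d k
    have : fderiv ℝ (eulerIter Z ZZ μ σ s d (k + 1)) = fun x =>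
        (fderiv ℝ (eulerStep Z ZZ μ σ (s + k * d) (s + (k + 1 : ℕ) * d))
          (eulerIter Z ZZ μ σ s d k x)).comp (fderiv ℝ (eulerIter Z ZZ μ σ s d k) x) := by
      ext1 x
      exact ((hasFDerivAt_eulerStep hμ.1 hσ.1 hσ.2.2.1 _ _ _).differentiableAt.hasFDerivAt.comp x
        (hd x).hasFDerivAt).fderiv
    rw [this]
    exact ((hstep _ _).comp hd).clm_comp ih

/-- The Davie solution of the doubly tangent system started at `((x, v), (w, 0))` is the limit of
`(f n, D(f n) v, D(f n) w, D²(f n) w v)`, at a rate independent of `x` and of `v`, `w` in the unit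
ball. Hence the limit of the schemes is twice differentiable. Increment bounds and stability of that
solution then give the estimates on the derivatives. -/
theorem local_flow [CompleteSpace W] (hα : 1 / 3 < α) (hα' : α ≤ 1 / 2)
    (hZ : RoughBound α T M Z ZZ) (hμ : IsBL (univ : Set W) 2 μ) (hσ : IsBL (univ : Set W) 4 σ) :
    ∃ C h₀ : ℝ, 0 ≤ C ∧ 0 < h₀ ∧ h₀ ≤ 1 ∧ ∀ s t : ℝ, 0 ≤ s → s < t → t ≤ T → t - s ≤ h₀ →
      ∃ Φ : W → W, IsFlowMap α Z ZZ μ σ C s t Φ := by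
  have hα0 : 0 < α := by linarith
  -- Tangent vectors start in unit balls (`S₀`) and are given radius `2`, so that the unit
  -- neighbourhood of `S₀` lies in `S`.
  set S : Set ((W × W) × (W × W)) := tanSet (tanSet univ (1 + 1)) (1 + 1) with hS
  set S₀ : Set ((W × W) × (W × W)) := tanSet (tanSet univ 1) 1 with hS₀
  set μ₂ := tanMap (tanMap μ) with hμ₂
  set σ₂ := tanField (tanField σ) with hσ₂
  have hScl : IsClosed S := isClosed_tanSet (isClosed_tanSet isClosed_univ _) _
  have hthick : ∀ p ∈ S₀, ∀ q, ‖q - p‖ ≤ 1 → q ∈ S :=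
    tanSet_thicken (tanSet_thicken fun _ _ _ _ => mem_univ _)
  obtain ⟨L, hc⟩ : ∃ L, CoefBound S L μ₂ σ₂ :=
    IsBL.coefBound (convex_tanSet (convex_tanSet convex_univ _) _)
      ((hμ.tanMap _).tanMap _) ((hσ.tanField _).tanField _)
  have hL := hc.nonneg
  have hM := hZ.nonneg
  obtain ⟨C, h₁, hC, h₁0, h₁1, hex⟩ := davie_exists hα hα' hZ hc hScl hthick
  obtain ⟨h₂, h₂0, hconv⟩ := eulerIter_sub_davie_le hα hα' hZ hc hthick
  obtain ⟨h₃, h₃0, hstab⟩ := davie_stability hα hα' hZ hc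
  set A := L * M + (L * M + (L + C)) with hA
  have hA0 : 0 ≤ A := by positivity
  refine ⟨C + A + 2, min h₁ (min h₂ h₃), by positivity, by positivity,
    (min_le_left _ _).trans h₁1, ?_⟩
  intro s t hs hst hT hh
  have hh1 := hh.trans (min_le_left _ _)
  have hh2 := (hh.trans (min_le_right _ _)).trans (min_le_left _ _)
  have hh3 := (hh.trans (min_le_right _ _)).trans (min_le_right _ _)
  have hts : 0 < t - s := by linarith
  have hp : ∀ x v w : W, ‖v‖ ≤ 1 → ‖w‖ ≤ 1 → (((x, v), (w, 0)) : (W × W) × (W × W)) ∈ S₀ := by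
    intro x v w hv hw
    refine ⟨⟨mem_univ _, by simpa using hv⟩, ?_⟩
    rw [mem_closedBall_zero_iff, Prod.norm_def]
    simpa using hw
  have hex' : ∀ x v w : W, ‖v‖ ≤ 1 → ‖w‖ ≤ 1 → ∃ X : ℝ → (W × W) × (W × W),
      X s = ((x, v), (w, 0)) ∧ (∀ r ∈ Icc s t, X r ∈ S) ∧ IsDavie α Z ZZ μ₂ σ₂ C s t X :=
    fun x v w hv hw => hex s t hs hst.le hT hh1 _ (hp x v w hv hw)
  choose! X hX0 hXS hXD using hex'
  set f : ℕ → W → W := fun n => eulerIter Z ZZ μ σ s ((t - s) / 2 ^ n) (2 ^ n) with hf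
  set ε : ℕ → ℝ := fun n => 2 * (C * ((t - s) / 2 ^ n) ^ (3 * α - 1)) with hε
  have hmesh := tendsto_mesh_rpow hα C (t - s)
  have hε0 : Tendsto ε atTop (𝓝 0) := by simpa using hmesh.const_mul 2
  obtain ⟨n₀, hn₀⟩ := eventually_atTop.1
    (hmesh.eventually (ge_mem_nhds (show (0 : ℝ) < 1 by norm_num)))
  have hfd : ∀ n, Differentiable ℝ (f n) := fun n =>
    differentiable_eulerIter hμ.1 hσ.1 hσ.2.2.1 _ _ _
  have hfd' : ∀ n, Differentiable ℝ (fderiv ℝ (f n)) := fun n =>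
    differentiable_fderiv_eulerIter hμ hσ _ _ _
  have hμ1 := hμ.tanMap (1 + 1)
  have hσ1 := hσ.tanField (1 + 1)
  have hfX : ∀ n ≥ n₀, ∀ x v w : W, ‖v‖ ≤ 1 → ‖w‖ ≤ 1 →
      ‖((f n x, fderiv ℝ (f n) x v), (fderiv ℝ (f n) x w, fderiv ℝ (fderiv ℝ (f n)) x w v))
        - X x v w t‖ ≤ ε n := by
    intro n hn x v w hv hw
    have h := hconv s t C (X x v w) n hs hst hT hh2 hC (by rw [hX0 x v w hv hw]
                                                           exact hp x v w hv hw)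
      (hXS x v w hv hw) (hXD x v w hv hw) (hn₀ n hn)
    rw [hX0 x v w hv hw, hμ₂, hσ₂, eulerIter_tan hμ1.1 hσ1.1 hσ1.2.2.1] at h
    have e : eulerIter Z ZZ (tanMap μ) (tanField σ) s ((t - s) / 2 ^ n) (2 ^ n)
        = tanMap (f n) := by
      ext1 p
      exact eulerIter_tan hμ.1 hσ.1 hσ.2.2.1 _ _ _ _
    rw [e, tanMap_tanMap (hfd n) (hfd' n)] at h
    exact h
  have h00 : ‖(0 : W)‖ ≤ 1 := by simp
  have hlim : ∀ x v w : W, ‖v‖ ≤ 1 → ‖w‖ ≤ 1 → Tendsto (fun n =>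
      (((f n x, fderiv ℝ (f n) x v), (fderiv ℝ (f n) x w, fderiv ℝ (fderiv ℝ (f n)) x w v)) :
        (W × W) × (W × W))) atTop (𝓝 (X x v w t)) := by
    intro x v w hv hw
    rw [tendsto_iff_norm_sub_tendsto_zero]
    refine squeeze_zero' (Eventually.of_forall fun _ => norm_nonneg _) ?_ hε0
    filter_upwards [eventually_ge_atTop n₀] with n hn
    exact hfX n hn x v w hv hw
  have hεnn : ∀ n, 0 ≤ ε n := fun n => by
    have : 0 < (t - s) / 2 ^ n := by positivity
    positivity
  have htri : ∀ n ≥ n₀, ∀ k ≥ n₀, ∀ x v w : W, ‖v‖ ≤ 1 → ‖w‖ ≤ 1 →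
      ‖((f n x, fderiv ℝ (f n) x v), (fderiv ℝ (f n) x w, fderiv ℝ (fderiv ℝ (f n)) x w v))
        - ((f k x, fderiv ℝ (f k) x v),
          (fderiv ℝ (f k) x w, fderiv ℝ (fderiv ℝ (f k)) x w v))‖ ≤ ε n + ε k := by
    intro n hn k hk x v w hv hw
    refine (norm_sub_le_norm_sub_add_norm_sub _ (X x v w t) _).trans
      (add_le_add (hfX n hn x v w hv hw) ?_)
    rw [norm_sub_rev]
    exact hfX k hk x v w hv hw
  -- The position component does not depend on the tangent vectors, being the limit of `f n x`; zero
  -- vectors serve as default.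
  set Φ : W → W := fun x => (X x 0 0 t).1.1 with hΦ
  have hfΦ : ∀ x, Tendsto (fun n => f n x) atTop (𝓝 (Φ x)) := fun x =>
    ((continuous_fst.comp continuous_fst).tendsto _).comp (hlim x 0 0 h00 h00)
  obtain ⟨hΦd, hΦ1⟩ := hasFDerivAt_of_uniform_cauchy hfd hε0 (n₀ := n₀)
    (fun n hn k hk x => norm_le_of_unit' (add_nonneg (hεnn n) (hεnn k)) fun v hv => by
      refine le_trans ?_ (htri n hn k hk x v 0 hv h00)
      exact (norm_snd_le _).trans (norm_fst_le
        (((f n x, fderiv ℝ (f n) x v), (fderiv ℝ (f n) x 0, fderiv ℝ (fderiv ℝ (f n)) x 0 v))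
        - ((f k x, fderiv ℝ (f k) x v),
          (fderiv ℝ (f k) x 0, fderiv ℝ (fderiv ℝ (f k)) x 0 v)) : (W × W) × (W × W)))) hfΦ
  obtain ⟨hΦd', hΦ2⟩ := hasFDerivAt_of_uniform_cauchy hfd' hε0 (n₀ := n₀)
    (fun n hn k hk x => norm_le_of_unit (add_nonneg (hεnn n) (hεnn k)) fun v w hv hw => by
      refine le_trans ?_ (htri n hn k hk x v w hv hw)
      exact (norm_snd_le _).trans (norm_snd_le
        (((f n x, fderiv ℝ (f n) x v), (fderiv ℝ (f n) x w, fderiv ℝ (fderiv ℝ (f n)) x w v))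
        - ((f k x, fderiv ℝ (f k) x v),
          (fderiv ℝ (f k) x w, fderiv ℝ (fderiv ℝ (f k)) x w v)) : (W × W) × (W × W)))) hΦ1
  have hXt : ∀ x v w : W, ‖v‖ ≤ 1 → ‖w‖ ≤ 1 → X x v w t =
      ((Φ x, fderiv ℝ Φ x v), (fderiv ℝ Φ x w, fderiv ℝ (fderiv ℝ Φ) x w v)) := by
    intro x v w hv hw
    refine tendsto_nhds_unique (hlim x v w hv hw) ?_
    exact ((hfΦ x).prodMk_nhds (tendsto_clm_apply (hΦ1 x) tendsto_const_nhds)).prodMk_nhds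
      ((tendsto_clm_apply (hΦ1 x) tendsto_const_nhds).prodMk_nhds
        (tendsto_clm_apply (tendsto_clm_apply (hΦ2 x) tendsto_const_nhds) tendsto_const_nhds))
  have hinc : ∀ x v w : W, ‖v‖ ≤ 1 → ‖w‖ ≤ 1 →
      ‖X x v w t - ((x, v), (w, 0))‖ ≤ A * (t - s) ^ α ∧
      ‖X x v w t - ((x, v), (w, 0)) - σ₂ ((x, v), (w, 0)) (Z t - Z s)‖
        ≤ A * ((t - s) ^ α) ^ 2 := by
    intro x v w hv hw
    have := (hXD x v w hv hw).increment_le hα hα' hZ hc hC hs hT le_rfl hst.le le_rfl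
      (hh1.trans h₁1) (hXS x v w hv hw s ⟨le_rfl, hst.le⟩)
    rwa [hX0 x v w hv hw] at this
  have hq0 : 0 ≤ (t - s) ^ α := by positivity
  refine ⟨Φ, ?_, hΦd, hΦd', ?_, ?_, ?_⟩
  · intro x
    refine ⟨fun r => (X x 0 0 r).1.1, by simp only [hX0 x 0 0 h00 h00], rfl, ?_⟩
    intro u v h1 h2 h3
    have h := hXD x 0 0 h00 h00 u v h1 h2 h3
    rw [hμ₂, hσ₂, eulerStep_tan hμ1.1 hσ1.1 hσ1.2.2.1] at h
    have e : eulerStep Z ZZ μ σ u v (X x 0 0 u).1.1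
        = (tanMap (eulerStep Z ZZ (tanMap μ) (tanField σ) u v) (X x 0 0 u)).1.1 := by
      simp only [tanMap]
      rw [eulerStep_tan hμ.1 hσ.1 hσ.2.2.1]
      rfl
    rw [e]
    refine ((norm_fst_le _).trans (norm_fst_le (X x 0 0 v -
      tanMap (eulerStep Z ZZ (tanMap μ) (tanField σ) u v) (X x 0 0 u)))).trans (h.trans ?_)
    have : 0 ≤ ((v - u) ^ α) ^ 3 := pow_nonneg (Real.rpow_nonneg (by linarith) _) _
    gcongr
    linarith
  · intro x
    refine norm_le_of_unit' (by positivity) fun v hv => ?_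
    have h := (hinc x v 0 hv h00).2
    rw [hXt x v 0 hv h00] at h
    refine ((norm_snd_le _).trans ((norm_fst_le _).trans h)).trans ?_
    gcongr
    linarith
  · intro x
    refine norm_le_of_unit (by positivity) fun v w hv hw => ?_
    have h := (hinc x v w hv hw).1
    rw [hXt x v w hv hw] at h
    have h' := (norm_snd_le _).trans ((norm_snd_le _).trans h)
    simp only [Prod.snd_sub, sub_zero] at h'
    refine h'.trans ?_
    gcongr
    linarith
  · intro x y
    refine norm_le_of_unit (by positivity) fun v w hv hw => ?_
    -- The Lipschitz bound on the second derivative is stability of the doubly tangent system from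
    -- two base points with the same vectors.
    have h := hstab s t C (X x v w) (X y v w) hs hst.le hT hh3 (hXS x v w hv hw)
      (hXS y v w hv hw) (hXD x v w hv hw) (hXD y v w hv hw)
    rw [hXt x v w hv hw, hXt y v w hv hw, hX0 x v w hv hw, hX0 y v w hv hw] at h
    have e : ‖(((x, v), (w, 0)) : (W × W) × (W × W)) - ((y, v), (w, 0))‖ = ‖x - y‖ := by
      simp [Prod.norm_def]
    rw [e] at h
    refine ((norm_snd_le _).trans ((norm_snd_le _).trans h)).trans ?_
    gcongr
    linarith

end LocalFlow

/-! ### Comparison of powers on the whole time horizon. -/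

section Horizon

/-- Replaces `le_rpow_sq` and `h ^ α ≤ 1` when steps are not shorter than `1`. -/
theorem exists_horizon_const {α : ℝ} (hα : 0 < α) (hα' : α ≤ 1 / 2) (T : ℝ) :
    ∃ Θ : ℝ, 1 ≤ Θ ∧ ∀ h, 0 ≤ h → h ≤ T → h ≤ Θ * (h ^ α) ^ 2 ∧ h ^ α ≤ Θ := by
  refine ⟨1 + |T| ^ (1 - 2 * α) + |T| ^ α, by
    have := Real.rpow_nonneg (abs_nonneg T) (1 - 2 * α)
    have := Real.rpow_nonneg (abs_nonneg T) α
    linarith, fun h h0 hT => ?_⟩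
  have h1 : h ^ (1 - 2 * α) ≤ |T| ^ (1 - 2 * α) :=
    Real.rpow_le_rpow h0 (hT.trans (le_abs_self T)) (by linarith)
  have h2 : h ^ α ≤ |T| ^ α := Real.rpow_le_rpow h0 (hT.trans (le_abs_self T)) hα.le
  have h3 := Real.rpow_nonneg (abs_nonneg T) (1 - 2 * α)
  have h4 := Real.rpow_nonneg (abs_nonneg T) α
  refine ⟨?_, by linarith⟩
  rcases h0.eq_or_lt with rfl | hpos
  · positivity
  · have e : h = h ^ (1 - 2 * α) * (h ^ α) ^ 2 := by
      rw [← rpow_sq α h0, ← Real.rpow_add hpos]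
      simp
    conv_lhs => rw [e]
    gcongr
    linarith

end Horizon

/-! ### Rough paths and rough integrals. -/

section RoughPath

variable {m : ℕ} {W U : Type*} [NormedAddCommGroup W] [NormedSpace ℝ W]
  [NormedAddCommGroup U] [NormedSpace ℝ U] {M α T : ℝ}
  {Z : ℝ → EuclideanSpace ℝ (Fin m)} {ZZ : ℝ → ℝ → Matrix (Fin m) (Fin m) ℝ}

theorem IsWeaklyGeometricRoughPath.area_self (hZ : IsWeaklyGeometricRoughPath α T Z ZZ) {u : ℝ}
    (h0 : 0 ≤ u) (hT : u ≤ T) (i j : Fin m) : ZZ u u i j = 0 := by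
  have := hZ.chen u u u h0 le_rfl le_rfl hT i j
  simp at this
  exact this

theorem IsWeaklyGeometricRoughPath.roughBound (hZ : IsWeaklyGeometricRoughPath α T Z ZZ) :
    ∃ M, RoughBound α T M Z ZZ := by
  obtain ⟨C, hC⟩ := hZ.holder_path
  obtain ⟨D, hD⟩ := hZ.holder_area
  refine ⟨|C| + ∑ _i : Fin m, ∑ _j : Fin m, |D|, ⟨by positivity, ?_, ?_, hZ.chen⟩⟩
  · intro u v h0 huv hT
    have hq : 0 ≤ (v - u) ^ α := Real.rpow_nonneg (by linarith) _
    have hs : 0 ≤ ∑ _i : Fin m, ∑ _j : Fin m, |D| := by positivity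
    rcases huv.eq_or_lt with rfl | h
    · rw [sub_self, norm_zero]
      exact mul_nonneg (by positivity) hq
    · refine (hC u v h0 h hT).trans ?_
      gcongr
      linarith [le_abs_self C]
  · intro u v h0 huv hT
    have hq : 0 ≤ ((v - u) ^ α) ^ 2 := by positivity
    rw [add_mul, Finset.sum_mul]
    refine le_trans ?_ (le_add_of_nonneg_left (by positivity))
    refine Finset.sum_le_sum fun i _ => ?_
    rw [Finset.sum_mul]
    refine Finset.sum_le_sum fun j _ => ?_
    rcases huv.eq_or_lt with rfl | h
    · rw [hZ.area_self h0 hT, abs_zero]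
      positivity
    · refine (hD u v h0 h hT i j).trans ?_
      rw [rpow_sq α (by linarith)]
      gcongr
      exact le_abs_self D

/-- Exchanging the arguments of `A` transposes the second level, whose symmetrisation is fixed by
weak geometricity. -/
theorem IsWeaklyGeometricRoughPath.contract_add_flip (hZ : IsWeaklyGeometricRoughPath α T Z ZZ)
    (A : EuclideanSpace ℝ (Fin m) →L[ℝ] EuclideanSpace ℝ (Fin m) →L[ℝ] U)
    {u v : ℝ} (h0 : 0 ≤ u) (h1 : u ≤ v) (h2 : v ≤ T) :
    contract A (ZZ u v) + contract A.flip (ZZ u v) = A (Z v - Z u) (Z v - Z u) := by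
  rw [contract_flip, ← contract_add_matrix, ← contract_vecMulVec A]
  congr 1
  ext i j
  have := hZ.bracket_eq_zero u v h0 h1 h2 i j
  simp only [Matrix.add_apply, Matrix.transpose_apply, Matrix.of_apply, PiLp.sub_apply]
  linarith

/-- A function whose increments are those of the compensated sums up to a small error is, up to a
constant, the rough integral. -/
theorem hasRoughIntegral_of_local (hα : 1 / 3 < α)
    {H : ℝ → EuclideanSpace ℝ (Fin m) →L[ℝ] U}
    {H' : ℝ → EuclideanSpace ℝ (Fin m) →L[ℝ] EuclideanSpace ℝ (Fin m) →L[ℝ] U} {J : ℝ → U}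
    {C h₀ s t : ℝ} (hC : 0 ≤ C) (hh : 0 < h₀) (hst : s ≤ t)
    (h : ∀ u v, s ≤ u → u ≤ v → v ≤ t → v - u ≤ h₀ →
      ‖J v - J u - (H u (Z v - Z u) + contract (H' u) (ZZ u v))‖ ≤ C * ((v - u) ^ α) ^ 3) :
    HasRoughIntegral Z ZZ H H' s t (J t - J s) := by
  intro ε hε
  -- Each error is at most `C * δ ^ (3 * α - 1)` times the length of its interval; the lengths add
  -- up to `t - s`, and this choice makes the total at most `ε / 2`.
  obtain ⟨δ, hδ0, hδ1, hδ⟩ := exists_step_rpow hα (A := C * (t - s) / ε * 2) (by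
    have : 0 ≤ t - s := by linarith
    positivity)
  refine ⟨min δ h₀, by positivity, fun n p hp0 hpn hp => ?_⟩
  have hmono : ∀ k : ℕ, k ≤ n → s ≤ p k := by
    intro k
    induction k with
    | zero => intro _; exact hp0.ge
    | succ k ih => intro hk; exact (ih (by omega)).trans (hp k (by omega)).1
  have hmono' : ∀ k : ℕ, k ≤ n → p (n - k) ≤ t := by
    intro k
    induction k with
    | zero => intro _; exact hpn.le
    | succ k ih =>
      intro hk
      have h1 := (hp (n - (k + 1)) (by omega)).1
      rw [show n - (k + 1) + 1 = n - k by omega] at h1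
      exact h1.trans (ih (by omega))
  have e : J t - J s = ∑ k ∈ Finset.range n, (J (p (k + 1)) - J (p k)) := by
    rw [Finset.sum_range_sub (fun k => J (p k)), hp0, hpn]
  rw [e, ← Finset.sum_sub_distrib]
  have hb : ∀ k ∈ Finset.range n, ‖H (p k) (Z (p (k + 1)) - Z (p k))
      + contract (H' (p k)) (ZZ (p k) (p (k + 1))) - (J (p (k + 1)) - J (p k))‖
      ≤ C * δ ^ (3 * α - 1) * (p (k + 1) - p k) := by
    intro k hk
    rw [Finset.mem_range] at hk
    obtain ⟨h1, h2⟩ := hp k hk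
    have h3 := hmono' (n - (k + 1)) (by omega)
    rw [show n - (n - (k + 1)) = k + 1 by omega] at h3
    rw [norm_sub_rev]
    refine (h _ _ (hmono k hk.le) h1 h3 (h2.le.trans (min_le_right _ _))).trans ?_
    rw [mul_assoc]
    gcongr
    rcases h1.eq_or_lt with h4 | h4
    · rw [h4, sub_self, mul_zero, Real.zero_rpow (by linarith)]
      norm_num
    · rw [rpow_cube_eq (by linarith)]
      exact mul_le_mul_of_nonneg_right (Real.rpow_le_rpow (by linarith)
        (h2.le.trans (min_le_left _ _)) (by linarith)) (by linarith)
  refine lt_of_le_of_lt (norm_sum_le_of_le _ hb) ?_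
  rw [← Finset.mul_sum, Finset.sum_range_sub (fun k => p k), hp0, hpn]
  have h5 := hδ δ hδ0 le_rfl
  have h6 : C * (t - s) / ε * 2 * δ ^ (3 * α - 1) = 2 * (C * δ ^ (3 * α - 1) * (t - s)) / ε := by
    ring
  rw [h6, div_le_one hε] at h5
  have h7 : 0 ≤ C * δ ^ (3 * α - 1) * (t - s) := by
    have : 0 ≤ t - s := by linarith
    positivity
  linarith

theorem uniform_partition {a b : ℝ} {N : ℕ} (hN : 0 < N) :
    a + (N : ℝ) * ((b - a) / N) = b := by
  have : (N : ℝ) ≠ 0 := by positivity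
  field_simp
  ring

theorem exists_uniform_mesh {δ : ℝ} (hδ : 0 < δ) (l : ℝ) :
    ∃ N₀ : ℕ, ∀ N : ℕ, N₀ ≤ N → 0 < N → l / N < δ := by
  have h := (tendsto_const_nhds (x := l)).div_atTop (tendsto_natCast_atTop_atTop (R := ℝ))
  obtain ⟨N₀, h⟩ := eventually_atTop.1 (h.eventually (gt_mem_nhds hδ))
  exact ⟨N₀, fun N hN _ => h N hN⟩

/-- Two integrals from the common lower endpoint `t` are compared on partitions that agree on `[t,
u]`. The sums there cancel, so a bound on uniform partitions of `[u, v]` is inherited by the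
difference of the integrals. -/
theorem HasRoughIntegral.norm_increment_sub_le
    {H : ℝ → EuclideanSpace ℝ (Fin m) →L[ℝ] U}
    {H' : ℝ → EuclideanSpace ℝ (Fin m) →L[ℝ] EuclideanSpace ℝ (Fin m) →L[ℝ] U} {I J G : U}
    {t u v B : ℝ} (htu : t ≤ u) (huv : u ≤ v) (hI : HasRoughIntegral Z ZZ H H' t u I)
    (hJ : HasRoughIntegral Z ZZ H H' t v J)
    (hG : ∀ N : ℕ, 0 < N → ‖(∑ k ∈ Finset.range N,
      (H (u + k * ((v - u) / N)) (Z (u + (k + 1 : ℕ) * ((v - u) / N)) - Z (u + k * ((v - u) / N)))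
        + contract (H' (u + k * ((v - u) / N)))
          (ZZ (u + k * ((v - u) / N)) (u + (k + 1 : ℕ) * ((v - u) / N))))) - G‖ ≤ B) :
    ‖J - I - G‖ ≤ B := by
  refine le_of_forall_pos_le_add fun ε hε => ?_
  obtain ⟨δ₁, hδ₁, h1⟩ := hI (ε / 2) (by positivity)
  obtain ⟨δ₂, hδ₂, h2⟩ := hJ (ε / 2) (by positivity)
  obtain ⟨N₁, hN₁⟩ := exists_uniform_mesh (δ := min δ₁ δ₂) (by positivity) (u - t)
  obtain ⟨N₂, hN₂⟩ := exists_uniform_mesh (δ := min δ₁ δ₂) (by positivity) (v - u)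
  obtain ⟨N, hN⟩ : ∃ N, N = N₁ + N₂ + 1 := ⟨_, rfl⟩
  have hN0 : 0 < N := by omega
  have hm1 := hN₁ N (by omega) hN0
  have hm2 := hN₂ N (by omega) hN0
  set p : ℕ → ℝ := fun k => t + k * ((u - t) / N) with hp
  set r : ℕ → ℝ := fun k => u + k * ((v - u) / N) with hr
  -- The grid of `[t, u]` followed by that of `[u, v]`, with `N` steps each; both formulas give `u`
  -- at index `N`.
  set q : ℕ → ℝ := fun k => if k < N then p k else r (k - N) with hq
  have hpstep : ∀ k, p (k + 1) - p k = (u - t) / N := fun k => by simp only [hp]; push_cast; ring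
  have hrstep : ∀ k, r (k + 1) - r k = (v - u) / N := fun k => by simp only [hr]; push_cast; ring
  have hp0 : 0 ≤ (u - t) / N := div_nonneg (by linarith) (by positivity)
  have hr0 : 0 ≤ (v - u) / N := div_nonneg (by linarith) (by positivity)
  have hqp : ∀ k ≤ N, q k = p k := by
    intro k hk
    rcases hk.eq_or_lt with rfl | hk
    · simp only [hq, hp, hr, lt_irrefl, if_false, Nat.sub_self]
      rw [uniform_partition hN0]
      simp
    · simp only [hq, if_pos hk]
  have hqr : ∀ k, q (N + k) = r k := by
    intro k
    simp only [hq]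
    rw [if_neg (by omega), Nat.add_sub_cancel_left]
  have k1 := h1 N p (by simp [hp]) (uniform_partition hN0) fun k _ => by
    have := hpstep k
    exact ⟨by linarith, by rw [this]; exact hm1.trans_le (min_le_left _ _)⟩
  have k2 := h2 (N + N) q (by rw [hqp 0 (by omega)]; simp [hp])
    (by rw [hqr]; exact uniform_partition hN0) fun k hk => by
    rcases Nat.lt_or_ge k N with h | h
    · rw [hqp k h.le, hqp (k + 1) h]
      have := hpstep k
      exact ⟨by linarith, by rw [this]; exact hm1.trans_le (min_le_right _ _)⟩
    · obtain ⟨l, rfl⟩ := Nat.exists_eq_add_of_le h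
      rw [add_assoc, hqr, hqr]
      have := hrstep l
      exact ⟨by linarith, by rw [this]; exact hm2.trans_le (min_le_right _ _)⟩
  have k3 := hG N hN0
  rw [Finset.sum_range_add] at k2
  have e1 : ∑ k ∈ Finset.range N, (H (q k) (Z (q (k + 1)) - Z (q k))
      + contract (H' (q k)) (ZZ (q k) (q (k + 1))))
      = ∑ k ∈ Finset.range N, (H (p k) (Z (p (k + 1)) - Z (p k))
      + contract (H' (p k)) (ZZ (p k) (p (k + 1)))) := by
    refine Finset.sum_congr rfl fun k hk => ?_
    rw [Finset.mem_range] at hk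
    rw [hqp k hk.le, hqp (k + 1) hk]
  have e2 : ∑ k ∈ Finset.range N, (H (q (N + k)) (Z (q (N + k + 1)) - Z (q (N + k)))
      + contract (H' (q (N + k))) (ZZ (q (N + k)) (q (N + k + 1))))
      = ∑ k ∈ Finset.range N, (H (r k) (Z (r (k + 1)) - Z (r k))
      + contract (H' (r k)) (ZZ (r k) (r (k + 1)))) := by
    refine Finset.sum_congr rfl fun k hk => ?_
    rw [add_assoc, hqr, hqr]
  rw [e1, e2] at k2
  change ‖(∑ k ∈ Finset.range N, (H (r k) (Z (r (k + 1)) - Z (r k))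
      + contract (H' (r k)) (ZZ (r k) (r (k + 1))))) - G‖ ≤ B at k3
  generalize (∑ k ∈ Finset.range N, (H (r k) (Z (r (k + 1)) - Z (r k))
      + contract (H' (r k)) (ZZ (r k) (r (k + 1))))) = b at k2 k3
  generalize (∑ k ∈ Finset.range N, (H (p k) (Z (p (k + 1)) - Z (p k))
      + contract (H' (p k)) (ZZ (p k) (p (k + 1))))) = a at k1 k2
  have e3 : J - I - G = (a - I) - (a + b - J) + (b - G) := by abel
  rw [e3]
  refine (norm_add_le _ _).trans ?_
  have := norm_sub_le (a - I) (a + b - J)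
  linarith

/-- Here the increments of `X` are known beforehand, so the sewing induction needs no bootstrap and
the bound holds on steps of any length. -/
theorem RoughBound.norm_sum_germ_sub_le (hα : 1 / 3 < α) (hZ : RoughBound α T M Z ZZ)
    {S : Set W} {L : ℝ} {μ : W → W} {σ : W → EuclideanSpace ℝ (Fin m) →L[ℝ] W} (hc : CoefBound S L μ σ)
    {A : ℝ} (hA : 0 ≤ A) {u v : ℝ} {X : ℝ → W} (h0 : 0 ≤ u) (huv : u < v) (hv : v ≤ T)
    (hXS : ∀ r ∈ Icc u v, X r ∈ S)
    (hX : ∀ a b, u ≤ a → a ≤ b → b ≤ v → ‖X b - X a‖ ≤ A * (b - a) ^ α ∧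
      ‖X b - X a - σ (X a) (Z b - Z a)‖ ≤ A * ((b - a) ^ α) ^ 2) {N : ℕ} (hN : 0 < N) :
    ‖(∑ k ∈ Finset.range N, germ Z ZZ σ (u + k * ((v - u) / N)) (u + (k + 1 : ℕ) * ((v - u) / N))
        (X (u + k * ((v - u) / N)))) - germ Z ZZ σ u v (X u)‖
      ≤ (L * A ^ 2 + 2 * (L * A)) * M / (1 - (2 / 3 : ℝ) ^ (3 * α - 1)) * ((v - u) ^ α) ^ 3 := by
  have hL := hc.nonneg
  have hM := hZ.nonneg
  have hθ := one_sub_two_thirds_rpow_pos (γ := 3 * α) (by linarith)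
  obtain ⟨ρ, hρ⟩ : ∃ ρ, ρ = (L * A ^ 2 + 2 * (L * A)) * M / (1 - (2 / 3 : ℝ) ^ (3 * α - 1)) :=
    ⟨_, rfl⟩
  have hρ0 : 0 ≤ ρ := by rw [hρ]; positivity
  have hρ' : (1 - (2 / 3 : ℝ) ^ (3 * α - 1)) * ρ = (L * A ^ 2 + 2 * (L * A)) * M := by
    rw [hρ]; field_simp
  obtain ⟨d, hd⟩ : ∃ d, d = (v - u) / N := ⟨_, rfl⟩
  have hd0 : 0 < d := by rw [hd]; exact div_pos (by linarith) (by positivity)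
  have hNd : u + N * d = v := by rw [hd]; exact uniform_partition hN
  rw [← hd, ← hρ]
  set R : ℕ → ℕ → W := fun k l =>
    (∑ j ∈ Finset.Ico k l, germ Z ZZ σ (u + j * d) (u + (j + 1 : ℕ) * d) (X (u + j * d)))
      - germ Z ZZ σ (u + k * d) (u + l * d) (X (u + k * d)) with hR
  have hle : ∀ k l : ℕ, k ≤ l → u + k * d ≤ u + l * d := fun k l h => grid_mono u hd0.le h
  have key := discrete_sewing (R := R) (γ := 3 * α) (by linarith) hd0 hρ0 (N := N) (fun k _ => by
      simp [hR]) ?_ N 0 hN (by omega)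
  · have e : R 0 (0 + N) = (∑ k ∈ Finset.range N, germ Z ZZ σ (u + k * d)
        (u + (k + 1 : ℕ) * d) (X (u + k * d))) - germ Z ZZ σ u v (X u) := by
      simp only [hR, zero_add, Nat.Ico_zero_eq_range, Nat.cast_zero, zero_mul, add_zero, hNd]
    rw [e] at key
    rwa [show (N : ℝ) * d = v - u by linarith, rpow_cube α (by linarith)] at key
  · intro k n p hn hp hk _
    have hT : u + (k + n + p : ℕ) * d ≤ v := hNd ▸ hle _ _ hk
    have hu0 : u ≤ u + k * d := le_add_of_nonneg_right (by positivity)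
    have h1 := hle k (k + n) (by omega)
    have h2 := hle (k + n) (k + n + p) (by omega)
    have e : R k (k + n + p) - R k (k + n) - R (k + n) (k + n + p)
        = defect Z ZZ σ (u + k * d) (u + (k + n : ℕ) * d) (u + (k + n + p : ℕ) * d)
          (X (u + k * d)) (X (u + (k + n : ℕ) * d)) := by
      rw [← hZ.germ_add_germ σ (by linarith) h1 h2 (hT.trans hv)]
      simp only [hR]
      rw [← Finset.sum_Ico_consecutive _ (Nat.le_add_right k n) (Nat.le_add_right (k + n) p)]
      abel
    rw [e, hρ', rpow_cube α (by positivity)]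
    obtain ⟨a1, a2⟩ := hX _ _ hu0 h1 (h2.trans hT)
    have hz := hZ.path _ _ (by linarith) h2 (hT.trans hv)
    have hzz := hZ.area _ _ (by linarith) h2 (hT.trans hv)
    rw [grid_sub] at a1 a2 hz hzz
    have g1 : ((n : ℝ) * d) ^ α ≤ ((n + p : ℕ) * d) ^ α :=
      grid_rpow_mono (by linarith) hd0.le (by omega)
    have g2 : ((p : ℝ) * d) ^ α ≤ ((n + p : ℕ) * d) ^ α :=
      grid_rpow_mono (by linarith) hd0.le (by omega)
    have hq : 0 ≤ (((n + p : ℕ) : ℝ) * d) ^ α := by positivity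
    exact hc.defect_le hA hq (hXS _ ⟨hu0, h1.trans (h2.trans hT)⟩)
      (hXS _ ⟨hu0.trans h1, h2.trans hT⟩) (a1.trans (by gcongr)) (a2.trans (by gcongr))
      (hz.trans (by gcongr)) (hzz.trans (by gcongr))

end RoughPath

/-! ### Well-posedness of the rough differential equation. -/

section WellPosed

variable {m : ℕ} {W : Type*} [NormedAddCommGroup W] [NormedSpace ℝ W] {L M α T : ℝ}
  {Z : ℝ → EuclideanSpace ℝ (Fin m)} {ZZ : ℝ → ℝ → Matrix (Fin m) (Fin m) ℝ}
  {μ : W → W} {σ : W → EuclideanSpace ℝ (Fin m) →L[ℝ] W}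

theorem IsDavie.increment_le_horizon (hα : 0 < α) (hα' : α ≤ 1 / 2) (hZ : RoughBound α T M Z ZZ)
    (hc : CoefBound univ L μ σ) {C : ℝ} (hC : 0 ≤ C) :
    ∃ A, 0 ≤ A ∧ ∀ (a b : ℝ) (X : ℝ → W), 0 ≤ a → b ≤ T → IsDavie α Z ZZ μ σ C a b X →
      ∀ u v, a ≤ u → u ≤ v → v ≤ b → ‖X v - X u‖ ≤ A * (v - u) ^ α ∧
        ‖X v - X u - σ (X u) (Z v - Z u)‖ ≤ A * ((v - u) ^ α) ^ 2 := by
  have hL := hc.nonneg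
  have hM := hZ.nonneg
  obtain ⟨Θ, hΘ1, hΘ⟩ := exists_horizon_const hα hα' T
  obtain ⟨B, hB⟩ : ∃ B, B = L * M + Θ * L + C * Θ := ⟨_, rfl⟩
  have hB0 : 0 ≤ B := by rw [hB]; positivity
  refine ⟨L * M + B * Θ + B, by positivity, fun a b X ha hb h u v h1 h2 h3 => ?_⟩
  have hz := hZ.path u v (by linarith) h2 (by linarith)
  have hzz := hZ.area u v (by linarith) h2 (by linarith)
  obtain ⟨k1, k2⟩ := hΘ (v - u) (by linarith) (by linarith)
  have k3 := h u v h1 h2 h3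
  have hq0 : 0 ≤ (v - u) ^ α := Real.rpow_nonneg (by linarith) _
  have hvu : 0 ≤ v - u := by linarith
  generalize (v - u) ^ α = q at *
  have e : X v - X u - σ (X u) (Z v - Z u) = contract (gammaOp σ σ (X u)) (ZZ u v)
      + (v - u) • μ (X u) + (X v - eulerStep Z ZZ μ σ u v (X u)) := by
    simp only [eulerStep, germ]; abel
  have h4 : ‖contract (gammaOp σ σ (X u)) (ZZ u v)‖ ≤ L * (M * q ^ 2) :=
    (norm_contract_le _ _).trans (mul_le_mul (hc.gamma_le _ (mem_univ _)) hzz (by positivity) hL)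
  have h5 : ‖(v - u) • μ (X u)‖ ≤ (Θ * q ^ 2) * L := by
    rw [norm_smul, Real.norm_of_nonneg hvu]
    exact mul_le_mul k1 (hc.drift_le _ (mem_univ _)) (norm_nonneg _) (by positivity)
  have h6 : C * q ^ 3 ≤ C * Θ * q ^ 2 := by
    have : C * q ^ 2 * q ≤ C * q ^ 2 * Θ := by gcongr
    linarith
  have h7 : ‖X v - X u - σ (X u) (Z v - Z u)‖ ≤ B * q ^ 2 := by
    rw [e, hB]
    refine (norm_add₃_le).trans ?_
    linarith
  have h8 : ‖σ (X u) (Z v - Z u)‖ ≤ L * (M * q) :=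
    ((σ (X u)).le_opNorm _).trans
      (mul_le_mul (hc.norm_le _ (mem_univ _)) hz (norm_nonneg _) hL)
  refine ⟨?_, h7.trans ?_⟩
  · have h9 : B * q ^ 2 ≤ B * Θ * q := by
      have : B * q * q ≤ B * q * Θ := by gcongr
      linarith
    have h10 : 0 ≤ B * q := by positivity
    have := norm_le_norm_sub_add (X v - X u) (σ (X u) (Z v - Z u))
    linarith
  · gcongr
    have : 0 ≤ L * M + B * Θ := by positivity
    linarith

theorem continuousOn_of_holder {U : Type*} [NormedAddCommGroup U] (hα : 0 < α) {A a b : ℝ}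
    {X : ℝ → U} (h : ∀ u v, a ≤ u → u ≤ v → v ≤ b → ‖X v - X u‖ ≤ A * (v - u) ^ α) :
    ContinuousOn X (Icc a b) := by
  intro r hr
  rw [ContinuousWithinAt, tendsto_iff_norm_sub_tendsto_zero]
  have h1 : Tendsto (fun x => A * |x - r| ^ α) (𝓝[Icc a b] r) (𝓝 0) := by
    have h2 : Tendsto (fun x : ℝ => |x - r|) (𝓝 r) (𝓝 0) := by
      have : Continuous fun x : ℝ => |x - r| := by fun_prop
      simpa using this.tendsto r
    have h3 := (h2.rpow_const (p := α) (Or.inr hα.le)).const_mul A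
    rw [Real.zero_rpow hα.ne', mul_zero] at h3
    exact h3.mono_left nhdsWithin_le_nhds
  refine squeeze_zero' (Eventually.of_forall fun _ => norm_nonneg _) ?_ h1
  filter_upwards [self_mem_nhdsWithin] with x hx
  rcases le_total x r with hxr | hxr
  · rw [norm_sub_rev, abs_of_nonpos (by linarith), neg_sub]
    exact h x r hx.1 hxr hr.2
  · rw [abs_of_nonneg (by linarith)]
    exact h r x hr.1 hxr hx.2

theorem norm_integral_sub_smul_le {U : Type*} [NormedAddCommGroup U] [NormedSpace ℝ U]
    [CompleteSpace U] (hα : 0 < α) {A a b : ℝ} (hA : 0 ≤ A) {g : ℝ → U}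
    (h : ∀ u v, a ≤ u → u ≤ v → v ≤ b → ‖g v - g u‖ ≤ A * (v - u) ^ α) {u v : ℝ}
    (h1 : a ≤ u) (h2 : u ≤ v) (h3 : v ≤ b) :
    ‖(∫ r in u..v, g r) - (v - u) • g u‖ ≤ A * (v - u) ^ α * (v - u) := by
  have hi : IntervalIntegrable g MeasureTheory.volume u v :=
    ((continuousOn_of_holder hα h).mono (Icc_subset_Icc h1 h3)).intervalIntegrable_of_Icc h2
  rw [← intervalIntegral.integral_const, ← intervalIntegral.integral_sub hi (by simp)]
  refine (intervalIntegral.norm_integral_le_of_norm_le_const (C := A * (v - u) ^ α)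
    fun r hr => ?_).trans ?_
  · rw [uIoc_of_le h2] at hr
    refine (h u r h1 hr.1.le (hr.2.trans h3)).trans ?_
    gcongr
    · linarith [hr.1]
    · exact hr.2
  · rw [abs_of_nonneg (by linarith)]

/-- Subtracting the drift integral from `X` leaves a path whose increments are germs up to third
order: the integral and its left-point value differ by a Hölder increment times the length, of order
`q * q ^ 2`. -/
theorem IsDavie.isRDESolution [CompleteSpace W] (hα : 1 / 3 < α) (hα' : α ≤ 1 / 2)
    (hZ : RoughBound α T M Z ZZ)
    (hc : CoefBound univ L μ σ) {C t : ℝ} (hC : 0 ≤ C) (ht : 0 ≤ t) {X : ℝ → W}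
    (h : IsDavie α Z ZZ μ σ C t T X) : IsRDESolution α T Z ZZ μ σ t (X t) X := by
  have hα0 : 0 < α := by linarith
  have hL := hc.nonneg
  obtain ⟨Θ, hΘ1, hΘ⟩ := exists_horizon_const hα0 hα' T
  obtain ⟨A, hA, hinc⟩ := IsDavie.increment_le_horizon hα0 hα' hZ hc hC
  replace hinc := hinc t T X ht le_rfl h
  have hμ : ∀ u v, t ≤ u → u ≤ v → v ≤ T → ‖μ (X v) - μ (X u)‖ ≤ L * A * (v - u) ^ α := by
    intro u v h1 h2 h3
    refine (hc.drift_lip _ (mem_univ _) _ (mem_univ _)).trans ?_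
    rw [mul_assoc]
    exact mul_le_mul_of_nonneg_left (hinc u v h1 h2 h3).1 hL
  have hμc := continuousOn_of_holder hα0 hμ
  refine ⟨rfl, ⟨⟨A, fun u v h1 h2 h3 => ?_⟩, ⟨L * A, fun u v h1 h2 h3 => ?_⟩⟩, fun s hs => ?_⟩
  · rw [rpow_sq α (by linarith)]
    exact (hinc u v h1 h2.le h3).2
  · refine (hc.lip _ (mem_univ _) _ (mem_univ _)).trans ?_
    rw [mul_assoc]
    exact mul_le_mul_of_nonneg_left (hinc u v h1 h2.le h3).1 hL
  · have key := hasRoughIntegral_of_local (Z := Z) (ZZ := ZZ) hα (H := fun r => σ (X r))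
      (H' := fun r => gammaOp σ σ (X r)) (J := fun r => X r - ∫ y in t..r, μ (X y))
      (C := C + L * A * Θ) (h₀ := 1) (s := t) (t := s) (by positivity) one_pos hs.1 ?_
    · rw [intervalIntegral.integral_same, sub_zero, sub_right_comm] at key
      exact key
    · intro u v h1 h2 h3 _
      have h3' := h3.trans hs.2
      have hint : ∀ r, t ≤ r → r ≤ T → IntervalIntegrable (fun y => μ (X y))
          MeasureTheory.volume t r := fun r h4 h5 =>
        (hμc.mono (Icc_subset_Icc le_rfl h5)).intervalIntegrable_of_Icc h4
      have e1 := intervalIntegral.integral_interval_sub_left (hint v (h1.trans h2) h3')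
        (hint u h1 (h2.trans h3'))
      have e : X v - (∫ y in t..v, μ (X y)) - (X u - ∫ y in t..u, μ (X y))
          - (σ (X u) (Z v - Z u) + contract (gammaOp σ σ (X u)) (ZZ u v))
          = (X v - eulerStep Z ZZ μ σ u v (X u))
            - ((∫ y in u..v, μ (X y)) - (v - u) • μ (X u)) := by
        rw [← e1]
        simp only [eulerStep, germ]
        abel
      rw [e]
      refine (norm_sub_le _ _).trans ?_
      rw [add_mul]
      refine add_le_add (h u v h1 h2 h3') ?_
      refine (norm_integral_sub_smul_le hα0 (by positivity) hμ h1 h2 h3').trans ?_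
      have k := (hΘ (v - u) (by linarith) (by linarith)).1
      have hq0 : 0 ≤ (v - u) ^ α := Real.rpow_nonneg (by linarith) _
      calc _ ≤ L * A * (v - u) ^ α * (Θ * ((v - u) ^ α) ^ 2) := by gcongr
        _ = _ := by ring

/-- Controlledness of `(X, σ(X))` alone gives the increments required for sewing, so compensated
sums over `[u, v]` are close to a single germ. The integral equation at `u` and `v` transfers this
to `X`. -/
theorem IsRDESolution.isDavie [CompleteSpace W] (hα : 1 / 3 < α) (hα' : α ≤ 1 / 2)
    (hZ : RoughBound α T M Z ZZ)
    (hc : CoefBound univ L μ σ) {t : ℝ} (ht : 0 ≤ t) {x : W} {X : ℝ → W}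
    (h : IsRDESolution α T Z ZZ μ σ t x X) : ∃ C, 0 ≤ C ∧ IsDavie α Z ZZ μ σ C t T X := by
  have hα0 : 0 < α := by linarith
  have hL := hc.nonneg
  have hM := hZ.nonneg
  obtain ⟨Θ, hΘ1, hΘ⟩ := exists_horizon_const hα0 hα' T
  obtain ⟨K, hK⟩ := h.controlled.expansion
  obtain ⟨A, hA⟩ : ∃ A, A = L * M + |K| * Θ + |K| := ⟨_, rfl⟩
  have hA0 : 0 ≤ A := by rw [hA]; positivity
  have hinc : ∀ u v, t ≤ u → u ≤ v → v ≤ T → ‖X v - X u‖ ≤ A * (v - u) ^ α ∧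
      ‖X v - X u - σ (X u) (Z v - Z u)‖ ≤ A * ((v - u) ^ α) ^ 2 := by
    intro u v h1 h2 h3
    have hq0 : 0 ≤ (v - u) ^ α := Real.rpow_nonneg (by linarith) _
    rcases h2.eq_or_lt with rfl | h2
    · simp only [sub_self, map_zero, norm_zero] at hq0 ⊢
      exact ⟨by positivity, by positivity⟩
    · have k := hK u v h1 h2 h3
      rw [rpow_sq α (by linarith)] at k
      have hz := hZ.path u v (by linarith) h2.le (by linarith)
      have k2 := (hΘ (v - u) (by linarith) (by linarith)).2
      generalize (v - u) ^ α = q at *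
      have k3 : ‖X v - X u - σ (X u) (Z v - Z u)‖ ≤ |K| * q ^ 2 :=
        k.trans (mul_le_mul_of_nonneg_right (le_abs_self K) (by positivity))
      have h8 : ‖σ (X u) (Z v - Z u)‖ ≤ L * (M * q) :=
        ((σ (X u)).le_opNorm _).trans
          (mul_le_mul (hc.norm_le _ (mem_univ _)) hz (norm_nonneg _) hL)
      have h9 : |K| * q ^ 2 ≤ |K| * Θ * q := by
        have : |K| * q * q ≤ |K| * q * Θ := by gcongr
        linarith
      refine ⟨?_, k3.trans ?_⟩
      · have h10 : 0 ≤ |K| * q := by positivity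
        have := norm_le_norm_sub_add (X v - X u) (σ (X u) (Z v - Z u))
        rw [hA]
        linarith
      · rw [hA]
        gcongr
        have : 0 ≤ L * M + |K| * Θ := by positivity
        linarith
  have hμ : ∀ u v, t ≤ u → u ≤ v → v ≤ T → ‖μ (X v) - μ (X u)‖ ≤ L * A * (v - u) ^ α := by
    intro u v h1 h2 h3
    refine (hc.drift_lip _ (mem_univ _) _ (mem_univ _)).trans ?_
    rw [mul_assoc]
    exact mul_le_mul_of_nonneg_left (hinc u v h1 h2 h3).1 hL
  have hμc := continuousOn_of_holder hα0 hμ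
  have hθ := one_sub_two_thirds_rpow_pos (γ := 3 * α) (by linarith)
  obtain ⟨ρ, hρ⟩ : ∃ ρ, ρ = (L * A ^ 2 + 2 * (L * A)) * M / (1 - (2 / 3 : ℝ) ^ (3 * α - 1)) :=
    ⟨_, rfl⟩
  have hρ0 : 0 ≤ ρ := by rw [hρ]; positivity
  refine ⟨ρ + L * A * Θ, by positivity, fun u v h1 h2 h3 => ?_⟩
  rcases h2.eq_or_lt with rfl | h2
  · rw [hZ.eulerStep_self hα0 (by linarith) h3, sub_self, norm_zero]
    have : 0 ≤ (u - u) ^ α := by rw [sub_self]; positivity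
    positivity
  · have key := HasRoughIntegral.norm_increment_sub_le (G := germ Z ZZ σ u v (X u)) h1 h2.le
      (h.equation u ⟨h1, by linarith⟩) (h.equation v ⟨by linarith, h3⟩) fun N hN =>
      hZ.norm_sum_germ_sub_le hα hc hA0 (by linarith) h2 h3 (fun _ _ => mem_univ _)
        (fun a b k1 k2 k3 => hinc a b (h1.trans k1) k2 (k3.trans h3)) hN
    rw [← hρ] at key
    have hint : ∀ r, t ≤ r → r ≤ T → IntervalIntegrable (fun y => μ (X y))
        MeasureTheory.volume t r := fun r h4 h5 =>
      (hμc.mono (Icc_subset_Icc le_rfl h5)).intervalIntegrable_of_Icc h4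
    have e1 := intervalIntegral.integral_interval_sub_left (hint v (h1.trans h2.le) h3)
      (hint u h1 (h2.le.trans h3))
    have e : X v - eulerStep Z ZZ μ σ u v (X u)
        = (X v - x - (∫ y in t..v, μ (X y)) - (X u - x - ∫ y in t..u, μ (X y))
          - germ Z ZZ σ u v (X u)) + ((∫ y in u..v, μ (X y)) - (v - u) • μ (X u)) := by
      rw [← e1]
      simp only [eulerStep]
      abel
    rw [e]
    refine (norm_add_le _ _).trans ?_
    rw [add_mul]
    refine add_le_add key ?_
    refine (norm_integral_sub_smul_le hα0 (by positivity) hμ h1 h2.le h3).trans ?_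
    have k := (hΘ (v - u) (by linarith) (by linarith)).1
    have hq0 : 0 ≤ (v - u) ^ α := Real.rpow_nonneg (by linarith) _
    calc _ ≤ L * A * (v - u) ^ α * (Θ * ((v - u) ^ α) ^ 2) := by gcongr
      _ = _ := by ring

/-- Stability on short intervals doubles an initial distance of zero; induction over intervals of
length `h₀` covers `[s, t]`. -/
theorem IsDavie.eqOn (hα : 1 / 3 < α) (hα' : α ≤ 1 / 2) (hZ : RoughBound α T M Z ZZ)
    (hc : CoefBound univ L μ σ) {s t C D : ℝ} {X Y : ℝ → W} (hs : 0 ≤ s) (ht : t ≤ T)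
    (hX : IsDavie α Z ZZ μ σ C s t X) (hY : IsDavie α Z ZZ μ σ D s t Y) (h : X s = Y s) :
    EqOn X Y (Icc s t) := by
  obtain ⟨h₀, h0, hstab⟩ := davie_stability hα hα' hZ hc
  have hmax : ∀ E F, E ≤ F → ∀ V, IsDavie α Z ZZ μ σ E s t V → IsDavie α Z ZZ μ σ F s t V :=
    fun E F hEF V hV u v h1 h2 h3 => (hV u v h1 h2 h3).trans (by
      have : 0 ≤ ((v - u) ^ α) ^ 3 := pow_nonneg (Real.rpow_nonneg (by linarith) _) _
      gcongr)
  have hX' := hmax _ _ (le_max_left C D) _ hX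
  have hY' := hmax _ _ (le_max_right C D) _ hY
  have key : ∀ n : ℕ, ∀ r, s ≤ r → r ≤ t → r - s ≤ n * h₀ → X r = Y r := by
    intro n
    induction n with
    | zero =>
      intro r h1 _ h3
      simp only [Nat.cast_zero, zero_mul] at h3
      rwa [show r = s by linarith]
    | succ n ih =>
      intro r h1 h2 h3
      push_cast at h3
      obtain ⟨r', hr'⟩ : ∃ r', r' = max s (r - h₀) := ⟨_, rfl⟩
      have k1 : s ≤ r' := hr' ▸ le_max_left _ _
      have k2 : r - h₀ ≤ r' := hr' ▸ le_max_right _ _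
      have k3 : r' ≤ r := hr' ▸ max_le h1 (by linarith)
      have k4 : r' - s ≤ n * h₀ := by
        rw [hr', sub_le_iff_le_add]
        have : 0 ≤ n * h₀ := by positivity
        exact max_le (by linarith) (by linarith)
      have k5 := ih r' k1 (k3.trans h2) k4
      have k6 := hstab r' r (max C D) X Y (hs.trans k1) k3 (h2.trans ht) (by linarith)
        (fun _ _ => mem_univ _) (fun _ _ => mem_univ _) (hX'.mono k1 h2) (hY'.mono k1 h2)
      rw [k5, sub_self, norm_zero, mul_zero] at k6
      exact sub_eq_zero.1 (norm_le_zero_iff.1 k6)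
  intro r hr
  obtain ⟨n, hn⟩ := exists_nat_ge ((r - s) / h₀)
  exact key n r hr.1 hr.2 ((div_le_iff₀ h0).1 hn)

/-- Only intervals that contain the junction `c` are in question. There one Euler step differs from
two consecutive ones by the defect and by the change of the drift, both of third order. -/
theorem IsDavie.glue (hα : 0 < α) (hα' : α ≤ 1 / 2) (hZ : RoughBound α T M Z ZZ)
    (hc : CoefBound univ L μ σ) {a c b C D : ℝ} {X Y : ℝ → W} (ha : 0 ≤ a) (hac : a ≤ c)
    (hcb : c ≤ b) (hb : b ≤ T) (hC : 0 ≤ C) (hD : 0 ≤ D)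
    (hX : IsDavie α Z ZZ μ σ C a c X) (hY : IsDavie α Z ZZ μ σ D c b Y) (h : Y c = X c) :
    ∃ V : ℝ → W, V a = X a ∧ ∃ E, 0 ≤ E ∧ IsDavie α Z ZZ μ σ E a b V := by
  have hL := hc.nonneg
  have hM := hZ.nonneg
  obtain ⟨Θ, hΘ1, hΘ⟩ := exists_horizon_const hα hα' T
  obtain ⟨A, hA, hinc⟩ := IsDavie.increment_le_horizon hα hα' hZ hc hC
  replace hinc := hinc a c X ha (hcb.trans hb) hX
  obtain ⟨B, hB⟩ : ∃ B, B = (L * A ^ 2 + 2 * (L * A)) * M := ⟨_, rfl⟩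
  have hB0 : 0 ≤ B := by rw [hB]; positivity
  refine ⟨fun r => if r ≤ c then X r else Y r, if_pos hac, C + D + B + Θ * (L * A),
    by positivity, fun u v h1 h2 h3 => ?_⟩
  have hq0 : 0 ≤ ((v - u) ^ α) ^ 3 := pow_nonneg (Real.rpow_nonneg (by linarith) _) _
  have hV : ∀ r, c ≤ r → (if r ≤ c then X r else Y r) = Y r := by
    intro r hr
    rcases hr.eq_or_lt with rfl | hr
    · rw [if_pos le_rfl, h]
    · rw [if_neg hr.not_ge]
  have hΘLA : 0 ≤ Θ * (L * A) := by positivity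
  rcases le_total v c with hvc | hcv
  · simp only [if_pos hvc, if_pos (h2.trans hvc)]
    refine (hX u v h1 h2 hvc).trans ?_
    gcongr
    linarith
  rcases le_total c u with hcu | huc
  · simp only [hV u hcu, hV v hcv]
    refine (hY u v hcu h2 h3).trans ?_
    gcongr
    linarith
  simp only [if_pos huc, hV v hcv]
  have k1 := hX u c h1 huc le_rfl
  have k2 := hY c v le_rfl hcv h3
  rw [h] at k2
  obtain ⟨k3, k4⟩ := hinc u c h1 huc le_rfl
  have g1 : (c - u) ^ α ≤ (v - u) ^ α := Real.rpow_le_rpow (by linarith) (by linarith) hα.le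
  have g2 : (v - c) ^ α ≤ (v - u) ^ α := Real.rpow_le_rpow (by linarith) (by linarith) hα.le
  have g3 : 0 ≤ (c - u) ^ α := Real.rpow_nonneg (by linarith) _
  have g4 : 0 ≤ (v - c) ^ α := Real.rpow_nonneg (by linarith) _
  have hz := hZ.path c v (by linarith) hcv (by linarith)
  have hzz := hZ.area c v (by linarith) hcv (by linarith)
  have k5 := (hΘ (v - u) (by linarith) (by linarith)).1
  have e : Y v - eulerStep Z ZZ μ σ u v (X u) = (Y v - eulerStep Z ZZ μ σ c v (X c))
      + (X c - eulerStep Z ZZ μ σ u c (X u)) + defect Z ZZ σ u c v (X u) (X c)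
      + (v - c) • (μ (X c) - μ (X u)) := by
    rw [← hZ.germ_add_germ σ (by linarith) huc hcv (by linarith)]
    simp only [eulerStep, show v - u = (v - c) + (c - u) by ring, add_smul, smul_sub]
    abel
  rw [e]
  generalize (v - u) ^ α = q at *
  have hq : 0 ≤ q := g3.trans g1
  have d1 : ‖defect Z ZZ σ u c v (X u) (X c)‖ ≤ B * q ^ 3 := by
    rw [hB]
    exact hc.defect_le hA hq (mem_univ _) (mem_univ _) (k3.trans (by gcongr))
      (k4.trans (by gcongr)) (hz.trans (by gcongr)) (hzz.trans (by gcongr))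
  have d2 : ‖(v - c) • (μ (X c) - μ (X u))‖ ≤ Θ * (L * A) * q ^ 3 := by
    rw [norm_smul, Real.norm_of_nonneg (by linarith)]
    have d3 : ‖μ (X c) - μ (X u)‖ ≤ L * (A * q) :=
      (hc.drift_lip _ (mem_univ _) _ (mem_univ _)).trans
        (mul_le_mul_of_nonneg_left (k3.trans (by gcongr)) hL)
    calc _ ≤ (Θ * q ^ 2) * (L * (A * q)) :=
          mul_le_mul (by linarith) d3 (norm_nonneg _) (by positivity)
      _ = _ := by ring
  have d4 : C * ((c - u) ^ α) ^ 3 ≤ C * q ^ 3 := by gcongr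
  have d5 : D * ((v - c) ^ α) ^ 3 ≤ D * q ^ 3 := by gcongr
  refine (norm_add_le _ _).trans ?_
  have := norm_add₃_le (a := Y v - eulerStep Z ZZ μ σ c v (X c))
    (b := X c - eulerStep Z ZZ μ σ u c (X u)) (c := defect Z ZZ σ u c v (X u) (X c))
  linarith

/-- The local existence time does not depend on the starting point, so finitely many gluings reach
`T`. The Davie constant may grow at each gluing, which is why it is existentially quantified after
the path. -/
theorem exists_davie [CompleteSpace W] (hα : 1 / 3 < α) (hα' : α ≤ 1 / 2)
    (hZ : RoughBound α T M Z ZZ) (hc : CoefBound univ L μ σ) {t : ℝ} (ht : 0 ≤ t) (htT : t ≤ T)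
    (x : W) : ∃ X : ℝ → W, X t = x ∧ ∃ C, 0 ≤ C ∧ IsDavie α Z ZZ μ σ C t T X := by
  have hα0 : 0 < α := by linarith
  obtain ⟨C, h₀, hC, h0, -, hex⟩ := davie_exists hα hα' hZ hc isClosed_univ (S₀ := univ)
    fun _ _ _ _ => mem_univ _
  have key : ∀ n : ℕ, ∀ b, t ≤ b → b ≤ T → b - t ≤ n * h₀ →
      ∃ X : ℝ → W, X t = x ∧ ∃ C, 0 ≤ C ∧ IsDavie α Z ZZ μ σ C t b X := by
    intro n
    induction n with
    | zero =>
      intro b h1 h2 h3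
      simp only [Nat.cast_zero, zero_mul] at h3
      obtain ⟨X, hX, -, hX'⟩ := hex t b ht h1 h2 (by linarith) x (mem_univ _)
      exact ⟨X, hX, C, hC, hX'⟩
    | succ n ih =>
      intro b h1 h2 h3
      push_cast at h3
      obtain ⟨c, hc'⟩ : ∃ c, c = max t (b - h₀) := ⟨_, rfl⟩
      have k1 : t ≤ c := hc' ▸ le_max_left _ _
      have k2 : b - h₀ ≤ c := hc' ▸ le_max_right _ _
      have k3 : c ≤ b := hc' ▸ max_le h1 (by linarith)
      have k4 : c - t ≤ n * h₀ := by
        rw [hc', sub_le_iff_le_add]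
        have : 0 ≤ n * h₀ := by positivity
        exact max_le (by linarith) (by linarith)
      obtain ⟨X, hX, D, hD, hX'⟩ := ih c k1 (k3.trans h2) k4
      obtain ⟨Y, hY, -, hY'⟩ := hex c b (ht.trans k1) k3 h2 (by linarith) (X c) (mem_univ _)
      obtain ⟨V, hV, E, hE, hV'⟩ := hX'.glue hα0 hα' hZ hc ht k1 k3 h2 hD hC hY' hY
      exact ⟨V, hV.trans hX, E, hE, hV'⟩
  obtain ⟨n, hn⟩ := exists_nat_ge ((T - t) / h₀)
  exact key n T htT le_rfl ((div_le_iff₀ h0).1 hn)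

end WellPosed

/-! ### Functions with locally Lipschitz second derivative, and their compositions. -/

section SecondOrder

variable {W U : Type} [NormedAddCommGroup W] [NormedSpace ℝ W] [NormedAddCommGroup U]
  [NormedSpace ℝ U]

/-- `g` is twice differentiable and on `B` its first two derivatives are bounded by `K`, the second
one being `K`-Lipschitz. -/
structure C21On (B : Set W) (K : ℝ) (g : W → U) : Prop where
  diff : Differentiable ℝ g
  diff_fderiv : Differentiable ℝ (fderiv ℝ g)
  fderiv_le : ∀ x ∈ B, ‖fderiv ℝ g x‖ ≤ K
  fderiv_fderiv_le : ∀ x ∈ B, ‖fderiv ℝ (fderiv ℝ g) x‖ ≤ K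
  fderiv_fderiv_lip : ∀ x ∈ B, ∀ y ∈ B,
    ‖fderiv ℝ (fderiv ℝ g) x - fderiv ℝ (fderiv ℝ g) y‖ ≤ K * ‖x - y‖

theorem C21On.mono {B : Set W} {K K' : ℝ} {g : W → U} (h : C21On B K g) (hK : K ≤ K') :
    C21On B K' g :=
  ⟨h.diff, h.diff_fderiv, fun x hx => (h.fderiv_le x hx).trans hK,
    fun x hx => (h.fderiv_fderiv_le x hx).trans hK, fun x hx y hy =>
    (h.fderiv_fderiv_lip x hx y hy).trans (by gcongr)⟩

theorem C21On.fderiv_lip {B : Set W} (hB : Convex ℝ B) {K : ℝ} {g : W → U} (h : C21On B K g)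
    {x y : W} (hx : x ∈ B) (hy : y ∈ B) : ‖fderiv ℝ g x - fderiv ℝ g y‖ ≤ K * ‖x - y‖ :=
  hB.norm_image_sub_le_of_norm_fderiv_le (fun z _ => h.diff_fderiv z) h.fderiv_fderiv_le hy hx

theorem C21On.contDiff {K : ℝ → ℝ} {g : W → U}
    (h : ∀ R, C21On (Metric.closedBall 0 R) (K R) g) : ContDiff ℝ 2 g := by
  have h0 := h 0
  rw [show (2 : WithTop ℕ∞) = 1 + 1 by norm_num, contDiff_succ_iff_fderiv]
  refine ⟨h0.diff, by simp, ?_⟩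
  rw [contDiff_one_iff_fderiv]
  refine ⟨h0.diff_fderiv, continuous_iff_continuousAt.2 fun x => ?_⟩
  have hK := h (‖x‖ + 1)
  have hx : x ∈ Metric.closedBall (0 : W) (‖x‖ + 1) := by simp
  have hlip : LipschitzOnWith (K (‖x‖ + 1)).toNNReal (fderiv ℝ (fderiv ℝ g))
      (Metric.closedBall 0 (‖x‖ + 1)) := by
    refine LipschitzOnWith.of_dist_le_mul fun y hy z hz => ?_
    rw [dist_eq_norm, dist_eq_norm]
    refine (hK.fderiv_fderiv_lip y hy z hz).trans ?_
    gcongr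
    exact Real.le_coe_toNNReal _
  refine hlip.continuousOn.continuousAt ?_
  refine Filter.mem_of_superset (Metric.ball_mem_nhds x one_pos) fun y hy => ?_
  rw [mem_closedBall_zero_iff]
  rw [mem_ball_iff_norm] at hy
  have := norm_le_norm_sub_add y x
  linarith

theorem fderiv_comp_apply {g : W → U} {Φ : W → W} (hg : Differentiable ℝ g)
    (hΦ : Differentiable ℝ Φ) (x v : W) :
    fderiv ℝ (fun x => g (Φ x)) x v = fderiv ℝ g (Φ x) (fderiv ℝ Φ x v) := by
  rw [fderiv_fun_comp x (hg _) (hΦ _)]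
  rfl

theorem hasFDerivAt_fderiv_comp {g : W → U} {Φ : W → W} (hg : Differentiable ℝ g)
    (hg' : Differentiable ℝ (fderiv ℝ g)) (hΦ : Differentiable ℝ Φ)
    (hΦ' : Differentiable ℝ (fderiv ℝ Φ)) (x : W) :
    HasFDerivAt (fderiv ℝ fun x => g (Φ x))
      (((ContinuousLinearMap.compL ℝ W W U) (fderiv ℝ g (Φ x))).comp (fderiv ℝ (fderiv ℝ Φ) x)
        + ((ContinuousLinearMap.compL ℝ W W U).flip (fderiv ℝ Φ x)).comp
          ((fderiv ℝ (fderiv ℝ g) (Φ x)).comp (fderiv ℝ Φ x))) x := by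
  have e : (fderiv ℝ fun x => g (Φ x)) = fun x => (fderiv ℝ g (Φ x)).comp (fderiv ℝ Φ x) := by
    ext1 y
    exact fderiv_fun_comp y (hg _) (hΦ _)
  rw [e]
  exact ((hg' _).hasFDerivAt.comp x (hΦ x).hasFDerivAt).clm_comp (hΦ' x).hasFDerivAt

theorem fderiv_fderiv_comp_apply {g : W → U} {Φ : W → W} (hg : Differentiable ℝ g)
    (hg' : Differentiable ℝ (fderiv ℝ g)) (hΦ : Differentiable ℝ Φ)
    (hΦ' : Differentiable ℝ (fderiv ℝ Φ)) (x w v : W) :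
    fderiv ℝ (fderiv ℝ fun x => g (Φ x)) x w v = fderiv ℝ g (Φ x) (fderiv ℝ (fderiv ℝ Φ) x w v)
      + fderiv ℝ (fderiv ℝ g) (Φ x) (fderiv ℝ Φ x w) (fderiv ℝ Φ x v) := by
  rw [(hasFDerivAt_fderiv_comp hg hg' hΦ hΦ' x).fderiv]
  rfl

theorem norm_clm_apply_le {V V' : Type} [NormedAddCommGroup V] [NormedSpace ℝ V]
    [NormedAddCommGroup V'] [NormedSpace ℝ V'] {A : V →L[ℝ] V'} {v : V} {a b : ℝ}
    (hA : ‖A‖ ≤ a) (hv : ‖v‖ ≤ b) : ‖A v‖ ≤ a * b :=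
  (A.le_opNorm v).trans (mul_le_mul hA hv (norm_nonneg _) ((norm_nonneg _).trans hA))

/-- The three powers of `K'` come from the five terms of the difference of `Dg(Φ) D²Φ + D²g(Φ)(DΦ,
DΦ)` at two points: one of degree one, three of degree two and one of degree three. The same
constant dominates the bounds on both derivatives. -/
theorem C21On.comp {B B' : Set W} (hB : Convex ℝ B) (hB' : Convex ℝ B') {K K' : ℝ} {g : W → U}
    {Φ : W → W} (hK : 0 ≤ K) (hK' : 0 ≤ K') (hg : C21On B' K g) (hΦ : C21On B K' Φ)
    (hm : ∀ x ∈ B, Φ x ∈ B') :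
    C21On B (K * (K' + 3 * K' ^ 2 + K' ^ 3)) fun x => g (Φ x) := by
  have hd := fun x => hasFDerivAt_fderiv_comp hg.diff hg.diff_fderiv hΦ.diff hΦ.diff_fderiv x
  refine ⟨hg.diff.comp hΦ.diff, fun x => (hd x).differentiableAt, fun x hx => ?_, fun x hx => ?_,
    fun x hx y hy => ?_⟩
  · refine norm_le_of_unit' (by positivity) fun v hv => ?_
    rw [fderiv_comp_apply hg.diff hΦ.diff]
    refine (norm_clm_apply_le (hg.fderiv_le _ (hm x hx))
      (norm_clm_apply_le (hΦ.fderiv_le x hx) hv)).trans ?_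
    gcongr
    have : 0 ≤ 3 * K' ^ 2 + K' ^ 3 := by positivity
    linarith
  · refine norm_le_of_unit (by positivity) fun v w hv hw => ?_
    rw [fderiv_fderiv_comp_apply hg.diff hg.diff_fderiv hΦ.diff hΦ.diff_fderiv]
    have h1 := norm_clm_apply_le (hg.fderiv_le _ (hm x hx))
      (norm_clm_apply_le (norm_clm_apply_le (hΦ.fderiv_fderiv_le x hx) hw) hv)
    have h2 := norm_clm_apply_le (norm_clm_apply_le (hg.fderiv_fderiv_le _ (hm x hx))
      (norm_clm_apply_le (hΦ.fderiv_le x hx) hw)) (norm_clm_apply_le (hΦ.fderiv_le x hx) hv)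
    refine (norm_add_le _ _).trans ((add_le_add h1 h2).trans ?_)
    have : 0 ≤ 2 * (K * K' ^ 2) + K * K' ^ 3 := by positivity
    linarith
  · refine norm_le_of_unit (by positivity) fun v w hv hw => ?_
    rw [sub_apply, sub_apply,
      fderiv_fderiv_comp_apply hg.diff hg.diff_fderiv hΦ.diff hΦ.diff_fderiv,
      fderiv_fderiv_comp_apply hg.diff hg.diff_fderiv hΦ.diff hΦ.diff_fderiv]
    have hxy := hB.norm_image_sub_le_of_norm_fderiv_le (fun z _ => hΦ.diff z) hΦ.fderiv_le hy hx
    have h1 := (hg.fderiv_lip hB' (hm x hx) (hm y hy)).trans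
      (mul_le_mul_of_nonneg_left hxy hK)
    have h2 := hΦ.fderiv_fderiv_lip x hx y hy
    have h3 := (hg.fderiv_fderiv_lip _ (hm x hx) _ (hm y hy)).trans
      (mul_le_mul_of_nonneg_left hxy hK)
    have h4 := hΦ.fderiv_lip hB hx hy
    have k1 := norm_clm_apply_le h1
      (norm_clm_apply_le (norm_clm_apply_le (hΦ.fderiv_fderiv_le x hx) hw) hv)
    have k2 := norm_clm_apply_le (hg.fderiv_le _ (hm y hy))
      (norm_clm_apply_le (norm_clm_apply_le h2 hw) hv)
    have k3 := norm_clm_apply_le (norm_clm_apply_le h3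
      (norm_clm_apply_le (hΦ.fderiv_le x hx) hw)) (norm_clm_apply_le (hΦ.fderiv_le x hx) hv)
    have k4 := norm_clm_apply_le (norm_clm_apply_le (hg.fderiv_fderiv_le _ (hm y hy))
      (norm_clm_apply_le h4 hw)) (norm_clm_apply_le (hΦ.fderiv_le x hx) hv)
    have k5 := norm_clm_apply_le (norm_clm_apply_le (hg.fderiv_fderiv_le _ (hm y hy))
      (norm_clm_apply_le (hΦ.fderiv_le y hy) hw)) (norm_clm_apply_le h4 hv)
    have e : fderiv ℝ g (Φ x) (fderiv ℝ (fderiv ℝ Φ) x w v)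
          + fderiv ℝ (fderiv ℝ g) (Φ x) (fderiv ℝ Φ x w) (fderiv ℝ Φ x v)
        - (fderiv ℝ g (Φ y) (fderiv ℝ (fderiv ℝ Φ) y w v)
          + fderiv ℝ (fderiv ℝ g) (Φ y) (fderiv ℝ Φ y w) (fderiv ℝ Φ y v))
        = (fderiv ℝ g (Φ x) - fderiv ℝ g (Φ y)) (fderiv ℝ (fderiv ℝ Φ) x w v)
          + fderiv ℝ g (Φ y) ((fderiv ℝ (fderiv ℝ Φ) x - fderiv ℝ (fderiv ℝ Φ) y) w v)
          + (fderiv ℝ (fderiv ℝ g) (Φ x) - fderiv ℝ (fderiv ℝ g) (Φ y)) (fderiv ℝ Φ x w)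
            (fderiv ℝ Φ x v)
          + fderiv ℝ (fderiv ℝ g) (Φ y) ((fderiv ℝ Φ x - fderiv ℝ Φ y) w) (fderiv ℝ Φ x v)
          + fderiv ℝ (fderiv ℝ g) (Φ y) (fderiv ℝ Φ y w) ((fderiv ℝ Φ x - fderiv ℝ Φ y) v) := by
      simp only [sub_apply, map_sub]
      abel
    rw [e]
    refine (norm_add_le _ _).trans ((add_le_add ((norm_add_le _ _).trans (add_le_add
      ((norm_add_le _ _).trans (add_le_add ((norm_add_le _ _).trans (add_le_add k1 k2)) k3))
      k4)) k5).trans (le_of_eq ?_))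
    ring

theorem norm_taylor_two_le {g : W → U} (hg : Differentiable ℝ g)
    (hg' : Differentiable ℝ (fderiv ℝ g)) {S : Set W} (hS : Convex ℝ S) {L : ℝ}
    (hlip : ∀ x ∈ S, ∀ y ∈ S, ‖fderiv ℝ (fderiv ℝ g) x - fderiv ℝ (fderiv ℝ g) y‖ ≤ L * ‖x - y‖)
    {x x' : W} (hL : 0 ≤ L) (hx : x ∈ S) (hx' : x' ∈ S) :
    ‖g x' - g x - fderiv ℝ g x (x' - x)
      - (1 / 2 : ℝ) • fderiv ℝ (fderiv ℝ g) x (x' - x) (x' - x)‖ ≤ L * ‖x' - x‖ ^ 3 := by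
  set A := fderiv ℝ (fderiv ℝ g) x with hA
  have hd : ∀ θ ∈ Icc (0 : ℝ) 1, HasDerivWithinAt
      (fun θ : ℝ => g (x + θ • (x' - x)) - θ • fderiv ℝ g x (x' - x)
        - (1 / 2 * θ ^ 2 : ℝ) • A (x' - x) (x' - x))
      (fderiv ℝ g (x + θ • (x' - x)) (x' - x) - fderiv ℝ g x (x' - x) - θ • A (x' - x) (x' - x))
      (Icc 0 1) θ := by
    intro θ _
    have h1 := ((hasDerivAt_id θ).smul_const (fderiv ℝ g x (x' - x)))
    rw [one_smul] at h1
    have h2 : HasDerivAt (fun θ : ℝ => 1 / 2 * θ ^ 2) θ θ := by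
      have h := (hasDerivAt_pow 2 θ).const_mul (1 / 2 : ℝ)
      have e : 1 / 2 * (((2 : ℕ) : ℝ) * θ ^ (2 - 1)) = θ := by norm_num; ring
      rwa [e] at h
    exact (((hasDerivAt_comp_segment hg x x' θ).sub h1).sub
      (h2.smul_const (A (x' - x) (x' - x)))).hasDerivWithinAt
  have := norm_image_sub_le_of_norm_deriv_le_segment_01' (C := L * ‖x' - x‖ ^ 3) hd ?_
  · convert this using 2
    simp only [one_smul, zero_smul, add_zero, add_sub_cancel, sub_zero, one_pow, mul_one, ne_eq,
      OfNat.ofNat_ne_zero, not_false_eq_true, zero_pow, mul_zero]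
    abel
  · intro θ hθ
    have h1 := norm_taylor_one_le hg' hS hlip hL hx (segment_mem hS hx hx' hθ.1 hθ.2)
    rw [add_sub_cancel_left, map_smul, ← hA] at h1
    have e : fderiv ℝ g (x + θ • (x' - x)) (x' - x) - fderiv ℝ g x (x' - x)
        - θ • A (x' - x) (x' - x)
        = (fderiv ℝ g (x + θ • (x' - x)) - fderiv ℝ g x - θ • A (x' - x)) (x' - x) := by
      simp only [sub_apply, smul_apply]
    rw [e]
    refine (norm_clm_apply_le h1 le_rfl).trans ?_
    have h2 : ‖θ • (x' - x)‖ ≤ ‖x' - x‖ := by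
      rw [norm_smul, Real.norm_of_nonneg hθ.1]
      nlinarith [norm_nonneg (x' - x), hθ.2]
    calc L * ‖θ • (x' - x)‖ ^ 2 * ‖x' - x‖ ≤ L * ‖x' - x‖ ^ 2 * ‖x' - x‖ := by gcongr
      _ = _ := by ring

/-- Closed balls are compact in a proper space, so continuity and local Lipschitz continuity become
uniform there. -/
theorem C21On.of_locallyLipschitz [ProperSpace W] {f : W → U} (hf : ContDiff ℝ 2 f)
    (hf' : LocallyLipschitz (iteratedFDeriv ℝ 2 f)) (R : ℝ) :
    ∃ K, 0 ≤ K ∧ C21On (Metric.closedBall 0 R) K f := by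
  rw [show (2 : WithTop ℕ∞) = 1 + 1 by norm_num, contDiff_succ_iff_fderiv] at hf
  obtain ⟨h1, -, h2⟩ := hf
  have h3 := contDiff_one_iff_fderiv.1 h2
  have hcpt : IsCompact (Metric.closedBall (0 : W) R) := isCompact_closedBall _ _
  obtain ⟨K₁, hK₁⟩ := hcpt.exists_bound_of_continuousOn h2.continuous.continuousOn
  obtain ⟨K₂, hK₂⟩ := hcpt.exists_bound_of_continuousOn h3.2.continuousOn
  obtain ⟨K₃, hK₃⟩ := (hf'.locallyLipschitzOn
    (s := Metric.closedBall (0 : W) R)).exists_lipschitzOnWith_of_compact hcpt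
  refine ⟨|K₁| + |K₂| + K₃, by positivity, h1, h3.1, fun x hx => (hK₁ x hx).trans ?_,
    fun x hx => (hK₂ x hx).trans ?_, fun x hx y hy => ?_⟩
  · linarith [le_abs_self K₁, abs_nonneg K₂, K₃.2]
  · linarith [le_abs_self K₂, abs_nonneg K₁, K₃.2]
  · refine norm_le_of_unit (by positivity) fun v w hv hw => ?_
    have h4 := hK₃.dist_le_mul x hx y hy
    rw [dist_eq_norm, dist_eq_norm] at h4
    have h5 := (iteratedFDeriv ℝ 2 f x - iteratedFDeriv ℝ 2 f y).le_opNorm ![w, v]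
    rw [sub_apply, iteratedFDeriv_two_apply, iteratedFDeriv_two_apply] at h5
    simp only [Matrix.cons_val_zero, Matrix.cons_val_one, Fin.prod_univ_two] at h5
    rw [sub_apply, sub_apply]
    refine h5.trans ?_
    have h6 : ‖w‖ * ‖v‖ ≤ 1 := mul_le_one₀ hw (norm_nonneg _) hv
    calc _ ≤ ‖iteratedFDeriv ℝ 2 f x - iteratedFDeriv ℝ 2 f y‖ * 1 := by gcongr
      _ ≤ K₃ * ‖x - y‖ := by rw [mul_one]; exact h4
      _ ≤ _ := by
        gcongr
        linarith [abs_nonneg K₁, abs_nonneg K₂]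

end SecondOrder

/-! ### Uniform bounds on the functions transported by the flow. -/

section Flow

variable {W U : Type} [NormedAddCommGroup W] [NormedSpace ℝ W] [NormedAddCommGroup U]
  [NormedSpace ℝ U] {m : ℕ} {M α T L : ℝ} {μ : W → W} {σ : W → EuclideanSpace ℝ (Fin m) →L[ℝ] W}
  {Z : ℝ → EuclideanSpace ℝ (Fin m)} {ZZ : ℝ → ℝ → Matrix (Fin m) (Fin m) ℝ}

/-- The flow map `Φ` over a time step with `q = h ^ α`, compared with the Euler scheme. -/
structure FlowBound (Z : ℝ → EuclideanSpace ℝ (Fin m))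
    (ZZ : ℝ → ℝ → Matrix (Fin m) (Fin m) ℝ) (μ : W → W)
    (σ : W → EuclideanSpace ℝ (Fin m) →L[ℝ] W) (D q u v : ℝ) (Φ : W → W) : Prop where
  diff : Differentiable ℝ Φ
  diff_fderiv : Differentiable ℝ (fderiv ℝ Φ)
  sub_le : ∀ x, ‖Φ x - x‖ ≤ D * q
  sub_sub_le : ∀ x, ‖Φ x - x - σ x (Z v - Z u)‖ ≤ D * q ^ 2
  sub_eulerStep_le : ∀ x, ‖Φ x - eulerStep Z ZZ μ σ u v x‖ ≤ D * q ^ 3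
  fderiv_sub_le : ∀ x, ‖fderiv ℝ Φ x - ContinuousLinearMap.id ℝ W‖ ≤ D * q
  fderiv_sub_sub_le : ∀ x, ‖fderiv ℝ Φ x - ContinuousLinearMap.id ℝ W
    - (ContinuousLinearMap.apply ℝ W (Z v - Z u)).comp (fderiv ℝ σ x)‖ ≤ D * q ^ 2
  fderiv_fderiv_le : ∀ x, ‖fderiv ℝ (fderiv ℝ Φ) x‖ ≤ D * q
  fderiv_fderiv_lip : ∀ x y,
    ‖fderiv ℝ (fderiv ℝ Φ) x - fderiv ℝ (fderiv ℝ Φ) y‖ ≤ D * ‖x - y‖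

theorem norm_apply_comp_le {V V' V'' : Type} [NormedAddCommGroup V] [NormedSpace ℝ V]
    [NormedAddCommGroup V'] [NormedSpace ℝ V'] [NormedAddCommGroup V''] [NormedSpace ℝ V'']
    (z : V') (A : V →L[ℝ] V' →L[ℝ] V'') :
    ‖(ContinuousLinearMap.apply ℝ V'' z).comp A‖ ≤ ‖A‖ * ‖z‖ := by
  refine ContinuousLinearMap.opNorm_le_bound _ (by positivity) fun v => ?_
  refine (A.le_opNorm₂ v z).trans (le_of_eq (by ring))

theorem IsFlowMap.flowBound (hα : 1 / 3 < α) (hα' : α ≤ 1 / 2) (hZ : RoughBound α T M Z ZZ)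
    (hc : CoefBound univ L μ σ) {C : ℝ} (hC : 0 ≤ C) :
    ∃ D, 0 ≤ D ∧ ∀ u v Φ, 0 ≤ u → u < v → v ≤ T → v - u ≤ 1 → IsFlowMap α Z ZZ μ σ C u v Φ →
      FlowBound Z ZZ μ σ D ((v - u) ^ α) u v Φ := by
  have hL := hc.nonneg
  have hM := hZ.nonneg
  obtain ⟨A, hA⟩ : ∃ A, A = L * M + (L * M + (L + C)) := ⟨_, rfl⟩
  have hA0 : 0 ≤ A := by rw [hA]; positivity
  refine ⟨A + C + L * M, by positivity, fun u v Φ h0 h1 h2 h3 h => ?_⟩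
  have hinc : ∀ x, ‖Φ x - x‖ ≤ A * (v - u) ^ α ∧
      ‖Φ x - x - σ x (Z v - Z u)‖ ≤ A * ((v - u) ^ α) ^ 2 ∧
      ‖Φ x - eulerStep Z ZZ μ σ u v x‖ ≤ C * ((v - u) ^ α) ^ 3 := by
    intro x
    obtain ⟨X, hX, hX', hD⟩ := h.davie x
    have k := hD.increment_le hα hα' hZ hc hC h0 h2 le_rfl h1.le le_rfl h3 (mem_univ _)
    have k' := hD u v le_rfl h1.le le_rfl
    rw [← hA, hX, hX'] at k
    rw [hX, hX'] at k'
    exact ⟨k.1, k.2, k'⟩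
  have hz := hZ.path u v h0 h1.le h2
  have hq0 : 0 ≤ (v - u) ^ α := Real.rpow_nonneg (by linarith) _
  have hq1 : (v - u) ^ α ≤ 1 := Real.rpow_le_one (by linarith) h3 (by linarith)
  have h4 := h.fderiv_sub_le
  have h5 := h.fderiv_fderiv_le
  generalize (v - u) ^ α = q at *
  have hLM : 0 ≤ L * M := by positivity
  refine ⟨h.diff, h.diff_fderiv, fun x => (hinc x).1.trans ?_, fun x => (hinc x).2.1.trans ?_,
    fun x => (hinc x).2.2.trans ?_, fun x => ?_, fun x => (h4 x).trans ?_,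
    fun x => (h5 x).trans ?_, fun x y => (h.fderiv_fderiv_lip x y).trans ?_⟩
  · gcongr; linarith
  · gcongr; linarith
  · gcongr; linarith
  · have k1 := norm_le_norm_sub_add (fderiv ℝ Φ x - ContinuousLinearMap.id ℝ W)
      ((ContinuousLinearMap.apply ℝ W (Z v - Z u)).comp (fderiv ℝ σ x))
    have k2 : ‖fderiv ℝ σ x‖ * ‖Z v - Z u‖ ≤ L * (M * q) :=
      mul_le_mul (hc.norm_fderiv_le x (mem_univ _)) hz (norm_nonneg _) hL
    have k3 := norm_apply_comp_le (Z v - Z u) (fderiv ℝ σ x)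
    have k4 : C * q ^ 2 ≤ C * q := by
      have : C * q * q ≤ C * q * 1 := by gcongr
      linarith
    have k5 : 0 ≤ A * q := by positivity
    linarith [h4 x]
  · gcongr; linarith
  · gcongr; linarith
  · gcongr; linarith

theorem FlowBound.c21On {D q u v : ℝ} (hD : 0 ≤ D) (hq1 : q ≤ 1) {Φ : W → W}
    (h : FlowBound Z ZZ μ σ D q u v Φ) : C21On univ (1 + D) Φ := by
  have hDq : D * q ≤ D := mul_le_of_le_one_right hD hq1
  refine ⟨h.diff, h.diff_fderiv, fun x _ => ?_, fun x _ => ?_, fun x _ y _ => ?_⟩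
  · have := norm_le_norm_sub_add (fderiv ℝ Φ x) (ContinuousLinearMap.id ℝ W)
    linarith [h.fderiv_sub_le x, ContinuousLinearMap.norm_id_le (𝕜 := ℝ) (E := W)]
  · linarith [h.fderiv_fderiv_le x]
  · refine (h.fderiv_fderiv_lip x y).trans ?_
    gcongr
    linarith

theorem C21On.mono_set {B B' : Set W} {K : ℝ} {g : W → U} (h : C21On B K g) (hB : B' ⊆ B) :
    C21On B' K g :=
  ⟨h.diff, h.diff_fderiv, fun x hx => h.fderiv_le x (hB hx),
    fun x hx => h.fderiv_fderiv_le x (hB hx), fun x hx y hy =>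
    h.fderiv_fderiv_lip x (hB hx) y (hB hy)⟩

/-- Backward induction in steps of length `h₀`, writing `F u = F v ∘ Φ`. The number of steps is
bounded by the horizon, hence the constant is uniform in `u`. -/
theorem exists_uniform_c21On {D h₀ : ℝ} (hα : 0 < α) (hD : 0 ≤ D) (h0 : 0 < h₀) (h1 : h₀ ≤ 1)
    {F : ℝ → W → U}
    (hF : ∀ u v, 0 ≤ u → u < v → v ≤ T → v - u ≤ h₀ → ∃ Φ : W → W,
      FlowBound Z ZZ μ σ D ((v - u) ^ α) u v Φ ∧ ∀ x, F u x = F v (Φ x))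
    (hT : ∀ R, ∃ K, 0 ≤ K ∧ C21On (Metric.closedBall 0 R) K (F T)) (R : ℝ) :
    ∃ K, 0 ≤ K ∧ ∀ u, 0 ≤ u → u ≤ T → C21On (Metric.closedBall 0 R) K (F u) := by
  have key : ∀ n : ℕ, ∀ R, ∃ K, 0 ≤ K ∧ ∀ u, 0 ≤ u → u ≤ T → T - u ≤ n * h₀ →
      C21On (Metric.closedBall 0 R) K (F u) := by
    intro n
    induction n with
    | zero =>
      intro R
      obtain ⟨K, hK, h⟩ := hT R
      refine ⟨K, hK, fun u _ h2 h3 => ?_⟩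
      simp only [Nat.cast_zero, zero_mul] at h3
      rwa [show u = T by linarith]
    | succ n ih =>
      intro R
      -- One flow step moves points by at most `D`, so the bound at the later time is needed on the
      -- larger ball.
      obtain ⟨K, hK, h⟩ := ih (R + D)
      obtain ⟨K₀, hK₀, h'⟩ := hT R
      set E := K * ((1 + D) + 3 * (1 + D) ^ 2 + (1 + D) ^ 3) with hE
      have hE0 : 0 ≤ E := by positivity
      refine ⟨E + K₀, by positivity, fun u hu huT hn => ?_⟩
      rcases huT.eq_or_lt with rfl | huT
      · exact h'.mono (by linarith)
      obtain ⟨v, hv⟩ : ∃ v, v = min T (u + h₀) := ⟨_, rfl⟩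
      have k1 : v ≤ T := hv ▸ min_le_left _ _
      have k2 : v ≤ u + h₀ := hv ▸ min_le_right _ _
      have k3 : u < v := hv ▸ lt_min huT (by linarith)
      have k4 : T - v ≤ n * h₀ := by
        push_cast at hn
        have : 0 ≤ n * h₀ := by positivity
        rw [hv]
        rcases min_choice T (u + h₀) with e | e <;> rw [e] <;> linarith
      obtain ⟨Φ, hΦ, hFΦ⟩ := hF u v hu k3 k1 (by linarith)
      have hq1 : (v - u) ^ α ≤ 1 := Real.rpow_le_one (by linarith) (by linarith) hα.le
      have e : F u = fun x => F v (Φ x) := funext hFΦ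
      rw [e]
      refine ((h v (by linarith) k1 k4).comp (convex_closedBall _ _) (convex_closedBall _ _) hK
        (by positivity) ((hΦ.c21On hD hq1).mono_set (subset_univ (Metric.closedBall 0 R)))
        fun x hx => ?_).mono (by linarith)
      rw [mem_closedBall_zero_iff] at hx ⊢
      have := norm_le_norm_sub_add (Φ x) x
      have h5 := hΦ.sub_le x
      have : D * (v - u) ^ α ≤ D := mul_le_of_le_one_right hD hq1
      linarith
  obtain ⟨n, hn⟩ := exists_nat_ge (T / h₀)
  obtain ⟨K, hK, h⟩ := key n R
  refine ⟨K, hK, fun u hu huT => h u hu huT ?_⟩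
  have := (div_le_iff₀ h0).1 hn
  linarith

end Flow

/-! ### Calculus of orders, Hölder paths and controlled paths. -/

section BigOh

variable {E E' E'' : Type} [NormedAddCommGroup E] [NormedSpace ℝ E] [NormedAddCommGroup E']
  [NormedSpace ℝ E'] [NormedAddCommGroup E''] [NormedSpace ℝ E''] {α T h₀ : ℝ} {m : ℕ}

/-- `f u v = O((v - u) ^ (n α))` on the time steps of length at most `h₀` in `[0, T]`. -/
def IsOrd (α T h₀ : ℝ) (n : ℕ) (f : ℝ → ℝ → E) : Prop :=
  ∃ K, 0 ≤ K ∧ ∀ u v, 0 ≤ u → u < v → v ≤ T → v - u ≤ h₀ → ‖f u v‖ ≤ K * ((v - u) ^ α) ^ n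

/-- `f` is bounded and `α`-Hölder continuous on `[0, T]`. -/
def IsHolder (α T : ℝ) (f : ℝ → E) : Prop :=
  ∃ C, 0 ≤ C ∧ (∀ r, 0 ≤ r → r ≤ T → ‖f r‖ ≤ C) ∧
    ∀ u v, 0 ≤ u → u ≤ v → v ≤ T → ‖f v - f u‖ ≤ C * (v - u) ^ α

theorem IsOrd.congr {n : ℕ} {f g : ℝ → ℝ → E} (hf : IsOrd α T h₀ n f)
    (h : ∀ u v, 0 ≤ u → u < v → v ≤ T → v - u ≤ h₀ → g u v = f u v) : IsOrd α T h₀ n g := by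
  obtain ⟨K, hK, hf⟩ := hf
  exact ⟨K, hK, fun u v h1 h2 h3 h4 => by rw [h u v h1 h2 h3 h4]; exact hf u v h1 h2 h3 h4⟩

theorem IsOrd.add {n : ℕ} {f g : ℝ → ℝ → E} (hf : IsOrd α T h₀ n f) (hg : IsOrd α T h₀ n g) :
    IsOrd α T h₀ n fun u v => f u v + g u v := by
  obtain ⟨K, hK, hf⟩ := hf
  obtain ⟨K', hK', hg⟩ := hg
  refine ⟨K + K', by positivity, fun u v h1 h2 h3 h4 => ?_⟩
  rw [add_mul]
  exact (norm_add_le _ _).trans (add_le_add (hf u v h1 h2 h3 h4) (hg u v h1 h2 h3 h4))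

theorem IsOrd.neg {n : ℕ} {f : ℝ → ℝ → E} (hf : IsOrd α T h₀ n f) :
    IsOrd α T h₀ n fun u v => -f u v := by
  obtain ⟨K, hK, hf⟩ := hf
  exact ⟨K, hK, fun u v h1 h2 h3 h4 => by rw [norm_neg]; exact hf u v h1 h2 h3 h4⟩

theorem IsOrd.sub {n : ℕ} {f g : ℝ → ℝ → E} (hf : IsOrd α T h₀ n f) (hg : IsOrd α T h₀ n g) :
    IsOrd α T h₀ n fun u v => f u v - g u v := by
  simpa only [sub_eq_add_neg] using hf.add hg.neg

theorem IsOrd.mono (hα : 0 < α) (h1 : h₀ ≤ 1) {n k : ℕ} (hk : k ≤ n) {f : ℝ → ℝ → E}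
    (hf : IsOrd α T h₀ n f) : IsOrd α T h₀ k f := by
  obtain ⟨K, hK, hf⟩ := hf
  refine ⟨K, hK, fun u v k1 k2 k3 k4 => (hf u v k1 k2 k3 k4).trans ?_⟩
  have hq0 : 0 ≤ (v - u) ^ α := Real.rpow_nonneg (by linarith) _
  have hq1 : (v - u) ^ α ≤ 1 := Real.rpow_le_one (by linarith) (by linarith) hα.le
  exact mul_le_mul_of_nonneg_left (pow_le_pow_of_le_one hq0 hq1 hk) hK

theorem IsOrd.bilin (b : E →L[ℝ] E' →L[ℝ] E'') {n k : ℕ} {f : ℝ → ℝ → E} {g : ℝ → ℝ → E'}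
    (hf : IsOrd α T h₀ n f) (hg : IsOrd α T h₀ k g) :
    IsOrd α T h₀ (n + k) fun u v => b (f u v) (g u v) := by
  obtain ⟨K, hK, hf⟩ := hf
  obtain ⟨K', hK', hg⟩ := hg
  refine ⟨‖b‖ * K * K', by positivity, fun u v h1 h2 h3 h4 => ?_⟩
  have hq0 : 0 ≤ (v - u) ^ α := Real.rpow_nonneg (by linarith) _
  have h5 := hf u v h1 h2 h3 h4
  have h6 := hg u v h1 h2 h3 h4
  calc ‖b (f u v) (g u v)‖ ≤ ‖b‖ * ‖f u v‖ * ‖g u v‖ := b.le_opNorm₂ _ _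
    _ ≤ ‖b‖ * (K * ((v - u) ^ α) ^ n) * (K' * ((v - u) ^ α) ^ k) := by gcongr
    _ = _ := by rw [pow_add]; ring

theorem IsOrd.apply {n k : ℕ} {A : ℝ → ℝ → E →L[ℝ] E'} {g : ℝ → ℝ → E}
    (hA : IsOrd α T h₀ n A) (hg : IsOrd α T h₀ k g) :
    IsOrd α T h₀ (n + k) fun u v => A u v (g u v) :=
  IsOrd.bilin (ContinuousLinearMap.id ℝ (E →L[ℝ] E')) hA hg

theorem IsOrd.comp {n k : ℕ} {A : ℝ → ℝ → E' →L[ℝ] E''} {B : ℝ → ℝ → E →L[ℝ] E'}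
    (hA : IsOrd α T h₀ n A) (hB : IsOrd α T h₀ k B) :
    IsOrd α T h₀ (n + k) fun u v => (A u v).comp (B u v) :=
  IsOrd.bilin (ContinuousLinearMap.compL ℝ E E' E'') hA hB

theorem IsOrd.const_smul (c : ℝ) {n : ℕ} {f : ℝ → ℝ → E} (hf : IsOrd α T h₀ n f) :
    IsOrd α T h₀ n fun u v => c • f u v := by
  obtain ⟨K, hK, hf⟩ := hf
  refine ⟨|c| * K, by positivity, fun u v h1 h2 h3 h4 => ?_⟩
  rw [norm_smul, Real.norm_eq_abs, mul_assoc]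
  exact mul_le_mul_of_nonneg_left (hf u v h1 h2 h3 h4) (abs_nonneg c)

/-- A factor of time counts as two orders, by `le_rpow_sq`. -/
theorem IsOrd.time_smul (hα' : α ≤ 1 / 2) (h1 : h₀ ≤ 1) {n : ℕ} {f : ℝ → ℝ → E}
    (hf : IsOrd α T h₀ n f) : IsOrd α T h₀ (2 + n) fun u v => (v - u) • f u v := by
  obtain ⟨K, hK, hf⟩ := hf
  refine ⟨K, hK, fun u v k1 k2 k3 k4 => ?_⟩
  rw [norm_smul, Real.norm_of_nonneg (by linarith)]
  have k5 := le_rpow_sq hα' (show 0 ≤ v - u by linarith) (by linarith)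
  calc (v - u) * ‖f u v‖ ≤ ((v - u) ^ α) ^ 2 * (K * ((v - u) ^ α) ^ n) :=
        mul_le_mul k5 (hf u v k1 k2 k3 k4) (norm_nonneg _) (by positivity)
    _ = _ := by rw [pow_add]; ring

theorem IsOrd.contract {M : ℝ} {Z : ℝ → EuclideanSpace ℝ (Fin m)}
    {ZZ : ℝ → ℝ → Matrix (Fin m) (Fin m) ℝ} (hZ : RoughBound α T M Z ZZ) {n : ℕ}
    {A : ℝ → ℝ → EuclideanSpace ℝ (Fin m) →L[ℝ] EuclideanSpace ℝ (Fin m) →L[ℝ] E}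
    (hA : IsOrd α T h₀ n A) : IsOrd α T h₀ (n + 2) fun u v => contract (A u v) (ZZ u v) := by
  obtain ⟨K, hK, hf⟩ := hA
  refine ⟨K * M, mul_nonneg hK hZ.nonneg, fun u v k1 k2 k3 k4 => ?_⟩
  have hq0 : 0 ≤ (v - u) ^ α := Real.rpow_nonneg (by linarith) _
  calc _ ≤ ‖A u v‖ * ∑ i, ∑ j, |ZZ u v i j| := norm_contract_le _ _
    _ ≤ (K * ((v - u) ^ α) ^ n) * (M * ((v - u) ^ α) ^ 2) :=
      mul_le_mul (hf u v k1 k2 k3 k4) (hZ.area u v k1 k2.le k3) (by positivity) (by positivity)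
    _ = _ := by rw [pow_add]; ring

theorem RoughBound.isOrd {M : ℝ} {Z : ℝ → EuclideanSpace ℝ (Fin m)}
    {ZZ : ℝ → ℝ → Matrix (Fin m) (Fin m) ℝ} (hZ : RoughBound α T M Z ZZ) :
    IsOrd α T h₀ 1 fun u v => Z v - Z u :=
  ⟨M, hZ.nonneg, fun u v h1 h2 h3 _ => by rw [pow_one]; exact hZ.path u v h1 h2.le h3⟩

theorem IsHolder.left {f : ℝ → E} (hf : IsHolder α T f) : IsOrd α T h₀ 0 fun u _ => f u := by
  obtain ⟨C, hC, h1, -⟩ := hf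
  exact ⟨C, hC, fun u v k1 k2 k3 _ => by rw [pow_zero, mul_one]; exact h1 u k1 (k2.le.trans k3)⟩

theorem IsHolder.increment {f : ℝ → E} (hf : IsHolder α T f) :
    IsOrd α T h₀ 1 fun u v => f v - f u := by
  obtain ⟨C, hC, -, h2⟩ := hf
  exact ⟨C, hC, fun u v k1 k2 k3 _ => by rw [pow_one]; exact h2 u v k1 k2.le k3⟩

/-- Over steps longer than `h₀` boundedness alone is enough, at the price of dividing by `h₀ ^ α`.
-/
theorem IsHolder.of_local (hα : 0 < α) (h0 : 0 < h₀) {f : ℝ → E} {C : ℝ}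
    (hb : ∀ r, 0 ≤ r → r ≤ T → ‖f r‖ ≤ C) (hf : IsOrd α T h₀ 1 fun u v => f v - f u) :
    IsHolder α T f := by
  obtain ⟨K, hK, hf⟩ := hf
  refine ⟨|C| + K + 2 * |C| / h₀ ^ α, by positivity, fun r h1 h2 => ?_, fun u v h1 h2 h3 => ?_⟩
  · have : 0 ≤ K + 2 * |C| / h₀ ^ α := by positivity
    linarith [hb r h1 h2, le_abs_self C]
  · have hq0 : 0 ≤ (v - u) ^ α := Real.rpow_nonneg (by linarith) _
    rcases h2.eq_or_lt with rfl | h2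
    · rw [sub_self, norm_zero]
      positivity
    rcases le_or_gt (v - u) h₀ with h4 | h4
    · have h5 := hf u v h1 h2 h3 h4
      rw [pow_one] at h5
      refine h5.trans ?_
      gcongr
      have : 0 ≤ |C| + 2 * |C| / h₀ ^ α := by positivity
      linarith
    · have h5 : 2 * |C| ≤ 2 * |C| / h₀ ^ α * (v - u) ^ α := by
        rw [div_mul_eq_mul_div, le_div_iff₀ (by positivity)]
        gcongr
      have h6 := norm_sub_le (f v) (f u)
      have h7 := hb u h1 (by linarith)
      have h8 := hb v (by linarith) h3
      have h9 : 0 ≤ (|C| + K) * (v - u) ^ α := by positivity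
      rw [add_mul]
      linarith [le_abs_self C]

theorem IsHolder.add {f g : ℝ → E} (hf : IsHolder α T f) (hg : IsHolder α T g) :
    IsHolder α T fun r => f r + g r := by
  obtain ⟨C, hC, h1, h2⟩ := hf
  obtain ⟨D, hD, h3, h4⟩ := hg
  refine ⟨C + D, by positivity, fun r k1 k2 => (norm_add_le _ _).trans
    (add_le_add (h1 r k1 k2) (h3 r k1 k2)), fun u v k1 k2 k3 => ?_⟩
  rw [add_sub_add_comm, add_mul]
  exact (norm_add_le _ _).trans (add_le_add (h2 u v k1 k2 k3) (h4 u v k1 k2 k3))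

theorem IsHolder.neg {f : ℝ → E} (hf : IsHolder α T f) : IsHolder α T fun r => -f r := by
  obtain ⟨C, hC, h1, h2⟩ := hf
  refine ⟨C, hC, fun r k1 k2 => by rw [norm_neg]; exact h1 r k1 k2, fun u v k1 k2 k3 => ?_⟩
  rw [neg_sub_neg, norm_sub_rev]
  exact h2 u v k1 k2 k3

theorem IsHolder.sub {f g : ℝ → E} (hf : IsHolder α T f) (hg : IsHolder α T g) :
    IsHolder α T fun r => f r - g r := by
  simpa only [sub_eq_add_neg] using hf.add hg.neg

theorem IsHolder.bilin (b : E →L[ℝ] E' →L[ℝ] E'') {f : ℝ → E} {g : ℝ → E'}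
    (hf : IsHolder α T f) (hg : IsHolder α T g) : IsHolder α T fun r => b (f r) (g r) := by
  obtain ⟨C, hC, h1, h2⟩ := hf
  obtain ⟨D, hD, h3, h4⟩ := hg
  refine ⟨2 * (‖b‖ * C * D), by positivity, fun r k1 k2 => ?_, fun u v k1 k2 k3 => ?_⟩
  · have h5 : ‖b‖ * ‖f r‖ * ‖g r‖ ≤ ‖b‖ * C * D := by
      gcongr
      exacts [h1 r k1 k2, h3 r k1 k2]
    have h6 : 0 ≤ ‖b‖ * C * D := by positivity
    linarith [b.le_opNorm₂ (f r) (g r)]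
  · have hq0 : 0 ≤ (v - u) ^ α := Real.rpow_nonneg (by linarith) _
    have e : b (f v) (g v) - b (f u) (g u) = b (f v - f u) (g v) + b (f u) (g v - g u) := by
      simp only [map_sub, sub_apply]; abel
    rw [e]
    refine (norm_add_le _ _).trans ?_
    have h5 : ‖b (f v - f u) (g v)‖ ≤ ‖b‖ * (C * (v - u) ^ α) * D :=
      (b.le_opNorm₂ _ _).trans (by
        gcongr
        exacts [h2 u v k1 k2 k3, h3 v (k1.trans k2) k3])
    have h6 : ‖b (f u) (g v - g u)‖ ≤ ‖b‖ * C * (D * (v - u) ^ α) :=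
      (b.le_opNorm₂ _ _).trans (by
        gcongr
        exacts [h1 u k1 (k2.trans k3), h4 u v k1 k2 k3])
    linarith

theorem IsHolder.flip {f : ℝ → E →L[ℝ] E' →L[ℝ] E''} (hf : IsHolder α T f) :
    IsHolder α T fun r => (f r).flip := by
  obtain ⟨C, hC, h1, h2⟩ := hf
  refine ⟨C, hC, fun r k1 k2 => ?_, fun u v k1 k2 k3 => ?_⟩
  · rw [ContinuousLinearMap.opNorm_flip]
    exact h1 r k1 k2
  · have e : (f v).flip - (f u).flip = (f v - f u).flip := rfl
    rw [e, ContinuousLinearMap.opNorm_flip]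
    exact h2 u v k1 k2 k3

theorem IsHolder.lipschitz {g : E → E'} (hg : BddLip univ g) {f : ℝ → E}
    (hf : IsHolder α T f) : IsHolder α T fun r => g (f r) := by
  obtain ⟨C, hC, h1, h2⟩ := hf
  obtain ⟨D, hD, h3, h4⟩ := hg
  refine ⟨D + D * C, by positivity, fun r _ _ => (h3 _ (mem_univ _)).trans
    (le_add_of_nonneg_right (by positivity)), fun u v k1 k2 k3 => ?_⟩
  have hq0 : 0 ≤ (v - u) ^ α := Real.rpow_nonneg (by linarith) _
  have h5 := mul_le_mul_of_nonneg_left (h2 u v k1 k2 k3) hD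
  have h6 := h4 (f v) (mem_univ _) (f u) (mem_univ _)
  have h7 : 0 ≤ D * (v - u) ^ α := by positivity
  linarith

theorem IsHolder.continuousOn (hα : 0 < α) {f : ℝ → E} (hf : IsHolder α T f) :
    ContinuousOn f (Icc 0 T) := by
  obtain ⟨C, -, -, h⟩ := hf
  exact continuousOn_of_holder hα h

variable {Z : ℝ → EuclideanSpace ℝ (Fin m)}

/-- `(A, A')` is `Z`-controlled on `[0, T]`, with the remainder estimated on short time steps. -/
structure IsLocCtrl (α T h₀ : ℝ) (Z : ℝ → EuclideanSpace ℝ (Fin m)) (A : ℝ → E)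
    (A' : ℝ → EuclideanSpace ℝ (Fin m) →L[ℝ] E) : Prop where
  holder : IsHolder α T A
  holder_deriv : IsHolder α T A'
  expansion : IsOrd α T h₀ 2 fun u v => A v - A u - A' u (Z v - Z u)

theorem IsLocCtrl.sub {A B : ℝ → E} {A' B' : ℝ → EuclideanSpace ℝ (Fin m) →L[ℝ] E}
    (hA : IsLocCtrl α T h₀ Z A A') (hB : IsLocCtrl α T h₀ Z B B') :
    IsLocCtrl α T h₀ Z (fun r => A r - B r) (fun r => A' r - B' r) := by
  refine ⟨hA.holder.sub hB.holder, hA.holder_deriv.sub hB.holder_deriv,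
    (hA.expansion.sub hB.expansion).congr fun u v _ _ _ _ => ?_⟩
  simp only [sub_apply]
  abel

/-- Product rule: the product of the two increments is already of second order, so the remainder is
that term plus the two individual remainders. -/
theorem IsLocCtrl.bilin (b : E →L[ℝ] E' →L[ℝ] E'') {A : ℝ → E} {B : ℝ → E'}
    {A' : ℝ → EuclideanSpace ℝ (Fin m) →L[ℝ] E} {B' : ℝ → EuclideanSpace ℝ (Fin m) →L[ℝ] E'}
    (hA : IsLocCtrl α T h₀ Z A A') (hB : IsLocCtrl α T h₀ Z B B') :
    IsLocCtrl α T h₀ Z (fun r => b (A r) (B r))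
      (fun r => (b.flip (B r)).comp (A' r) + (b (A r)).comp (B' r)) := by
  refine ⟨hA.holder.bilin b hB.holder, IsHolder.add ?_ ?_, ?_⟩
  · exact (IsHolder.bilin ((ContinuousLinearMap.compL ℝ (EuclideanSpace ℝ (Fin m)) E E'').comp
      b.flip) hB.holder hA.holder_deriv)
  · exact (IsHolder.bilin ((ContinuousLinearMap.compL ℝ (EuclideanSpace ℝ (Fin m)) E' E'').comp
      b) hA.holder hB.holder_deriv)
  · have h1 := IsOrd.bilin b hA.holder.increment (h₀ := h₀) hB.holder.increment
    have h2 := IsOrd.bilin b hA.expansion hB.holder.left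
    have h3 := IsOrd.bilin b hA.holder.left hB.expansion
    refine ((h1.add h2).add h3).congr fun u v _ _ _ _ => ?_
    simp only [map_sub, sub_apply, add_apply, ContinuousLinearMap.comp_apply,
      ContinuousLinearMap.flip_apply]
    abel

theorem IsLocCtrl.isControlled {M : ℝ} {ZZ : ℝ → ℝ → Matrix (Fin m) (Fin m) ℝ} (hα : 0 < α)
    (h0 : 0 < h₀) (hZ : RoughBound α T M Z ZZ) {A : ℝ → E}
    {A' : ℝ → EuclideanSpace ℝ (Fin m) →L[ℝ] E} (hA : IsLocCtrl α T h₀ Z A A') :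
    IsControlled α 0 T Z A A' := by
  obtain ⟨K, hK, h1⟩ := hA.expansion
  obtain ⟨C, hC, h2, h3⟩ := hA.holder
  obtain ⟨D, hD, h4, h5⟩ := hA.holder_deriv
  have hM := hZ.nonneg
  refine ⟨⟨K + (C + D * M) / h₀ ^ α, fun u v k1 k2 k3 => ?_⟩,
    ⟨D, fun u v k1 k2 k3 => h5 u v k1 k2.le k3⟩⟩
  have hq0 : 0 ≤ (v - u) ^ α := Real.rpow_nonneg (by linarith) _
  rw [rpow_sq α (by linarith)]
  rcases le_or_gt (v - u) h₀ with k4 | k4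
  · refine (h1 u v k1 k2 k3 k4).trans ?_
    gcongr
    have : 0 ≤ (C + D * M) / h₀ ^ α := by positivity
    linarith
  · have h6 : h₀ ^ α ≤ (v - u) ^ α := Real.rpow_le_rpow h0.le k4.le hα.le
    have h7 := norm_sub_le (A v - A u) (A' u (Z v - Z u))
    have h8 := h3 u v k1 k2.le k3
    have h9 := norm_clm_apply_le (h4 u k1 (by linarith)) (hZ.path u v k1 k2.le k3)
    have h10 : (C + D * M) * (v - u) ^ α ≤ (C + D * M) / h₀ ^ α * ((v - u) ^ α) ^ 2 := by
      rw [div_mul_eq_mul_div, le_div_iff₀ (by positivity), pow_two, ← mul_assoc]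
      gcongr
    have h11 : 0 ≤ K * ((v - u) ^ α) ^ 2 := by positivity
    rw [add_mul]
    linarith

end BigOh

/-! ### The operator `Γ` and the contracted Gubinelli derivative. -/

section GammaCalculus

variable {W U : Type} [NormedAddCommGroup W] [NormedSpace ℝ W] [NormedAddCommGroup U]
  [NormedSpace ℝ U] {m : ℕ} {α T : ℝ} {σ : W → EuclideanSpace ℝ (Fin m) →L[ℝ] W}
  {Z : ℝ → EuclideanSpace ℝ (Fin m)} {ZZ : ℝ → ℝ → Matrix (Fin m) (Fin m) ℝ}

theorem hasFDerivAt_gammaOp_of {G : W → U} (hG' : Differentiable ℝ (fderiv ℝ G))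
    (hσ : Differentiable ℝ σ) (x : W) :
    HasFDerivAt (gammaOp σ G)
      ((ContinuousLinearMap.compL ℝ (EuclideanSpace ℝ (Fin m)) W U).precompR W (fderiv ℝ G x)
          (fderiv ℝ σ x)
        + (ContinuousLinearMap.compL ℝ (EuclideanSpace ℝ (Fin m)) W U).precompL W
          (fderiv ℝ (fderiv ℝ G) x) (σ x)) x :=
  (ContinuousLinearMap.compL ℝ (EuclideanSpace ℝ (Fin m)) W U).hasFDerivAt_of_bilinear
    (hG' x).hasFDerivAt (hσ x).hasFDerivAt

theorem fderiv_gammaOp_apply {G : W → U} (hG' : Differentiable ℝ (fderiv ℝ G))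
    (hσ : Differentiable ℝ σ) (x w : W) (η : EuclideanSpace ℝ (Fin m)) :
    fderiv ℝ (gammaOp σ G) x w η
      = fderiv ℝ G x (fderiv ℝ σ x w η) + fderiv ℝ (fderiv ℝ G) x w (σ x η) := by
  rw [(hasFDerivAt_gammaOp_of hG' hσ x).fderiv]
  simp [ContinuousLinearMap.precompR_apply, ContinuousLinearMap.precompL_apply]

theorem fderiv_fderiv_symm {G : W → U} (hG : Differentiable ℝ G)
    (hG' : Differentiable ℝ (fderiv ℝ G)) (x v w : W) :
    fderiv ℝ (fderiv ℝ G) x v w = fderiv ℝ (fderiv ℝ G) x w v :=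
  second_derivative_symmetric (fun y => (hG y).hasFDerivAt) (hG' x).hasFDerivAt v w

theorem IsWeaklyGeometricRoughPath.contract_symm (hZ : IsWeaklyGeometricRoughPath α T Z ZZ)
    {A : EuclideanSpace ℝ (Fin m) →L[ℝ] EuclideanSpace ℝ (Fin m) →L[ℝ] U}
    (hA : ∀ v w, A v w = A w v) {u v : ℝ} (h0 : 0 ≤ u) (h1 : u ≤ v) (h2 : v ≤ T) :
    contract A (ZZ u v) = (1 / 2 : ℝ) • A (Z v - Z u) (Z v - Z u) := by
  have h := hZ.contract_add_flip A h0 h1 h2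
  have e : A.flip = A := by
    ext v w
    exact hA w v
  rw [e, ← two_smul ℝ] at h
  rw [← h, smul_smul]
  norm_num

/-- Adding a bilinear map to its transpose removes the area. Thus the pair of terms in `D(ΓF) Y'`
becomes its value at `Z v - Z u`, and `(Γ²F)ᵀ` becomes such a value minus the contraction of `Γ²F`;
the two values combine into the term with `Y' - σ`. Finally `Γ²F` is `DF` on `Γσ` plus the symmetric
form `D²F(σ, σ)`, which contributes the last half square. -/
theorem contract_agIntegrandDeriv (hZ : IsWeaklyGeometricRoughPath α T Z ZZ)
    (hσ : Differentiable ℝ σ) {F : ℝ → W → U} {Y : ℝ → W}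
    {Y' : ℝ → EuclideanSpace ℝ (Fin m) →L[ℝ] W}
    {Y'' : ℝ → EuclideanSpace ℝ (Fin m) →L[ℝ] EuclideanSpace ℝ (Fin m) →L[ℝ] W} {u v : ℝ}
    (hF : Differentiable ℝ (F u)) (hF' : Differentiable ℝ (fderiv ℝ (F u)))
    (h0 : 0 ≤ u) (h1 : u ≤ v) (h2 : v ≤ T) :
    contract (agIntegrandDeriv σ F Y Y' Y'' u) (ZZ u v)
      = fderiv ℝ (F u) (Y u) (contract (Y'' u) (ZZ u v) - contract (gammaOp σ σ (Y u)) (ZZ u v))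
        - fderiv ℝ (gammaOp σ (F u)) (Y u) ((Y' u - σ (Y u)) (Z v - Z u)) (Z v - Z u)
        + (1 / 2 : ℝ) • fderiv ℝ (fderiv ℝ (F u)) (Y u) (Y' u (Z v - Z u)) (Y' u (Z v - Z u))
        - (1 / 2 : ℝ) • fderiv ℝ (fderiv ℝ (F u)) (Y u) (σ (Y u) (Z v - Z u))
          (σ (Y u) (Z v - Z u)) := by
  have hsym := fderiv_fderiv_symm hF hF' (Y u)
  have c1 : contract ((ContinuousLinearMap.compL ℝ (EuclideanSpace ℝ (Fin m)) W U
      (fderiv ℝ (F u) (Y u))).comp (Y'' u)) (ZZ u v)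
      = fderiv ℝ (F u) (Y u) (contract (Y'' u) (ZZ u v)) :=
    contract_map _ (fun _ _ => rfl) _
  have c2 := hZ.contract_add_flip (gammaOp σ (gammaOp σ (F u)) (Y u)) h0 h1 h2
  have c3 := hZ.contract_add_flip ((fderiv ℝ (gammaOp σ (F u)) (Y u)).comp (Y' u)) h0 h1 h2
  have c4 := hZ.contract_symm (A := (fderiv ℝ (fderiv ℝ (F u)) (Y u)).bilinearComp (Y' u) (Y' u))
    (fun _ _ => hsym _ _) h0 h1 h2
  have c5 := hZ.contract_symm
    (A := (fderiv ℝ (fderiv ℝ (F u)) (Y u)).bilinearComp (σ (Y u)) (σ (Y u)))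
    (fun _ _ => hsym _ _) h0 h1 h2
  have c6 : gammaOp σ (gammaOp σ (F u)) (Y u)
      = (ContinuousLinearMap.compL ℝ (EuclideanSpace ℝ (Fin m)) W U
        (fderiv ℝ (F u) (Y u))).comp (gammaOp σ σ (Y u))
        + (fderiv ℝ (fderiv ℝ (F u)) (Y u)).bilinearComp (σ (Y u)) (σ (Y u)) := by
    ext ζ η
    exact fderiv_gammaOp_apply hF' hσ _ _ _
  have c7 : contract (gammaOp σ (gammaOp σ (F u)) (Y u)) (ZZ u v)
      = fderiv ℝ (F u) (Y u) (contract (gammaOp σ σ (Y u)) (ZZ u v))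
        + (1 / 2 : ℝ) • fderiv ℝ (fderiv ℝ (F u)) (Y u) (σ (Y u) (Z v - Z u))
          (σ (Y u) (Z v - Z u)) := by
    rw [c6, contract_add, c5]
    congr 1
    exact contract_map _ (fun _ _ => rfl) _
  rw [agIntegrandDeriv, contract_add, contract_sub, contract_sub, contract_add, c1, c4,
    eq_sub_iff_add_eq'.2 c2, eq_sub_iff_add_eq'.2 c3, c7]
  simp only [map_sub, sub_apply, ContinuousLinearMap.comp_apply,
    ContinuousLinearMap.bilinearComp_apply, gammaOp]
  abel

end GammaCalculus

/-! ### Expansions of a transported family in space and in time. -/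

section Expansion

variable {W U : Type} [NormedAddCommGroup W] [NormedSpace ℝ W] [NormedAddCommGroup U]
  [NormedSpace ℝ U] {m : ℕ} {M α T L h₀ D : ℝ} {μ : W → W}
  {σ : W → EuclideanSpace ℝ (Fin m) →L[ℝ] W}
  {Z : ℝ → EuclideanSpace ℝ (Fin m)} {ZZ : ℝ → ℝ → Matrix (Fin m) (Fin m) ℝ}

theorem IsOrd.of_le {E : Type} [NormedAddCommGroup E] [NormedSpace ℝ E] {n : ℕ} {K : ℝ}
    (hK : 0 ≤ K) {f : ℝ → ℝ → E}
    (h : ∀ u v, 0 ≤ u → u < v → v ≤ T → v - u ≤ h₀ → ‖f u v‖ ≤ K * ((v - u) ^ α) ^ n) :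
    IsOrd α T h₀ n f := ⟨K, hK, h⟩

theorem IsOrd.clm_comp {E E' E'' E₀ : Type} [NormedAddCommGroup E] [NormedSpace ℝ E]
    [NormedAddCommGroup E'] [NormedSpace ℝ E'] [NormedAddCommGroup E''] [NormedSpace ℝ E'']
    [NormedAddCommGroup E₀] [NormedSpace ℝ E₀] (b : E →L[ℝ] E' →L[ℝ] E'') {n k : ℕ}
    {f : ℝ → ℝ → E} {g : ℝ → ℝ → E₀ →L[ℝ] E'} (hf : IsOrd α T h₀ n f) (hg : IsOrd α T h₀ k g) :
    IsOrd α T h₀ (n + k) fun u v => (b (f u v)).comp (g u v) :=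
  IsOrd.bilin ((ContinuousLinearMap.compL ℝ E₀ E' E'').comp b) hf hg

/-- A family of functions transported by the flow maps `Φ` of a rough differential equation. -/
structure IsTransported (α T h₀ D : ℝ) (Z : ℝ → EuclideanSpace ℝ (Fin m))
    (ZZ : ℝ → ℝ → Matrix (Fin m) (Fin m) ℝ) (μ : W → W)
    (σ : W → EuclideanSpace ℝ (Fin m) →L[ℝ] W) (Φ : ℝ → ℝ → W → W) (F : ℝ → W → U) : Prop where
  nonneg : 0 ≤ D
  flow : ∀ u v, 0 ≤ u → u < v → v ≤ T → v - u ≤ h₀ →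
    FlowBound Z ZZ μ σ D ((v - u) ^ α) u v (Φ u v)
  comp : ∀ u v, 0 ≤ u → u < v → v ≤ T → v - u ≤ h₀ → F u = fun x => F v (Φ u v x)
  c21 : ∀ R, ∃ K, 0 ≤ K ∧ ∀ u, 0 ≤ u → u ≤ T → C21On (Metric.closedBall 0 R) K (F u)

variable {Φ : ℝ → ℝ → W → W} {F : ℝ → W → U}

theorem IsTransported.diff (h : IsTransported α T h₀ D Z ZZ μ σ Φ F) {u : ℝ} (h0 : 0 ≤ u)
    (hT : u ≤ T) : Differentiable ℝ (F u) :=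
  ((h.c21 0).choose_spec.2 u h0 hT).diff

theorem IsTransported.diff_fderiv (h : IsTransported α T h₀ D Z ZZ μ σ Φ F) {u : ℝ} (h0 : 0 ≤ u)
    (hT : u ≤ T) : Differentiable ℝ (fderiv ℝ (F u)) :=
  ((h.c21 0).choose_spec.2 u h0 hT).diff_fderiv

/-- Taylor expansions of the functions `F v` between two nearby points. -/
structure TaylorOrd (α T h₀ : ℝ) (F : ℝ → W → U) (p p' : ℝ → ℝ → W) : Prop where
  fderiv_zero : IsOrd α T h₀ 0 fun u v => fderiv ℝ (F v) (p u v)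
  fderiv_zero' : IsOrd α T h₀ 0 fun u v => fderiv ℝ (F v) (p' u v)
  hess_zero : IsOrd α T h₀ 0 fun u v => fderiv ℝ (fderiv ℝ (F v)) (p u v)
  fderiv_one : IsOrd α T h₀ 1 fun u v => fderiv ℝ (F v) (p' u v) - fderiv ℝ (F v) (p u v)
  hess_one : IsOrd α T h₀ 1 fun u v =>
    fderiv ℝ (fderiv ℝ (F v)) (p' u v) - fderiv ℝ (fderiv ℝ (F v)) (p u v)
  fderiv_two : IsOrd α T h₀ 2 fun u v => fderiv ℝ (F v) (p' u v) - fderiv ℝ (F v) (p u v)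
    - fderiv ℝ (fderiv ℝ (F v)) (p u v) (p' u v - p u v)
  three : IsOrd α T h₀ 3 fun u v => F v (p' u v) - F v (p u v)
    - fderiv ℝ (F v) (p u v) (p' u v - p u v)
    - (1 / 2 : ℝ) • fderiv ℝ (fderiv ℝ (F v)) (p u v) (p' u v - p u v) (p' u v - p u v)

/-- Everything is evaluated at the later time `v`; the bounds on `F v` on a ball are uniform in `v`,
so the usual Taylor estimates become statements about orders. -/
theorem IsTransported.taylorOrd (h : IsTransported α T h₀ D Z ZZ μ σ Φ F) {R : ℝ}
    {p p' : ℝ → ℝ → W}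
    (hp : ∀ u v, 0 ≤ u → u < v → v ≤ T → v - u ≤ h₀ → ‖p u v‖ ≤ R)
    (hp' : ∀ u v, 0 ≤ u → u < v → v ≤ T → v - u ≤ h₀ → ‖p' u v‖ ≤ R)
    (hpp : IsOrd α T h₀ 1 fun u v => p' u v - p u v) : TaylorOrd α T h₀ F p p' := by
  obtain ⟨K, hK, hF⟩ := h.c21 R
  obtain ⟨A, hA, hpp⟩ := hpp
  have hB : Convex ℝ (Metric.closedBall (0 : W) R) := convex_closedBall _ _
  have hm : ∀ x : W, ‖x‖ ≤ R → x ∈ Metric.closedBall (0 : W) R := fun x hx => by simpa using hx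
  refine ⟨IsOrd.of_le hK fun u v h1 h2 h3 h4 => ?_, IsOrd.of_le hK fun u v h1 h2 h3 h4 => ?_,
    IsOrd.of_le hK fun u v h1 h2 h3 h4 => ?_,
    IsOrd.of_le (K := K * A) (by positivity) fun u v h1 h2 h3 h4 => ?_,
    IsOrd.of_le (K := K * A) (by positivity) fun u v h1 h2 h3 h4 => ?_,
    IsOrd.of_le (K := K * A ^ 2) (by positivity) fun u v h1 h2 h3 h4 => ?_,
    IsOrd.of_le (K := K * A ^ 3) (by positivity) fun u v h1 h2 h3 h4 => ?_⟩
  all_goals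
    have hv := hF v (by linarith) h3
    have hx := hm _ (hp u v h1 h2 h3 h4)
    have hx' := hm _ (hp' u v h1 h2 h3 h4)
    have hd := hpp u v h1 h2 h3 h4
    rw [pow_one] at hd
  · rw [pow_zero, mul_one]
    exact hv.fderiv_le _ hx
  · rw [pow_zero, mul_one]
    exact hv.fderiv_le _ hx'
  · rw [pow_zero, mul_one]
    exact hv.fderiv_fderiv_le _ hx
  · rw [pow_one, mul_assoc]
    exact (hv.fderiv_lip hB hx' hx).trans (by gcongr)
  · rw [pow_one, mul_assoc]
    exact (hv.fderiv_fderiv_lip _ hx' _ hx).trans (by gcongr)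
  · rw [mul_assoc, ← mul_pow]
    exact (norm_taylor_one_le hv.diff_fderiv hB hv.fderiv_fderiv_lip hK hx hx').trans (by gcongr)
  · rw [mul_assoc, ← mul_pow]
    exact (norm_taylor_two_le hv.diff hv.diff_fderiv hB hv.fderiv_fderiv_lip hK hx hx').trans
      (by gcongr)

/-- The flow expansions along a path `Y`. -/
structure FlowOrd (α T h₀ : ℝ) (Z : ℝ → EuclideanSpace ℝ (Fin m))
    (ZZ : ℝ → ℝ → Matrix (Fin m) (Fin m) ℝ) (μ : W → W)
    (σ : W → EuclideanSpace ℝ (Fin m) →L[ℝ] W) (Φ : ℝ → ℝ → W → W) (Y : ℝ → W) : Prop where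
  one : IsOrd α T h₀ 1 fun u v => Φ u v (Y u) - Y u
  two : IsOrd α T h₀ 2 fun u v => Φ u v (Y u) - Y u - σ (Y u) (Z v - Z u)
  three : IsOrd α T h₀ 3 fun u v => Φ u v (Y u) - eulerStep Z ZZ μ σ u v (Y u)
  fderiv_zero : IsOrd α T h₀ 0 fun u v => fderiv ℝ (Φ u v) (Y u)
  fderiv_one : IsOrd α T h₀ 1 fun u v => fderiv ℝ (Φ u v) (Y u) - ContinuousLinearMap.id ℝ W
  fderiv_two : IsOrd α T h₀ 2 fun u v => fderiv ℝ (Φ u v) (Y u) - ContinuousLinearMap.id ℝ W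
    - (ContinuousLinearMap.apply ℝ W (Z v - Z u)).comp (fderiv ℝ σ (Y u))
  hess_one : IsOrd α T h₀ 1 fun u v => fderiv ℝ (fderiv ℝ (Φ u v)) (Y u)

theorem IsTransported.flowOrd (hα : 0 < α) (h1 : h₀ ≤ 1)
    (h : IsTransported α T h₀ D Z ZZ μ σ Φ F) (Y : ℝ → W) :
    FlowOrd α T h₀ Z ZZ μ σ Φ Y := by
  refine ⟨IsOrd.of_le h.nonneg fun u v k1 k2 k3 k4 => ?_,
    IsOrd.of_le h.nonneg fun u v k1 k2 k3 k4 => ?_,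
    IsOrd.of_le h.nonneg fun u v k1 k2 k3 k4 => ?_,
    IsOrd.of_le (K := 1 + D) (by linarith [h.nonneg]) fun u v k1 k2 k3 k4 => ?_,
    IsOrd.of_le h.nonneg fun u v k1 k2 k3 k4 => ?_,
    IsOrd.of_le h.nonneg fun u v k1 k2 k3 k4 => ?_,
    IsOrd.of_le h.nonneg fun u v k1 k2 k3 k4 => ?_⟩
  all_goals have hf := h.flow u v k1 k2 k3 k4
  · rw [pow_one]; exact hf.sub_le _
  · exact hf.sub_sub_le _
  · exact hf.sub_eulerStep_le _
  · rw [pow_zero, mul_one]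
    exact (hf.c21On h.nonneg (Real.rpow_le_one (by linarith) (by linarith) hα.le)).fderiv_le _
      (mem_univ _)
  · rw [pow_one]; exact hf.fderiv_sub_le _
  · exact hf.fderiv_sub_sub_le _
  · rw [pow_one]; exact hf.fderiv_fderiv_le _

/-- The time increments of the derivatives of a transported family along a path `Y`. -/
structure TransportOrd (α T h₀ : ℝ) (Z : ℝ → EuclideanSpace ℝ (Fin m))
    (σ : W → EuclideanSpace ℝ (Fin m) →L[ℝ] W) (F : ℝ → W → U) (Y : ℝ → W) : Prop where
  fderiv_one : IsOrd α T h₀ 1 fun u v => fderiv ℝ (F u) (Y u) - fderiv ℝ (F v) (Y u)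
  hess_one : IsOrd α T h₀ 1 fun u v =>
    fderiv ℝ (fderiv ℝ (F u)) (Y u) - fderiv ℝ (fderiv ℝ (F v)) (Y u)
  gamma_one : IsOrd α T h₀ 1 fun u v =>
    fderiv ℝ (gammaOp σ (F u)) (Y u) - fderiv ℝ (gammaOp σ (F v)) (Y u)
  fderiv_two : IsOrd α T h₀ 2 fun u v => fderiv ℝ (F u) (Y u) - fderiv ℝ (F v) (Y u)
    - (ContinuousLinearMap.apply ℝ U (Z v - Z u)).comp (fderiv ℝ (gammaOp σ (F v)) (Y u))

theorem IsTransported.taylorOrd_path (h : IsTransported α T h₀ D Z ZZ μ σ Φ F) {Y : ℝ → W}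
    (hY : IsHolder α T Y) : TaylorOrd α T h₀ F (fun u _ => Y u) fun _ v => Y v := by
  obtain ⟨R, hR, hb, -⟩ := id hY
  exact h.taylorOrd (fun u v k1 k2 k3 _ => hb u k1 (by linarith))
    (fun u v k1 k2 k3 _ => hb v (by linarith) k3) hY.increment

theorem IsTransported.taylorOrd_flow (hα : 0 < α) (h1 : h₀ ≤ 1)
    (h : IsTransported α T h₀ D Z ZZ μ σ Φ F) {Y : ℝ → W}
    (hY : IsHolder α T Y) : TaylorOrd α T h₀ F (fun u _ => Y u) fun u v => Φ u v (Y u) := by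
  obtain ⟨R, hR, hb, -⟩ := id hY
  have hD := h.nonneg
  refine h.taylorOrd (R := R + D) (fun u v k1 k2 k3 _ => (hb u k1 (by linarith)).trans
    (by linarith)) (fun u v k1 k2 k3 k4 => ?_) (h.flowOrd hα h1 Y).one
  have k5 := (h.flow u v k1 k2 k3 k4).sub_le (Y u)
  have k6 := norm_le_norm_sub_add (Φ u v (Y u)) (Y u)
  have k7 := hb u k1 (by linarith)
  have hq1 : (v - u) ^ α ≤ 1 := Real.rpow_le_one (by linarith) (by linarith) hα.le
  have k8 : D * (v - u) ^ α ≤ D := mul_le_of_le_one_right hD hq1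
  linarith

/-- The chain rule for `F u = F v ∘ Φ u v` turns spatial expansions of `F v` and of the flow into
increments in time. In the second order statement the leading terms `D²F (σ δZ)` and `DF Dσ δZ`
together form the derivative of `ΓF`. -/
theorem IsTransported.transportOrd (hα : 0 < α) (h1 : h₀ ≤ 1)
    (h : IsTransported α T h₀ D Z ZZ μ σ Φ F) (hZ : RoughBound α T M Z ZZ)
    (hσ : IsBL (univ : Set W) 1 σ) {Y : ℝ → W} (hY : IsHolder α T Y) :
    TransportOrd α T h₀ Z σ F Y := by
  have fl := h.flowOrd hα h1 Y
  have ta := h.taylorOrd_flow hα h1 hY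
  have hσY := (hY.lipschitz hσ.2.1).left (h₀ := h₀)
  have hσY' := (hY.lipschitz hσ.2.2).left (h₀ := h₀)
  have e1 : ∀ u v, 0 ≤ u → u < v → v ≤ T → v - u ≤ h₀ → fderiv ℝ (F u) (Y u)
      = (fderiv ℝ (F v) (Φ u v (Y u))).comp (fderiv ℝ (Φ u v) (Y u)) := by
    intro u v k1 k2 k3 k4
    rw [h.comp u v k1 k2 k3 k4]
    exact fderiv_fun_comp _ (h.diff (by linarith) k3 _) ((h.flow u v k1 k2 k3 k4).diff _)
  have o1 : IsOrd α T h₀ 1 fun u v => fderiv ℝ (F u) (Y u) - fderiv ℝ (F v) (Y u) := by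
    refine ((ta.fderiv_one.comp fl.fderiv_zero).add
      ((ta.fderiv_zero.comp fl.fderiv_one).mono hα h1 le_rfl)).congr fun u v k1 k2 k3 k4 => ?_
    rw [e1 u v k1 k2 k3 k4]
    ext w
    simp
  have o2 : IsOrd α T h₀ 1 fun u v =>
      fderiv ℝ (fderiv ℝ (F u)) (Y u) - fderiv ℝ (fderiv ℝ (F v)) (Y u) := by
    have t1 := IsOrd.clm_comp (ContinuousLinearMap.compL ℝ W W U) ta.fderiv_zero' fl.hess_one
    have t2 := IsOrd.clm_comp (ContinuousLinearMap.compL ℝ W W U).flip fl.fderiv_zero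
      (ta.hess_one.comp fl.fderiv_zero)
    have t3 := IsOrd.clm_comp (ContinuousLinearMap.compL ℝ W W U).flip fl.fderiv_one
      (ta.hess_zero.comp fl.fderiv_zero)
    have t4 := ta.hess_zero.comp fl.fderiv_one
    refine (((t1.add t2).add t3).add t4).congr fun u v k1 k2 k3 k4 => ?_
    have hf := h.flow u v k1 k2 k3 k4
    rw [h.comp u v k1 k2 k3 k4]
    ext w x
    rw [sub_apply, sub_apply, fderiv_fderiv_comp_apply (h.diff (by linarith) k3)
      (h.diff_fderiv (by linarith) k3) hf.diff hf.diff_fderiv]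
    simp
    abel
  refine ⟨o1, o2, ?_, ?_⟩
  · have t1 := IsOrd.bilin ((ContinuousLinearMap.compL ℝ (EuclideanSpace ℝ (Fin m)) W U).precompR
      W) o1 hσY'
    have t2 := IsOrd.bilin ((ContinuousLinearMap.compL ℝ (EuclideanSpace ℝ (Fin m)) W U).precompL
      W) o2 hσY
    refine (t1.add t2).congr fun u v k1 k2 k3 k4 => ?_
    rw [(hasFDerivAt_gammaOp_of (h.diff_fderiv k1 (by linarith)) hσ.1 (Y u)).fderiv,
      (hasFDerivAt_gammaOp_of (h.diff_fderiv (by linarith) k3) hσ.1 (Y u)).fderiv]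
    simp only [map_sub, sub_apply]
    abel
  · have hz := hσY.apply hZ.isOrd
    have t1 := ta.fderiv_two.comp fl.fderiv_zero
    have t2 := (ta.hess_zero.apply fl.two).comp fl.fderiv_zero
    have t3 := (ta.hess_zero.apply hz).comp fl.fderiv_one
    have t4 := ta.fderiv_zero.comp fl.fderiv_two
    refine (((t1.add t2).add t3).add t4).congr fun u v k1 k2 k3 k4 => ?_
    rw [e1 u v k1 k2 k3 k4]
    ext w
    -- The Taylor expansion has the flow direction `σ(Y) δZ` in the first slot of the Hessian,
    -- `D(ΓF)` has it in the second.
    have hs := fderiv_fderiv_symm (h.diff (u := v) (by linarith) k3)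
      (h.diff_fderiv (u := v) (by linarith) k3) (Y u) w (σ (Y u) (Z v - Z u))
    have hg := fderiv_gammaOp_apply (h.diff_fderiv (u := v) (by linarith) k3) hσ.1 (Y u) w
      (Z v - Z u)
    rw [hs] at hg
    simp only [sub_apply, add_apply, ContinuousLinearMap.comp_apply,
      ContinuousLinearMap.apply_apply, map_sub, ContinuousLinearMap.id_apply] at hg ⊢
    rw [hg]
    abel

end Expansion

/-! ### From strong controlledness to local order estimates. -/

section StronglyControlled

variable {W : Type} [NormedAddCommGroup W] [NormedSpace ℝ W] {m : ℕ} {M α T h₀ : ℝ}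
  {Z : ℝ → EuclideanSpace ℝ (Fin m)} {ZZ : ℝ → ℝ → Matrix (Fin m) (Fin m) ℝ}
  {Y : ℝ → W} {Y' : ℝ → EuclideanSpace ℝ (Fin m) →L[ℝ] W}
  {Y'' : ℝ → EuclideanSpace ℝ (Fin m) →L[ℝ] EuclideanSpace ℝ (Fin m) →L[ℝ] W} {Ydot : ℝ → W}

theorem IsHolder.of_holder {E : Type} [NormedAddCommGroup E] [NormedSpace ℝ E] (hα : 0 < α)
    {f : ℝ → E}
    (h : ∃ C : ℝ, ∀ s t, 0 ≤ s → s < t → t ≤ T → ‖f t - f s‖ ≤ C * (t - s) ^ α) :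
    IsHolder α T f := by
  obtain ⟨C, hC⟩ := h
  have hC' : ∀ s t, 0 ≤ s → s ≤ t → t ≤ T → ‖f t - f s‖ ≤ |C| * (t - s) ^ α := by
    intro s t h1 h2 h3
    have hq0 : 0 ≤ (t - s) ^ α := Real.rpow_nonneg (by linarith) _
    rcases h2.eq_or_lt with rfl | h2
    · rw [sub_self, norm_zero]
      positivity
    · exact (hC s t h1 h2 h3).trans (mul_le_mul_of_nonneg_right (le_abs_self C) hq0)
  have hT0 := Real.rpow_nonneg (abs_nonneg T) α
  refine ⟨|C| + |C| * |T| ^ α + ‖f 0‖, by positivity, fun r h1 h2 => ?_, fun u v h1 h2 h3 => ?_⟩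
  · have k1 := hC' 0 r le_rfl h1 h2
    have k2 : (r - 0) ^ α ≤ |T| ^ α :=
      Real.rpow_le_rpow (by linarith) (by linarith [le_abs_self T]) hα.le
    have k3 : |C| * (r - 0) ^ α ≤ |C| * |T| ^ α := by gcongr
    have k4 := norm_le_norm_sub_add (f r) (f 0)
    linarith [abs_nonneg C]
  · refine (hC' u v h1 h2 h3).trans ?_
    have : 0 ≤ |C| * |T| ^ α := by positivity
    exact mul_le_mul_of_nonneg_right (by linarith [norm_nonneg (f 0)])
      (Real.rpow_nonneg (by linarith) _)

theorem IsHolder.congr {E : Type} [NormedAddCommGroup E] [NormedSpace ℝ E] {f g : ℝ → E}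
    (hf : IsHolder α T f) (h : ∀ r, 0 ≤ r → r ≤ T → g r = f r) : IsHolder α T g := by
  obtain ⟨C, hC, k1, k2⟩ := hf
  refine ⟨C, hC, fun r h3 h4 => ?_, fun u v h3 h4 h5 => ?_⟩
  · rw [h r h3 h4]
    exact k1 r h3 h4
  · rw [h u h3 (h4.trans h5), h v (h3.trans h4) h5]
    exact k2 u v h3 h4 h5

theorem IsOrd.flip {E E' E'' : Type} [NormedAddCommGroup E] [NormedSpace ℝ E]
    [NormedAddCommGroup E'] [NormedSpace ℝ E'] [NormedAddCommGroup E''] [NormedSpace ℝ E'']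
    {n : ℕ} {f : ℝ → ℝ → E →L[ℝ] E' →L[ℝ] E''} (hf : IsOrd α T h₀ n f) :
    IsOrd α T h₀ n fun u v => (f u v).flip := by
  obtain ⟨K, hK, hf⟩ := hf
  refine ⟨K, hK, fun u v k1 k2 k3 k4 => ?_⟩
  rw [ContinuousLinearMap.opNorm_flip]
  exact hf u v k1 k2 k3 k4

/-- The local form of strong controlledness. -/
structure IsLocStrong (α T h₀ : ℝ) (Z : ℝ → EuclideanSpace ℝ (Fin m))
    (ZZ : ℝ → ℝ → Matrix (Fin m) (Fin m) ℝ)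
    (Y : ℝ → W) (Y' : ℝ → EuclideanSpace ℝ (Fin m) →L[ℝ] W)
    (Y'' : ℝ → EuclideanSpace ℝ (Fin m) →L[ℝ] EuclideanSpace ℝ (Fin m) →L[ℝ] W)
    (Ydot : ℝ → W) : Prop where
  ctrl : IsLocCtrl α T h₀ Z Y Y'
  ctrl_deriv : IsLocCtrl α T h₀ Z Y' Y''
  dot : IsHolder α T Ydot
  three : IsOrd α T h₀ 3 fun u v =>
    Y v - Y u - Y' u (Z v - Z u) - contract (Y'' u) (ZZ u v) - (v - u) • Ydot u

/-- The definition gives expansions but no bounds. Hölder continuity is recovered in the order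
`Y''`, `Y'`, `Y`: each path is bounded by expanding from time `0`, and its increments follow from
the expansion and the previous one. -/
theorem IsStronglyControlled.isLocStrong (hα : 0 < α) (hα' : α ≤ 1 / 2) (h0 : 0 < h₀)
    (h1 : h₀ ≤ 1) (hT : 0 < T) (hZ : RoughBound α T M Z ZZ)
    (hY : IsStronglyControlled α T Z ZZ Y Y' Y'' Ydot) :
    IsLocStrong α T h₀ Z ZZ Y Y' Y'' Ydot := by
  have hd := IsHolder.of_holder hα hY.holder_dot
  have hY'' := IsHolder.of_holder hα hY.controlled_deriv.holder_deriv
  obtain ⟨K, hK⟩ := hY.expansion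
  obtain ⟨K', hK'⟩ := hY.controlled_deriv.expansion
  have hM := hZ.nonneg
  obtain ⟨Θ, hΘ1, hΘ⟩ := exists_horizon_const hα hα' T
  have o3 : IsOrd α T h₀ 3 fun u v =>
      Y v - Y u - Y' u (Z v - Z u) - contract (Y'' u) (ZZ u v) - (v - u) • Ydot u := by
    refine IsOrd.of_le (abs_nonneg K) fun u v k1 k2 k3 _ => (hK u v k1 k2 k3).trans ?_
    rw [rpow_cube α (by linarith)]
    have : 0 ≤ ((v - u) ^ α) ^ 3 := pow_nonneg (Real.rpow_nonneg (by linarith) _) _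
    gcongr
    exact le_abs_self K
  have o2' : IsOrd α T h₀ 2 fun u v => Y' v - Y' u - Y'' u (Z v - Z u) := by
    refine IsOrd.of_le (abs_nonneg K') fun u v k1 k2 k3 _ => (hK' u v k1 k2 k3).trans ?_
    rw [rpow_sq α (by linarith)]
    have : 0 ≤ ((v - u) ^ α) ^ 2 := by positivity
    gcongr
    exact le_abs_self K'
  have hb' : ∀ r, 0 ≤ r → r ≤ T → ‖Y' r‖ ≤ |K'| * Θ ^ 2 + ‖Y'' 0‖ * (M * Θ) + ‖Y' 0‖ := by
    intro r h2 h3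
    rcases h2.eq_or_lt with rfl | h2
    · have : 0 ≤ |K'| * Θ ^ 2 + ‖Y'' 0‖ * (M * Θ) := by positivity
      linarith
    have k1 := hK' 0 r le_rfl h2 h3
    rw [rpow_sq α (by linarith), sub_zero] at k1
    have k2 := (hΘ r h2.le h3).2
    have k3 : K' * (r ^ α) ^ 2 ≤ |K'| * Θ ^ 2 := by
      have : 0 ≤ r ^ α := by positivity
      gcongr
      exact le_abs_self K'
    have k4 := hZ.path 0 r le_rfl h2.le h3
    rw [sub_zero] at k4
    have k5 := norm_clm_apply_le (A := Y'' 0) le_rfl (k4.trans (show M * r ^ α ≤ M * Θ by gcongr))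
    have e : Y' r = (Y' r - Y' 0 - Y'' 0 (Z r - Z 0)) + Y'' 0 (Z r - Z 0) + Y' 0 := by abel
    rw [e]
    refine (norm_add₃_le).trans ?_
    linarith
  have hY' : IsHolder α T Y' := by
    refine IsHolder.of_local hα h0 hb' ?_
    refine ((o2'.mono hα h1 (by norm_num)).add
      ((hY''.left.apply hZ.isOrd).mono hα h1 le_rfl)).congr fun u v _ _ _ _ => ?_
    abel
  have o2 : IsOrd α T h₀ 2 fun u v => Y v - Y u - Y' u (Z v - Z u) := by
    refine ((o3.mono hα h1 (by norm_num)).add ((hY''.left.contract hZ).add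
      (hd.left.time_smul hα' h1))).congr fun u v _ _ _ _ => ?_
    abel
  have hb : ∀ r, 0 ≤ r → r ≤ T → ‖Y r‖ ≤ |K| * Θ ^ 3 + ‖Y' 0‖ * (M * Θ) + ‖Y'' 0‖ * (M * Θ ^ 2)
      + T * ‖Ydot 0‖ + ‖Y 0‖ := by
    intro r h2 h3
    rcases h2.eq_or_lt with rfl | h2
    · have : 0 ≤ |K| * Θ ^ 3 + ‖Y' 0‖ * (M * Θ) + ‖Y'' 0‖ * (M * Θ ^ 2) + T * ‖Ydot 0‖ := by
        positivity
      linarith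
    have hr0 : 0 ≤ r ^ α := by positivity
    have k1 := hK 0 r le_rfl h2 h3
    rw [rpow_cube α (by linarith), sub_zero] at k1
    have k2 := (hΘ r h2.le h3).2
    have k3 : K * (r ^ α) ^ 3 ≤ |K| * Θ ^ 3 := by
      gcongr
      exact le_abs_self K
    have k4 := hZ.path 0 r le_rfl h2.le h3
    have k4' := hZ.area 0 r le_rfl h2.le h3
    rw [sub_zero] at k4 k4'
    have k5 := norm_clm_apply_le (A := Y' 0) le_rfl (k4.trans (show M * r ^ α ≤ M * Θ by gcongr))
    have k6 : ‖contract (Y'' 0) (ZZ 0 r)‖ ≤ ‖Y'' 0‖ * (M * Θ ^ 2) :=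
      (norm_contract_le _ _).trans (by
        gcongr
        exact k4'.trans (by gcongr))
    have k7 : ‖r • Ydot 0‖ ≤ T * ‖Ydot 0‖ := by
      rw [norm_smul, Real.norm_of_nonneg h2.le]
      gcongr
    have e : Y r = (Y r - Y 0 - Y' 0 (Z r - Z 0) - contract (Y'' 0) (ZZ 0 r) - r • Ydot 0)
        + Y' 0 (Z r - Z 0) + contract (Y'' 0) (ZZ 0 r) + r • Ydot 0 + Y 0 := by abel
    rw [e]
    refine (norm_add_le _ _).trans ?_
    refine (add_le_add_left ((norm_add_le _ _).trans (add_le_add_left norm_add₃_le _)) _).trans ?_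
    linarith
  have hYh : IsHolder α T Y := by
    refine IsHolder.of_local hα h0 hb ?_
    refine ((o2.mono hα h1 (by norm_num)).add
      ((hY'.left.apply hZ.isOrd).mono hα h1 le_rfl)).congr fun u v _ _ _ _ => ?_
    abel
  exact ⟨⟨hYh, hY', o2⟩, ⟨hY', hY'', o2'⟩, hd, o3⟩

end StronglyControlled

/-! ### The rough Alekseev–Gröbner expansion and the integral. -/

section AlekseevGroebner

variable {W U : Type} [NormedAddCommGroup W] [NormedSpace ℝ W] [NormedAddCommGroup U]
  [NormedSpace ℝ U] {m : ℕ} {M α T L h₀ D : ℝ} {μ : W → W}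
  {σ : W → EuclideanSpace ℝ (Fin m) →L[ℝ] W}
  {Z : ℝ → EuclideanSpace ℝ (Fin m)} {ZZ : ℝ → ℝ → Matrix (Fin m) (Fin m) ℝ}
  {Φ : ℝ → ℝ → W → W} {F : ℝ → W → U}
  {Y : ℝ → W} {Y' : ℝ → EuclideanSpace ℝ (Fin m) →L[ℝ] W}
  {Y'' : ℝ → EuclideanSpace ℝ (Fin m) →L[ℝ] EuclideanSpace ℝ (Fin m) →L[ℝ] W} {Ydot : ℝ → W}

theorem IsTransported.isHolder_fderiv (hα : 0 < α) (h0 : 0 < h₀) (h1 : h₀ ≤ 1)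
    (h : IsTransported α T h₀ D Z ZZ μ σ Φ F) (hZ : RoughBound α T M Z ZZ)
    (hσ : IsBL (univ : Set W) 1 σ) (hY : IsHolder α T Y) :
    IsHolder α T (fun r => fderiv ℝ (F r) (Y r)) ∧
      IsHolder α T fun r => fderiv ℝ (fderiv ℝ (F r)) (Y r) := by
  obtain ⟨R, hR, hb, -⟩ := id hY
  obtain ⟨K, hK, hF⟩ := h.c21 R
  have hm : ∀ r, 0 ≤ r → r ≤ T → Y r ∈ Metric.closedBall (0 : W) R := fun r k1 k2 => by
    simpa using hb r k1 k2
  have tr := h.transportOrd hα h1 hZ hσ hY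
  have ta := h.taylorOrd_path hY
  constructor
  · refine IsHolder.of_local hα h0 (fun r k1 k2 => (hF r k1 k2).fderiv_le _ (hm r k1 k2)) ?_
    refine (ta.fderiv_one.sub tr.fderiv_one).congr fun u v _ _ _ _ => ?_
    abel
  · refine IsHolder.of_local hα h0
      (fun r k1 k2 => (hF r k1 k2).fderiv_fderiv_le _ (hm r k1 k2)) ?_
    refine (ta.hess_one.sub tr.hess_one).congr fun u v _ _ _ _ => ?_
    abel

theorem IsTransported.isHolder_fderiv_gammaOp (hα : 0 < α) (h0 : 0 < h₀) (h1 : h₀ ≤ 1)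
    (h : IsTransported α T h₀ D Z ZZ μ σ Φ F) (hZ : RoughBound α T M Z ZZ)
    (hσ : IsBL (univ : Set W) 1 σ) (hY : IsHolder α T Y) :
    IsHolder α T fun r => fderiv ℝ (gammaOp σ (F r)) (Y r) := by
  obtain ⟨hP, hQ⟩ := h.isHolder_fderiv hα h0 h1 hZ hσ hY
  have t1 := IsHolder.bilin ((ContinuousLinearMap.compL ℝ (EuclideanSpace ℝ (Fin m)) W U).precompR
    W) hP (hY.lipschitz hσ.2.2)
  have t2 := IsHolder.bilin ((ContinuousLinearMap.compL ℝ (EuclideanSpace ℝ (Fin m)) W U).precompL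
    W) hQ (hY.lipschitz hσ.2.1)
  exact (t1.add t2).congr fun r k1 k2 =>
    (hasFDerivAt_gammaOp_of (h.diff_fderiv k1 k2) hσ.1 (Y r)).fderiv

/-- Moving the point gives `D²F Y'`; moving time gives minus `D(ΓF)`, transposed because its second
argument is the increment of `Z`. In the remainder, quantities at time `v` are first replaced by
those at time `u`. -/
theorem IsTransported.isLocCtrl_fderiv (hα : 0 < α) (h0 : 0 < h₀) (h1 : h₀ ≤ 1)
    (h : IsTransported α T h₀ D Z ZZ μ σ Φ F) (hZ : RoughBound α T M Z ZZ)
    (hσ : IsBL (univ : Set W) 1 σ) (hY : IsLocCtrl α T h₀ Z Y Y') :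
    IsLocCtrl α T h₀ Z (fun r => fderiv ℝ (F r) (Y r)) fun r =>
      (fderiv ℝ (fderiv ℝ (F r)) (Y r)).comp (Y' r)
        - (fderiv ℝ (gammaOp σ (F r)) (Y r)).flip := by
  obtain ⟨hP, hQ⟩ := h.isHolder_fderiv hα h0 h1 hZ hσ hY.holder
  have hG := h.isHolder_fderiv_gammaOp hα h0 h1 hZ hσ hY.holder
  have tr := h.transportOrd hα h1 hZ hσ hY.holder
  have ta := h.taylorOrd_path hY.holder
  refine ⟨hP, (IsHolder.bilin (ContinuousLinearMap.compL ℝ (EuclideanSpace ℝ (Fin m)) W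
    (W →L[ℝ] U)) hQ hY.holder_deriv).sub hG.flip, ?_⟩
  have t1 := ta.fderiv_two
  have t2 := tr.hess_one.apply hY.holder.increment
  have t3 := hQ.left.apply hY.expansion
  have t4 := tr.fderiv_two
  have t5 := tr.gamma_one.flip.apply hZ.isOrd
  refine ((((t1.sub t2).add t3).sub t4).add t5).congr fun u v _ _ _ _ => ?_
  ext w
  simp only [sub_apply, add_apply, ContinuousLinearMap.comp_apply, map_sub,
    ContinuousLinearMap.flip_apply, ContinuousLinearMap.apply_apply]
  abel

theorem IsLocCtrl.comp_smooth {V : Type} [NormedAddCommGroup V] [NormedSpace ℝ V] {g : W → V}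
    (hg : IsBL (univ : Set W) 1 g) (hY : IsLocCtrl α T h₀ Z Y Y') :
    IsLocCtrl α T h₀ Z (fun r => g (Y r)) fun r => (fderiv ℝ g (Y r)).comp (Y' r) := by
  have hg' := hY.holder.lipschitz hg.2.2
  refine ⟨hY.holder.lipschitz hg.2.1, IsHolder.bilin (ContinuousLinearMap.compL ℝ
    (EuclideanSpace ℝ (Fin m)) W V) hg' hY.holder_deriv, ?_⟩
  obtain ⟨C, hC, -, hlip⟩ := hg.2.2
  obtain ⟨K, hK, hinc⟩ := hY.holder.increment (h₀ := h₀)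
  have t1 : IsOrd α T h₀ 2 fun u v => g (Y v) - g (Y u) - fderiv ℝ g (Y u) (Y v - Y u) := by
    refine IsOrd.of_le (K := C * K ^ 2) (by positivity) fun u v k1 k2 k3 k4 => ?_
    have k5 := hinc u v k1 k2 k3 k4
    rw [pow_one] at k5
    rw [mul_assoc, ← mul_pow]
    exact (norm_taylor_one_le hg.1 convex_univ hlip hC (mem_univ _) (mem_univ _)).trans
      (by gcongr)
  refine (t1.add (hg'.left.apply hY.expansion)).congr fun u v _ _ _ _ => ?_
  simp only [ContinuousLinearMap.comp_apply, map_sub]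
  abel

theorem IsTransported.isLocCtrl_agIntegrand (hα : 0 < α) (h0 : 0 < h₀) (h1 : h₀ ≤ 1)
    (h : IsTransported α T h₀ D Z ZZ μ σ Φ F) (hZ : RoughBound α T M Z ZZ)
    (hσ : IsBL (univ : Set W) 1 σ) (hY : IsLocStrong α T h₀ Z ZZ Y Y' Y'' Ydot) :
    IsLocCtrl α T h₀ Z (agIntegrand σ F Y Y') fun r =>
      (((ContinuousLinearMap.compL ℝ (EuclideanSpace ℝ (Fin m)) W U).flip (Y' r - σ (Y r))).comp
        ((fderiv ℝ (fderiv ℝ (F r)) (Y r)).comp (Y' r)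
          - (fderiv ℝ (gammaOp σ (F r)) (Y r)).flip))
      + ((ContinuousLinearMap.compL ℝ (EuclideanSpace ℝ (Fin m)) W U) (fderiv ℝ (F r) (Y r))).comp
        (Y'' r - (fderiv ℝ σ (Y r)).comp (Y' r)) :=
  (h.isLocCtrl_fderiv hα h0 h1 hZ hσ hY.ctrl).bilin
    (ContinuousLinearMap.compL ℝ (EuclideanSpace ℝ (Fin m)) W U)
    (hY.ctrl_deriv.sub (hY.ctrl.comp_smooth hσ))

/-- The product rule delivers the form on the right. Expanding `D(ΓF)` on `Y'` as `DF Dσ Y' +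
D²F(Y', σ)` and reading `D(ΓF)` on `σ` as `Γ²F` gives the stated formula. -/
theorem agIntegrandDeriv_eq (hσ : Differentiable ℝ σ) {r : ℝ}
    (hF' : Differentiable ℝ (fderiv ℝ (F r))) :
    agIntegrandDeriv σ F Y Y' Y'' r =
      (((ContinuousLinearMap.compL ℝ (EuclideanSpace ℝ (Fin m)) W U).flip (Y' r - σ (Y r))).comp
        ((fderiv ℝ (fderiv ℝ (F r)) (Y r)).comp (Y' r)
          - (fderiv ℝ (gammaOp σ (F r)) (Y r)).flip))
      + ((ContinuousLinearMap.compL ℝ (EuclideanSpace ℝ (Fin m)) W U) (fderiv ℝ (F r) (Y r))).comp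
        (Y'' r - (fderiv ℝ σ (Y r)).comp (Y' r)) := by
  ext ζ η
  have h1 := fderiv_gammaOp_apply hF' hσ (Y r) (Y' r ζ) η
  simp only [agIntegrandDeriv, sub_apply, add_apply, ContinuousLinearMap.comp_apply, map_sub,
    ContinuousLinearMap.flip_apply, ContinuousLinearMap.compL_apply, h1,
    ContinuousLinearMap.bilinearComp_apply]
  rw [show gammaOp σ (gammaOp σ (F r)) (Y r) η ζ
    = fderiv ℝ (gammaOp σ (F r)) (Y r) (σ (Y r) η) ζ from rfl]
  abel

theorem IsTransported.isControlled (hα : 0 < α) (h0 : 0 < h₀) (h1 : h₀ ≤ 1)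
    (h : IsTransported α T h₀ D Z ZZ μ σ Φ F) (hZ : RoughBound α T M Z ZZ)
    (hσ : IsBL (univ : Set W) 1 σ) (hY : IsLocStrong α T h₀ Z ZZ Y Y' Y'' Ydot) :
    IsControlled α 0 T Z (agIntegrand σ F Y Y') (agIntegrandDeriv σ F Y Y' Y'') := by
  have hc := (h.isLocCtrl_agIntegrand hα h0 h1 hZ hσ hY).isControlled hα h0 hZ
  have e := fun r (k1 : 0 ≤ r) (k2 : r ≤ T) =>
    agIntegrandDeriv_eq (Y := Y) (Y' := Y') (Y'' := Y'') hσ.1 (h.diff_fderiv k1 k2)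
  obtain ⟨⟨C, hC⟩, D, hD⟩ := hc
  refine ⟨⟨C, fun u v k1 k2 k3 => ?_⟩, D, fun u v k1 k2 k3 => ?_⟩
  · rw [e u k1 (by linarith)]
    exact hC u v k1 k2 k3
  · rw [e u k1 (by linarith), e v (by linarith) k3]
    exact hD u v k1 k2 k3

/-- The difference of two squares of first order terms that agree to second order is of third order.
-/
theorem IsOrd.half_sq {n : ℕ} {A : ℝ → ℝ → W →L[ℝ] W →L[ℝ] U} {a b : ℝ → ℝ → W} (hα : 0 < α)
    (h1 : h₀ ≤ 1) (hA : IsOrd α T h₀ 0 A) (ha : IsOrd α T h₀ 1 a) (hb : IsOrd α T h₀ 1 b)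
    (hab : IsOrd α T h₀ 2 fun u v => a u v - b u v) (hn : n ≤ 3) :
    IsOrd α T h₀ n fun u v => (1 / 2 : ℝ) • A u v (a u v) (a u v)
      - (1 / 2 : ℝ) • A u v (b u v) (b u v) := by
  have t1 := (hA.apply hab).apply ha
  have t2 := (hA.apply hb).apply hab
  refine IsOrd.mono hα h1 hn (((t1.add t2).const_smul (1 / 2)).congr fun u v _ _ _ _ => ?_)
  rw [← smul_sub]
  simp only [map_sub, sub_apply]
  congr 1
  abel

/-- `F v (Y v)` and `F u (Y u) = F v (Φ u v (Y u))` are both expanded at `Y u`; their common value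
there cancels. The remaining discrepancies are the nine terms below, each of third order, and their
signed sum is an exact identity. -/
theorem IsTransported.expansion (hα : 0 < α) (hα' : α ≤ 1 / 2) (h1 : h₀ ≤ 1)
    (h : IsTransported α T h₀ D Z ZZ μ σ Φ F) (hZ' : IsWeaklyGeometricRoughPath α T Z ZZ)
    (hZ : RoughBound α T M Z ZZ) (hμ : IsBL (univ : Set W) 0 μ)
    (hσ : IsBL (univ : Set W) 2 σ) (hY : IsLocStrong α T h₀ Z ZZ Y Y' Y'' Ydot) :
    IsOrd α T h₀ 3 fun u v => F v (Y v) - F u (Y u)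
      - (agIntegrand σ F Y Y' u (Z v - Z u) + contract (agIntegrandDeriv σ F Y Y' Y'' u) (ZZ u v))
      - (v - u) • fderiv ℝ (F u) (Y u) (Ydot u - μ (Y u)) := by
  have hYh := hY.ctrl.holder
  have hσ1 := hσ.of_succ
  have hσY := hYh.lipschitz hσ.2.1
  have hΓY := hYh.lipschitz hσ.gamma.bddLip
  have hμY := hYh.lipschitz hμ.bddLip
  have hz : IsOrd α T h₀ 1 fun u v => Z v - Z u := hZ.isOrd
  have tr := h.transportOrd hα h1 hZ hσ1 hYh
  have ta := h.taylorOrd_path hYh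
  have tf := h.taylorOrd_flow hα h1 hYh
  have fl := h.flowOrd hα h1 Y
  have hY'z : IsOrd α T h₀ 1 fun u v => Y' u (Z v - Z u) := by
    simpa using hY.ctrl.holder_deriv.left.apply hz
  have hσz : IsOrd α T h₀ 1 fun u v => σ (Y u) (Z v - Z u) := by
    simpa using hσY.left.apply hz
  have hc := hY'z.sub hσz
  have he2 : IsOrd α T h₀ 2 fun u v => contract (Y'' u) (ZZ u v)
      - contract (gammaOp σ σ (Y u)) (ZZ u v) + (v - u) • (Ydot u - μ (Y u)) :=
    ((hY.ctrl_deriv.holder_deriv.left.contract hZ).sub (hΓY.left.contract hZ)).add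
      ((hY.dot.sub hμY).left.time_smul hα' h1)
  -- `t1` collects Taylor remainders, `t2` and `t3` linearise the quadratic terms, and `t4` inserts
  -- the expansions of `Y` and of the flow. The terms `t5` to `t9` move the derivatives of `F` from
  -- time `v` to time `u`, with the first order correction by `D(ΓF)` only where `DF` meets the
  -- first order quantity `hc`.
  have t1 := ta.three.sub tf.three
  have t2 := IsOrd.half_sq hα h1 ta.hess_zero hYh.increment hY'z hY.ctrl.expansion le_rfl
  have t3 := IsOrd.half_sq hα h1 tf.hess_zero fl.one hσz fl.two le_rfl
  have t4 := ta.fderiv_zero.apply (hY.three.sub fl.three)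
  have t5 := tr.fderiv_two.apply hc
  have t6 := (tr.gamma_one.apply hc).apply hz
  have t7 := tr.fderiv_one.apply he2
  have t8 := ((tr.hess_one.apply hY'z).apply hY'z).const_smul (1 / 2)
  have t9 := ((tr.hess_one.apply hσz).apply hσz).const_smul (1 / 2)
  refine ((((((((t1.add t2).sub t3).add t4).sub t5).add t6).sub t7).sub t8).add t9).congr
    fun u v k1 k2 k3 k4 => ?_
  rw [contract_agIntegrandDeriv hZ' hσ.1 (h.diff k1 (by linarith))
    (h.diff_fderiv k1 (by linarith)) k1 k2.le k3]
  have e : F u (Y u) = F v (Φ u v (Y u)) := congrFun (h.comp u v k1 k2 k3 k4) (Y u)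
  rw [e]
  simp only [agIntegrand, eulerStep, germ, sub_apply, ContinuousLinearMap.comp_apply,
    map_sub, map_add, map_smul, smul_sub, ContinuousLinearMap.apply_apply]
  abel

/-- The path `F r (Y r)` minus the drift integral has increments equal to the compensated terms up
to third order; the integrand of the drift is Hölder, so its left-point approximation is accurate
enough. -/
theorem IsTransported.hasRoughIntegral [CompleteSpace U] (hα : 1 / 3 < α) (hα' : α ≤ 1 / 2)
    (h0 : 0 < h₀) (h1 : h₀ ≤ 1)
    (h : IsTransported α T h₀ D Z ZZ μ σ Φ F) (hZ' : IsWeaklyGeometricRoughPath α T Z ZZ)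
    (hZ : RoughBound α T M Z ZZ) (hμ : IsBL (univ : Set W) 0 μ)
    (hσ : IsBL (univ : Set W) 2 σ) (hY : IsLocStrong α T h₀ Z ZZ Y Y' Y'' Ydot) {s t : ℝ}
    (hs : 0 ≤ s) (hst : s ≤ t) (ht : t ≤ T) :
    IntervalIntegrable (fun r => fderiv ℝ (F r) (Y r) (Ydot r - μ (Y r)))
        MeasureTheory.volume s t ∧
      HasRoughIntegral Z ZZ (agIntegrand σ F Y Y') (agIntegrandDeriv σ F Y Y' Y'') s t
        (F t (Y t) - F s (Y s) - ∫ r in s..t, fderiv ℝ (F r) (Y r) (Ydot r - μ (Y r))) := by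
  have hα0 : 0 < α := by linarith
  obtain ⟨g, hg⟩ : ∃ g, g = fun r => fderiv ℝ (F r) (Y r) (Ydot r - μ (Y r)) := ⟨_, rfl⟩
  have hgh : IsHolder α T g := by
    rw [hg]
    exact IsHolder.bilin (ContinuousLinearMap.id ℝ (W →L[ℝ] U))
      (h.isHolder_fderiv hα0 h0 h1 hZ hσ.of_succ hY.ctrl.holder).1
      (hY.dot.sub (hY.ctrl.holder.lipschitz hμ.bddLip))
  have hint : ∀ a b, 0 ≤ a → a ≤ b → b ≤ T → IntervalIntegrable g MeasureTheory.volume a b :=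
    fun a b k1 k2 k3 =>
      ((hgh.continuousOn hα0).mono (Icc_subset_Icc k1 k3)).intervalIntegrable_of_Icc k2
  obtain ⟨C, hC, -, hhol⟩ := hgh
  obtain ⟨K, hK, hexp⟩ := h.expansion hα0 hα' h1 hZ' hZ hμ hσ hY
  rw [← hg]
  refine ⟨hint s t hs hst ht, ?_⟩
  have key := hasRoughIntegral_of_local (Z := Z) (ZZ := ZZ) hα (H := agIntegrand σ F Y Y')
    (H' := agIntegrandDeriv σ F Y Y' Y'') (J := fun r => F r (Y r) - ∫ y in s..r, g y)
    (C := K + C) (h₀ := h₀) (s := s) (t := t) (by positivity) h0 hst ?_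
  · rw [intervalIntegral.integral_same, sub_zero, sub_right_comm] at key
    exact key
  · intro u v k1 k2 k3 k4
    have hu : 0 ≤ u := hs.trans k1
    have hv : v ≤ T := k3.trans ht
    have hq0 : 0 ≤ (v - u) ^ α := Real.rpow_nonneg (by linarith) _
    rcases k2.eq_or_lt with rfl | k2
    · have e : contract (agIntegrandDeriv σ F Y Y' Y'' u) (ZZ u u) = 0 := by
        simp [contract, hZ'.area_self hu hv]
      simp only [sub_self, map_zero, e, add_zero, norm_zero]
      positivity
    · have e1 := intervalIntegral.integral_interval_sub_left (hint s v hs (k1.trans k2.le) hv)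
        (hint s u hs k1 (k2.le.trans hv))
      have e : F v (Y v) - (∫ y in s..v, g y) - (F u (Y u) - ∫ y in s..u, g y)
          - (agIntegrand σ F Y Y' u (Z v - Z u)
            + contract (agIntegrandDeriv σ F Y Y' Y'' u) (ZZ u v))
          = (F v (Y v) - F u (Y u) - (agIntegrand σ F Y Y' u (Z v - Z u)
            + contract (agIntegrandDeriv σ F Y Y' Y'' u) (ZZ u v)) - (v - u) • g u)
            - ((∫ y in u..v, g y) - (v - u) • g u) := by
        rw [← e1]
        abel
      rw [e]
      refine (norm_sub_le _ _).trans ?_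
      rw [add_mul]
      have k5 := hexp u v hu k2 hv k4
      refine add_le_add (by rw [hg]; exact k5) ?_
      refine (norm_integral_sub_smul_le hα0 hC hhol hu k2.le hv).trans ?_
      have k6 := le_rpow_sq hα' (show 0 ≤ v - u by linarith) (by linarith)
      calc _ ≤ C * (v - u) ^ α * ((v - u) ^ α) ^ 2 := by gcongr
        _ = _ := by ring

end AlekseevGroebner

/-! ### The solution family is transported by the flow. -/

section TransportedFamily

variable {W U : Type} [NormedAddCommGroup W] [NormedSpace ℝ W] [CompleteSpace W]
  [NormedAddCommGroup U] [NormedSpace ℝ U] {m : ℕ} {M α T : ℝ} {μ : W → W}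
  {σ : W → EuclideanSpace ℝ (Fin m) →L[ℝ] W}
  {Z : ℝ → EuclideanSpace ℝ (Fin m)} {ZZ : ℝ → ℝ → Matrix (Fin m) (Fin m) ℝ}

theorem IsRDESolution.eqOn (hα : 1 / 3 < α) (hα' : α ≤ 1 / 2) (hZ : RoughBound α T M Z ZZ)
    {L : ℝ} (hc : CoefBound univ L μ σ) {t : ℝ} (ht : 0 ≤ t) {x : W} {X₁ X₂ : ℝ → W}
    (h₁ : IsRDESolution α T Z ZZ μ σ t x X₁) (h₂ : IsRDESolution α T Z ZZ μ σ t x X₂) :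
    EqOn X₁ X₂ (Icc t T) := by
  obtain ⟨C₁, -, hd₁⟩ := h₁.isDavie hα hα' hZ hc ht
  obtain ⟨C₂, -, hd₂⟩ := h₂.isDavie hα hα' hZ hc ht
  exact hd₁.eqOn hα hα' hZ hc ht le_rfl hd₂ (h₁.initial.trans h₂.initial.symm)

/-- Uniqueness is applied twice: on `[u, v]` the solution from `x` follows the flow and reaches `Φ u
v x`, and on `[v, T]` it coincides with the solution restarted from there. Both therefore have the
same value at `T`. -/
theorem exists_isTransported (hα : 1 / 3 < α) (hα' : α ≤ 1 / 2) (hT : 0 ≤ T)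
    (hZ : RoughBound α T M Z ZZ) (hμ : IsBL (univ : Set W) 2 μ) (hσ : IsBL (univ : Set W) 4 σ)
    {X : ℝ → W → ℝ → W} (hX : ∀ t ∈ Icc 0 T, ∀ x, IsRDESolution α T Z ZZ μ σ t x (X t x))
    {f : W → U} (hf : ∀ R, ∃ K, 0 ≤ K ∧ C21On (Metric.closedBall 0 R) K f) {F : ℝ → W → U}
    (hF : ∀ t x, F t x = f (X t x T)) :
    ∃ h₀ D Φ, 0 < h₀ ∧ h₀ ≤ 1 ∧ IsTransported α T h₀ D Z ZZ μ σ Φ F := by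
  obtain ⟨L, hc⟩ := IsBL.coefBound convex_univ hμ.of_succ.of_succ hσ.of_succ.of_succ
  obtain ⟨C, h₀, hC, h0, h1, hflow⟩ := local_flow hα hα' hZ hμ hσ
  obtain ⟨D, hD, hbd⟩ := IsFlowMap.flowBound hα hα' hZ hc hC
  choose! Φ hΦ using hflow
  have hcomp : ∀ u v, 0 ≤ u → u < v → v ≤ T → v - u ≤ h₀ → ∀ x, F u x = F v (Φ u v x) := by
    intro u v k1 k2 k3 k4 x
    have hXu := hX u ⟨k1, by linarith⟩ x
    have hXv := hX v ⟨by linarith, k3⟩ (Φ u v x)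
    obtain ⟨C₁, -, hd₁⟩ := hXu.isDavie hα hα' hZ hc k1
    obtain ⟨C₂, -, hd₂⟩ := hXv.isDavie hα hα' hZ hc (by linarith)
    obtain ⟨V, hV, hV', hd⟩ := (hΦ u v k1 k2 k3 k4).davie x
    have e1 := (hd₁.mono le_rfl k3).eqOn hα hα' hZ hc k1 k3 hd (hXu.initial.trans hV.symm)
      ⟨k2.le, le_rfl⟩
    have e2 := (hd₁.mono k2.le le_rfl).eqOn hα hα' hZ hc (by linarith) le_rfl hd₂
      (e1.trans (hV'.trans hXv.initial.symm)) ⟨k3, le_rfl⟩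
    rw [hF, hF, e2]
  have hbd' : ∀ u v, 0 ≤ u → u < v → v ≤ T → v - u ≤ h₀ →
      FlowBound Z ZZ μ σ D ((v - u) ^ α) u v (Φ u v) := fun u v k1 k2 k3 k4 =>
    hbd u v _ k1 k2 k3 (k4.trans h1) (hΦ u v k1 k2 k3 k4)
  have hFT : F T = f := by
    ext1 x
    rw [hF, (hX T ⟨hT, le_rfl⟩ x).initial]
  exact ⟨h₀, D, Φ, h0, h1, hD, hbd', fun u v k1 k2 k3 k4 => funext (hcomp u v k1 k2 k3 k4),
    exists_uniform_c21On (by linarith) hD h0 h1 (fun u v k1 k2 k3 k4 =>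
      ⟨Φ u v, hbd' u v k1 k2 k3 k4, hcomp u v k1 k2 k3 k4⟩) (by rw [hFT]; exact hf)⟩

end TransportedFamily

end

/-! ### The main theorem. -/

theorem mainTheorem4 (dX dZ : ℕ) (α T : ℝ) (hα : 1 / 3 < α) (hα' : α ≤ 1 / 2) (hT : 0 < T)
    (Z : ℝ → EuclideanSpace ℝ (Fin dZ)) (ZZ : ℝ → ℝ → Matrix (Fin dZ) (Fin dZ) ℝ)
    (hZ : IsWeaklyGeometricRoughPath α T Z ZZ)
    (Y : ℝ → EuclideanSpace ℝ (Fin dX))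
    (Y' : ℝ → EuclideanSpace ℝ (Fin dZ) →L[ℝ] EuclideanSpace ℝ (Fin dX))
    (Y'' : ℝ → EuclideanSpace ℝ (Fin dZ) →L[ℝ] EuclideanSpace ℝ (Fin dZ) →L[ℝ]
      EuclideanSpace ℝ (Fin dX))
    (Ydot : ℝ → EuclideanSpace ℝ (Fin dX))
    (hY : IsStronglyControlled α T Z ZZ Y Y' Y'' Ydot)
    (μ : EuclideanSpace ℝ (Fin dX) → EuclideanSpace ℝ (Fin dX)) (hμ : IsSteinLip 2 μ)
    (σ : EuclideanSpace ℝ (Fin dX) →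
      EuclideanSpace ℝ (Fin dZ) →L[ℝ] EuclideanSpace ℝ (Fin dX)) (hσ : IsSteinLip 4 σ)
    (f : EuclideanSpace ℝ (Fin dX) → EuclideanSpace ℝ (Fin dX))
    (hf : ContDiff ℝ 2 f) (hf' : LocallyLipschitz (iteratedFDeriv ℝ 2 f)) :
    -- the rough differential equation is well posed
    (∀ t ∈ Set.Icc 0 T, ∀ x : EuclideanSpace ℝ (Fin dX),
      (∃ X, IsRDESolution α T Z ZZ μ σ t x X) ∧
      ∀ X₁ X₂, IsRDESolution α T Z ZZ μ σ t x X₁ → IsRDESolution α T Z ZZ μ σ t x X₂ →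
        Set.EqOn X₁ X₂ (Set.Icc t T)) ∧
    -- the formula, with `X t x` the solution started at time `t` from `x`
    ∀ X : ℝ → EuclideanSpace ℝ (Fin dX) → ℝ → EuclideanSpace ℝ (Fin dX),
      (∀ t ∈ Set.Icc 0 T, ∀ x, IsRDESolution α T Z ZZ μ σ t x (X t x)) →
      ∀ F : ℝ → EuclideanSpace ℝ (Fin dX) → EuclideanSpace ℝ (Fin dX),
        (∀ t x, F t x = f (X t x T)) →
        (∀ t ∈ Set.Icc 0 T, ContDiff ℝ 2 (F t)) ∧
        IsControlled α 0 T Z (agIntegrand σ F Y Y') (agIntegrandDeriv σ F Y Y' Y'') ∧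
        ∀ s t, 0 ≤ s → s ≤ t → t ≤ T →
          IntervalIntegrable (fun r => fderiv ℝ (F r) (Y r) (Ydot r - μ (Y r)))
            MeasureTheory.volume s t ∧
          HasRoughIntegral Z ZZ (agIntegrand σ F Y Y') (agIntegrandDeriv σ F Y Y' Y'') s t
            (F t (Y t) - F s (Y s) - ∫ r in s..t, fderiv ℝ (F r) (Y r) (Ydot r - μ (Y r))) := by
  obtain ⟨M, hM⟩ := hZ.roughBound
  have hμ' := hμ.isBL
  have hσ' := hσ.isBL
  -- Well-posedness uses only two derivatives of `σ` and a Lipschitz drift; the full regularity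
  -- serves the differentiability of the flow.
  obtain ⟨L, hc⟩ := IsBL.coefBound convex_univ hμ'.of_succ.of_succ hσ'.of_succ.of_succ
  refine ⟨fun t ht x => ⟨?_, fun X₁ X₂ h₁ h₂ => h₁.eqOn hα hα' hM hc ht.1 h₂⟩,
    fun X hX F hF => ?_⟩
  · obtain ⟨X, rfl, C, hC, hX⟩ := exists_davie hα hα' hM hc ht.1 ht.2 x
    exact ⟨X, hX.isRDESolution hα hα' hM hc hC ht.1⟩
  · obtain ⟨h₀, D, Φ, h0, h1, hΦ⟩ := exists_isTransported hα hα' hT.le hM hμ' hσ' hX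
      (C21On.of_locallyLipschitz hf hf') hF
    have hα0 : 0 < α := by linarith
    have hY' := hY.isLocStrong hα0 hα' h0 h1 hT hM
    choose K _ hK using hΦ.c21
    exact ⟨fun t ht => C21On.contDiff fun R => hK R t ht.1 ht.2,
      hΦ.isControlled hα0 h0 h1 hM hσ'.of_succ.of_succ.of_succ hY',
      fun s t hs hst ht => hΦ.hasRoughIntegral hα hα' h0 h1 hZ hM hμ'.of_succ.of_succ
        hσ'.of_succ.of_succ hY' hs hst ht⟩
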